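/- **Setting.** Let $\mathcal G$ be a connected graph in the sense of Serre, with vertex set $V(\mathcal G)$, edge set $E(\mathcal G)$, source and range maps $s,r$ and edge reversal $e\mapsto\bar e\neq e$. Let $(\mathcal G,(A_q)_q,(B_e)_e)$ be a graph of unital C\*-algebras: $A_q$ ($q\in V(\mathcal G)$) and $B_e=B_{\bar e}$ ($e\in E(\mathcal G)$) are unital C\*-algebras, $s_e:B_e\to A_{s(e)}$ is a faithful unital $*$-homomorphism for each edge $e$, and $r_e:=s_{\bar e}:B_e\to A_{r(e)}$. For each $e$ let $E_e^s:A_{s(e)}\to s_e(B_e)$ be a conditional expectation (not assumed GNS-faithful). Fix a maximal subtree $\mathcal T$ of $\mathcal G$, and for vertices $q,p$ let $g_{qp}$ be the geodesic path in $\mathcal T$ from $q$ to $p$. *Maximal algebra.* $P$ is the universal unital C\*-algebra generated by the $A_q$ and unitaries $u_e$, subject to $u_{\bar e}=u_e^*$, $u_{\bar e}s_e(b)u_e=r_e(b)$ for $b\in B_e$, and $u_e=1$ for $e\in E(\mathcal T)$ (the units of all $A_q$ are the unit of $P$). A *reduced operator from $p$ to $p$* is an element $a_0u_{e_1}a_1\cdots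 u_{e_n}a_n\in P$ with $n\ge1$, $(e_1,\dots,e_n)$ a path from $p$ to $p$, $a_0\in A_p$, $a_i\in A_{r(e_i)}$ for $1\le i\le n$, and $E^s_{e_{i+1}}(a_i)=0$ whenever $1\le i\le n-1$ and $e_{i+1}=\bar e_i$. *Reduced representations.* Let $(K_e^s,\rho_e^s,\eta_e^s)$ be the GNS construction of $s_e^{-1}\circ E_e^s:A_{s(e)}\to B_e$, and let $(K_e^s)^\circ$ be the closure of $\{\rho_e^s(a)\eta_e^s: E_e^s(a)=0\}$. For a path $w=(e_1,\dots,e_n)$ from $q$ to $p$ with $n\ge1$ let $H_w=K_0\otimes\cdots\otimes K_n$ (interior tensor product through the maps $r_{e_i}$, $1\le i\le n$), where $K_0=K_{e_1}^s$, $K_n=A_p$ and, for $1\le i\le n-1$, $K_i=(K_{e_{i+1}}^s)^\circ$ if $e_{i+1}=\bar e_i$ and $K_i=K_{e_{i+1}}^s$ otherwise. For the empty path at $p$ let $H_\emptyset=A_p$. Let $H_{q,p}=\bigoplus_w H_w$ over all paths from $q$ to $p$ (including the empty one if $q=p$), a Hilbert $A_p$-module, and let $\lambda_{q,p}$ be the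 left action of $A_q$ on it through the first tensor factor. The unitary $u_e^p:H_{r(e),p}\to H_{s(e),p}$ is determined by $u_e^p\xi=\eta_e^s\otimes\xi$ for $\xi\in H_w$ if $w$ does not begin with $\bar e$, and by $$u_e^p(\rho(a)\eta\otimes\xi')=\eta_e^s\otimes\rho(a-E(a))\eta\otimes\xi'+\lambda_{s(e),p}\bigl(r_{\bar e}(s_{\bar e}^{-1}(E(a)))\bigr)\xi'$$ if $w$ begins with $\bar e$, where $E=E_{\bar e}^s$, $\rho=\rho_{\bar e}^s$, $\eta=\eta_{\bar e}^s$. For a path $w=(e_1,\dots,e_n)$ put $u_w^p=u_{e_1}^p\cdots u_{e_n}^p$. Then $\lambda_p:P\to\mathcal L_{A_p}(H_{p,p})$ is the unital $*$-homomorphism with $\lambda_p(u_e)=(u^p_{g_{s(e)p}})^*u_e^pu^p_{g_{r(e)p}}$ and $\lambda_p(a)=(u^p_{g_{qp}})^*\lambda_{q,p}(a)u^p_{g_{qp}}$ for $a\in A_q$. *Vertex-reduced algebra.* $P_{\rm vert}$ is the separation-completion of $P$ for the C\*-seminorm $\|x\|_v=\sup_{p\in V(\mathcal G)}\|\lambda_p(x)\|$,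 and $\lambda:P\to P_{\rm vert}$ is the canonical surjection. A family of ucp maps $\varphi_i:D\to D_i$ is called *GNS-faithful* if $\bigcap_i\ker\pi_i=\{0\}$, where $(H_i,\pi_i,\xi_i)$ is a GNS construction of $\varphi_i$. **Proposition.** The following hold. 1. For every $p\in V(\mathcal G)$ the morphism $\lambda$ is faithful on $A_p$: the $*$-homomorphism $A_p\to P\xrightarrow{\lambda}P_{\rm vert}$ is injective. 2. For every $p\in V(\mathcal G)$ there is a unique ucp map $\mathbb E_{A_p}:P_{\rm vert}\to A_p$ such that $\mathbb E_{A_p}(\lambda(a))=a$ for all $a\in A_p$ and $\mathbb E_{A_p}(\lambda(x))=0$ for every reduced operator $x\in P$ from $p$ to $p$. Moreover, the family $\{\mathbb E_{A_p}:p\in V(\mathcal G)\}$ is GNS-faithful. 3. Let $C$ be a unital C\*-algebra, $\pi:P\to C$ a surjective unital $*$-homomorphism, and $E_{A_p}:C\to A_p$ ($p\in V(\mathcal G)$) ucp maps such that $E_{A_p}(\pi(a))=a$ for all $a\in A_p$ and $E_{A_p}(\pi(x))=0$ for every reduced operator $x\in P$ from $p$ to $p$, and such that the family $\{E_{A_p}:p\in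 V(\mathcal G)\}$ is GNS-faithful. Then there is a unique unital $*$-isomorphism $\nu:P_{\rm vert}\to C$ with $\nu\circ\lambda=\pi$. Moreover, $E_{A_p}\circ\nu=\mathbb E_{A_p}$ for all $p\in V(\mathcal G)$. -/

import Mathlib

open scoped CStarAlgebra

attribute [local instance] CStarAlgebra.spectralOrder CStarAlgebra.spectralOrderedRing

universe u v w x y

noncomputable section

/-- A C⋆-seminorm on a unital complex ⋆-algebra. -/
structure CStarSeminorm (R : Type*) [Ring R] [StarRing R] [Algebra ℂ R] extends
    Seminorm ℂ R where
  mul_le' : ∀ x y, toFun (x * y) ≤ toFun x * toFun y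
  star_mul_self' : ∀ x, toFun (star x * x) = toFun x * toFun x

namespace CStarSeminorm

section basic

variable {R : Type*} [Ring R] [StarRing R] [Algebra ℂ R]

theorem le_star (σ : CStarSeminorm R) (x : R) :
    σ.toSeminorm x ≤ σ.toSeminorm (star x) := by
  have h1 : σ.toSeminorm x * σ.toSeminorm x ≤ σ.toSeminorm (star x) * σ.toSeminorm x := by
    have := σ.mul_le' (star x) x
    rw [σ.star_mul_self'] at this
    exact this
  rcases (apply_nonneg σ.toSeminorm x).eq_or_lt with h | h
  · rw [← h]; exact apply_nonneg _ _
  · exact le_of_mul_le_mul_right h1 h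

theorem apply_star (σ : CStarSeminorm R) (x : R) :
    σ.toSeminorm (star x) = σ.toSeminorm x :=
  le_antisymm (by simpa using σ.le_star (star x)) (σ.le_star x)

/-- A copy of the ⋆-algebra `R`, seminormed by `σ`. -/
def Carrier (_σ : CStarSeminorm R) : Type _ := R

instance (σ : CStarSeminorm R) : Ring σ.Carrier := inferInstanceAs (Ring R)
instance (σ : CStarSeminorm R) : StarRing σ.Carrier := inferInstanceAs (StarRing R)
instance (σ : CStarSeminorm R) : Algebra ℂ σ.Carrier := inferInstanceAs (Algebra ℂ R)
instance (σ : CStarSeminorm R) [StarModule ℂ R] : StarModule ℂ σ.Carrier :=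
  inferInstanceAs (StarModule ℂ R)

instance (σ : CStarSeminorm R) : SeminormedRing σ.Carrier where
  __ := (inferInstance : Ring σ.Carrier)
  __ := σ.toSeminorm.toAddGroupSeminorm.toSeminormedAddCommGroup
  norm_mul_le x y := σ.mul_le' x y

theorem norm_carrier (σ : CStarSeminorm R) (x : σ.Carrier) : ‖x‖ = σ.toSeminorm x := rfl

instance (σ : CStarSeminorm R) : NormedSpace ℂ σ.Carrier where
  __ := (inferInstance : Algebra ℂ σ.Carrier).toModule
  norm_smul_le c x := (map_smul_eq_mul σ.toSeminorm c x).le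

/-- The separation-completion of a ⋆-algebra for a C⋆-seminorm. -/
def Completion (σ : CStarSeminorm R) : Type _ := UniformSpace.Completion σ.Carrier

instance (σ : CStarSeminorm R) : NormedRing σ.Completion :=
  inferInstanceAs (NormedRing (UniformSpace.Completion σ.Carrier))

instance (σ : CStarSeminorm R) : CompleteSpace σ.Completion :=
  inferInstanceAs (CompleteSpace (UniformSpace.Completion σ.Carrier))

instance (σ : CStarSeminorm R) : NormedAlgebra ℂ σ.Completion where
  __ := (UniformSpace.Completion.algebra σ.Carrier ℂ)
  norm_smul_le c x := norm_smul_le (β := UniformSpace.Completion σ.Carrier) c x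

/-- The canonical map of `R` to its separation-completion. -/
def coe (σ : CStarSeminorm R) (x : R) : σ.Completion :=
  UniformSpace.Completion.coe' (α := σ.Carrier) x

variable (σ : CStarSeminorm R)

theorem norm_coe (x : R) : ‖σ.coe x‖ = σ.toSeminorm x :=
  UniformSpace.Completion.norm_coe (E := σ.Carrier) x

theorem denseRange_coe : DenseRange σ.coe :=
  UniformSpace.Completion.denseRange_coe (α := σ.Carrier)

theorem coe_add (x y : R) : σ.coe (x + y) = σ.coe x + σ.coe y :=
  UniformSpace.Completion.coe_add (α := σ.Carrier) x y

theorem coe_mul (x y : R) : σ.coe (x * y) = σ.coe x * σ.coe y :=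
  UniformSpace.Completion.coe_mul (α := σ.Carrier) x y

theorem coe_one : σ.coe 1 = 1 := rfl

theorem coe_smul (c : ℂ) (x : R) : σ.coe (c • x) = c • σ.coe x :=
  UniformSpace.Completion.coe_smul (M := ℂ) (X := σ.Carrier) c x

theorem induction₁ {p : σ.Completion → Prop} (x : σ.Completion)
    (hp : IsClosed {x | p x}) (h : ∀ x : R, p (σ.coe x)) : p x :=
  UniformSpace.Completion.induction_on (α := σ.Carrier) x hp h

theorem induction₂ {p : σ.Completion → σ.Completion → Prop} (x y : σ.Completion)
    (hp : IsClosed {x : σ.Completion × σ.Completion | p x.1 x.2})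
    (h : ∀ x y : R, p (σ.coe x) (σ.coe y)) : p x y :=
  UniformSpace.Completion.induction_on₂ (α := σ.Carrier) (β := σ.Carrier) x y hp h

theorem star_uc : UniformContinuous (fun x : σ.Carrier => (star x : σ.Carrier)) := by
  apply LipschitzWith.uniformContinuous (K := 1)
  refine LipschitzWith.of_dist_le_mul fun x y => ?_
  rw [dist_eq_norm, dist_eq_norm, ← star_sub, norm_carrier, norm_carrier]
  exact (σ.apply_star (x - y)).le.trans (one_mul _).ge

instance : Star σ.Completion where
  star := UniformSpace.Completion.map (fun x : σ.Carrier => (star x : σ.Carrier))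

theorem star_cont : Continuous (star : σ.Completion → σ.Completion) :=
  UniformSpace.Completion.continuous_map

theorem coe_star (x : R) : σ.coe (star x) = star (σ.coe x) :=
  (UniformSpace.Completion.map_coe σ.star_uc x).symm

instance : StarRing σ.Completion where
  star_involutive x := by
    refine σ.induction₁ (p := fun x => star (star x) = x) x ?_ fun x => ?_
    · exact isClosed_eq (σ.star_cont.comp σ.star_cont) continuous_id
    · rw [← coe_star, ← coe_star, star_star]
  star_mul x y := by
    refine σ.induction₂ (p := fun x y => star (x * y) = star y * star x) x y ?_ fun x y => ?_
    · exact isClosed_eq (σ.star_cont.comp (by fun_prop))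
        ((σ.star_cont.comp continuous_snd).mul (σ.star_cont.comp continuous_fst))
    · rw [← coe_mul, ← coe_star, ← coe_star, ← coe_star, ← coe_mul, star_mul]
  star_add x y := by
    refine σ.induction₂ (p := fun x y => star (x + y) = star x + star y) x y ?_ fun x y => ?_
    · exact isClosed_eq (σ.star_cont.comp (by fun_prop))
        ((σ.star_cont.comp continuous_fst).add (σ.star_cont.comp continuous_snd))
    · rw [← coe_add, ← coe_star, ← coe_star, ← coe_star, ← coe_add, star_add]

instance : CStarRing σ.Completion where
  norm_mul_self_le x := by
    refine σ.induction₁ (p := fun x => ‖x‖ * ‖x‖ ≤ ‖star x * x‖) x ?_ fun x => ?_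
    · exact isClosed_le (by fun_prop) ((σ.star_cont.mul continuous_id).norm)
    · rw [← coe_star, ← coe_mul, norm_coe, norm_coe]
      exact (σ.star_mul_self' x).ge

end basic

variable {R : Type*} [Ring R] [StarRing R] [Algebra ℂ R] [StarModule ℂ R] (σ : CStarSeminorm R)

instance : StarModule ℂ σ.Completion where
  star_smul c x := by
    refine σ.induction₁ (p := fun x => star (c • x) = star c • star x) x ?_ fun x => ?_
    · exact isClosed_eq (σ.star_cont.comp (continuous_const_smul c))
        ((continuous_const_smul (star c)).comp σ.star_cont)
    · rw [← coe_smul, ← coe_star, ← coe_star, ← coe_smul, star_smul]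

instance : CStarAlgebra σ.Completion where

/-- The canonical ⋆-homomorphism of `R` to its separation-completion. -/
def toCompletion : R →⋆ₐ[ℂ] σ.Completion where
  toFun := σ.coe
  map_one' := σ.coe_one
  map_mul' := σ.coe_mul
  map_zero' := rfl
  map_add' := σ.coe_add
  commutes' _ := rfl
  map_star' := σ.coe_star

theorem norm_toCompletion (x : R) : ‖σ.toCompletion x‖ = σ.toSeminorm x := σ.norm_coe x

theorem denseRange_toCompletion : DenseRange σ.toCompletion := σ.denseRange_coe

variable {C : Type*} [CStarAlgebra C]

/-- The C⋆-seminorm induced by a ⋆-homomorphism to a C⋆-algebra. -/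
def ofHom (φ : R →⋆ₐ[ℂ] C) : CStarSeminorm R where
  toFun x := ‖φ x‖
  map_zero' := by simp
  add_le' x y := by rw [map_add]; exact norm_add_le _ _
  neg' x := by rw [map_neg, norm_neg]
  smul' c x := by rw [map_smul, norm_smul]
  mul_le' x y := by rw [map_mul]; exact norm_mul_le _ _
  star_mul_self' x := by rw [map_mul, map_star, CStarRing.norm_star_mul_self]

theorem lift_uc (φ : R →⋆ₐ[ℂ] C) (h : ∀ x, ‖φ x‖ ≤ σ.toSeminorm x) :
    UniformContinuous (fun x : σ.Carrier => (φ x : C)) := by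
  apply LipschitzWith.uniformContinuous (K := 1)
  refine LipschitzWith.of_dist_le_mul fun x y => ?_
  rw [dist_eq_norm, dist_eq_norm, norm_carrier]
  have e : φ (x - y) = φ x - φ y := _root_.map_sub φ (x : R) (y : R)
  rw [← e]
  exact (h (x - y)).trans (one_mul _).ge

/-- A ⋆-homomorphism dominated by `σ` extends to the separation-completion. -/
def lift (φ : R →⋆ₐ[ℂ] C) (h : ∀ x, ‖φ x‖ ≤ σ.toSeminorm x) : σ.Completion →⋆ₐ[ℂ] C :=
  let f : σ.Completion → C := UniformSpace.Completion.extension (fun x : σ.Carrier => (φ x : C))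
  have hc : Continuous f := UniformSpace.Completion.continuous_extension
  have hf : ∀ x, f (σ.coe x) = φ x := fun x =>
    UniformSpace.Completion.extension_coe (σ.lift_uc φ h) x
  { toFun := f
    map_one' := by rw [← σ.coe_one, hf, map_one]
    map_mul' := fun x y => by
      refine σ.induction₂ (p := fun x y => f (x * y) = f x * f y) x y ?_ fun x y => ?_
      · exact isClosed_eq (hc.comp (by fun_prop))
          ((hc.comp continuous_fst).mul (hc.comp continuous_snd))
      · rw [← coe_mul, hf, hf, hf, map_mul]
    map_zero' := by
      have := hf 0
      rw [map_zero] at this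
      exact this
    map_add' := fun x y => by
      refine σ.induction₂ (p := fun x y => f (x + y) = f x + f y) x y ?_ fun x y => ?_
      · exact isClosed_eq (hc.comp (by fun_prop))
          ((hc.comp continuous_fst).add (hc.comp continuous_snd))
      · rw [← coe_add, hf, hf, hf, map_add]
    commutes' := fun c => by
      have := hf (algebraMap ℂ R c)
      rw [AlgHomClass.commutes] at this
      exact this
    map_star' := fun x => by
      refine σ.induction₁ (p := fun x => f (star x) = star (f x)) x ?_ fun x => ?_
      · exact isClosed_eq (hc.comp σ.star_cont) (continuous_star.comp hc)
      · rw [← coe_star, hf, hf, map_star] }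

theorem lift_toCompletion (φ : R →⋆ₐ[ℂ] C) (h : ∀ x, ‖φ x‖ ≤ σ.toSeminorm x) (x : R) :
    σ.lift φ h (σ.toCompletion x) = φ x :=
  UniformSpace.Completion.extension_coe (σ.lift_uc φ h) x

end CStarSeminorm

/-- A right pre-Hilbert module over a C⋆-algebra `A`: the inner product is `A`-valued, linear in
the second variable and positive semidefinite. -/
class PreHilbertModule (A E : Type*) [CStarAlgebra A] [AddCommGroup E] [Module ℂ E]
    [Module Aᵐᵒᵖ E] extends Inner A E where
  inner_add_right : ∀ x y z : E, inner x (y + z) = inner x y + inner x z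
  inner_smul_right : ∀ (c : ℂ) (x y : E), inner x (c • y) = c • inner x y
  inner_op_smul_right : ∀ (a : A) (x y : E), inner x (MulOpposite.op a • y) = inner x y * a
  star_inner : ∀ x y : E, star (inner x y) = inner y x
  inner_self_nonneg : ∀ x : E, 0 ≤ inner x x

/-- A (right) Hilbert C⋆-module over `A`: a pre-Hilbert module that is complete for the norm
`‖x‖ = ‖⟨x, x⟩‖ ^ (1 / 2)`. -/
class HilbertModule (A E : Type*) [CStarAlgebra A] [NormedAddCommGroup E] [NormedSpace ℂ E]
    [Module Aᵐᵒᵖ E] extends PreHilbertModule A E, CompleteSpace E where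
  norm_mul_self : ∀ x : E, ‖x‖ * ‖x‖ = ‖inner x x‖

namespace PreHilbertModule

variable {A E : Type*} [CStarAlgebra A] [AddCommGroup E] [Module ℂ E] [Module Aᵐᵒᵖ E]
  [PreHilbertModule A E]

theorem inner_add_left (x y z : E) : inner A (x + y) z = inner A x z + inner A y z := by
  rw [← star_inner, inner_add_right, star_add, star_inner, star_inner]

theorem inner_smul_left (c : ℂ) (x y : E) : inner A (c • x) y = star c • inner A x y := by
  rw [← star_inner, inner_smul_right, star_smul, star_inner]

theorem inner_op_smul_left (a : A) (x y : E) :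
    inner A (MulOpposite.op a • x) y = star a * inner A x y := by
  rw [← star_inner, inner_op_smul_right, star_mul, star_inner]

/-- The inner product, as a linear map in the second variable. -/
def innerₗ (x : E) : E →ₗ[ℂ] A where
  toFun := inner A x
  map_add' := inner_add_right x
  map_smul' c := inner_smul_right c x

theorem inner_neg_right (x y : E) : inner A x (-y) = -inner A x y := map_neg (innerₗ x) y

theorem inner_sub_right (x y z : E) : inner A x (y - z) = inner A x y - inner A x z :=
  map_sub (innerₗ x) y z

theorem inner_sub_left (x y z : E) : inner A (x - y) z = inner A x z - inner A y z := by
  rw [← star_inner, inner_sub_right, star_sub, star_inner, star_inner]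

theorem inner_zero_right (x : E) : inner A x (0 : E) = 0 := map_zero (innerₗ x)

theorem inner_zero_left (x : E) : inner A (0 : E) x = 0 := by
  rw [← star_inner, inner_zero_right, star_zero]

/-- The Cauchy-Schwarz inequality. -/
theorem norm_inner_mul_self_le (x y : E) :
    ‖inner A x y‖ * ‖inner A x y‖ ≤ ‖inner A x x‖ * ‖inner A y y‖ := by
  set a := inner A x y with ha
  have key : ∀ t : ℝ, 0 < t → ‖inner A x x‖ ≤ t → ‖a‖ * ‖a‖ ≤ t * ‖inner A y y‖ := by
    intro t ht hxt
    have h1 : (0 : A) ≤ inner A (MulOpposite.op a • x - (t : ℂ) • y)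
        (MulOpposite.op a • x - (t : ℂ) • y) := inner_self_nonneg _
    have h2 : inner A (MulOpposite.op a • x - (t : ℂ) • y)
        (MulOpposite.op a • x - (t : ℂ) • y) = star a * inner A x x * a
          - (2 * t) • (star a * a) + (t * t) • inner A y y := by
      rw [inner_sub_left, inner_sub_right, inner_sub_right, inner_op_smul_left,
        inner_op_smul_left, inner_smul_left, inner_smul_left, inner_smul_right, inner_smul_right,
        inner_op_smul_right, inner_op_smul_right, ← star_inner x y, ← ha, mul_smul_comm, two_mul,
        add_smul, mul_smul]
      simp only [Complex.star_def, Complex.conj_ofReal, Complex.coe_smul, mul_assoc]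
      abel
    have h3 : star a * inner A x x * a ≤ t • (star a * a) := by
      refine (CStarAlgebra.star_left_conjugate_le_norm_smul (a := a) (b := inner A x x)
        (star_inner x x)).trans ?_
      exact smul_le_smul_of_nonneg_right hxt (star_mul_self_nonneg a)
    rw [h2] at h1
    have h4 : t • (star a * a) ≤ t • (t • inner A y y) := by
      have h5 := h1.trans (add_le_add_left (sub_le_sub_right h3 _) _)
      rw [two_mul, add_smul, mul_smul, sub_add_eq_sub_sub, sub_self, zero_sub,
        neg_add_eq_sub, sub_nonneg] at h5
      exact h5
    have h6 : star a * a ≤ t • inner A y y := (smul_le_smul_iff_of_pos_left ht).1 h4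
    have h7 := CStarAlgebra.norm_le_norm_of_nonneg_of_le (star_mul_self_nonneg a) h6
    rwa [CStarRing.norm_star_mul_self, norm_smul, Real.norm_of_nonneg ht.le] at h7
  refine le_of_forall_pos_le_add fun ε hε => ?_
  have hy : 0 < ‖inner A y y‖ + 1 := by positivity
  refine (key (‖inner A x x‖ + ε / (‖inner A y y‖ + 1)) (by positivity)
    (le_add_of_nonneg_right (by positivity))).trans ?_
  rw [add_mul]
  refine add_le_add_right ?_ _
  rw [div_mul_eq_mul_div, div_le_iff₀ hy]
  nlinarith

variable (A) in
/-- The seminorm `‖⟨x, x⟩‖ ^ (1 / 2)` of a pre-Hilbert module. -/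
def seminorm : Seminorm ℂ E :=
  Seminorm.of (fun x : E => √‖inner A x x‖)
    (fun x y => by
      rw [Real.sqrt_le_left (by positivity)]
      have h : ∀ u v : E, ‖inner A u v‖ ≤ √‖inner A u u‖ * √‖inner A v v‖ := fun u v => by
        rw [← Real.sqrt_mul (norm_nonneg _)]
        exact Real.le_sqrt_of_sq_le (by rw [sq]; exact norm_inner_mul_self_le u v)
      have hx := Real.mul_self_sqrt (norm_nonneg (inner A x x))
      have hy := Real.mul_self_sqrt (norm_nonneg (inner A y y))
      rw [inner_add_left, inner_add_right, inner_add_right]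
      have h1 := norm_add_le (inner A x x + inner A x y) (inner A y x + inner A y y)
      have h2 := norm_add_le (inner A x x) (inner A x y)
      have h3 := norm_add_le (inner A y x) (inner A y y)
      have h4 := h x y
      have h5 := h y x
      nlinarith)
    (fun c x => by
      rw [inner_smul_left, inner_smul_right, smul_smul, norm_smul, Real.sqrt_mul (norm_nonneg _),
        norm_mul, norm_star, Real.sqrt_mul_self (norm_nonneg _)])

theorem seminorm_mul_self (x : E) : seminorm A x * seminorm A x = ‖inner A x x‖ :=
  Real.mul_self_sqrt (norm_nonneg _)

theorem norm_inner_le (x y : E) : ‖inner A x y‖ ≤ seminorm A x * seminorm A y := by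
  refine abs_le_of_sq_le_sq' ?_ (mul_nonneg (apply_nonneg _ _) (apply_nonneg _ _)) |>.2
  have := norm_inner_mul_self_le (A := A) x y
  rw [← seminorm_mul_self, ← seminorm_mul_self] at this
  nlinarith

end PreHilbertModule

/-- A positive definite `A`-valued kernel on a set `S`. -/
structure PosDefKernel (A S : Type*) [CStarAlgebra A] where
  toFun : S → S → A
  star_apply' : ∀ s t, star (toFun s t) = toFun t s
  nonneg' : ∀ v : S →₀ A, 0 ≤ v.sum fun s a => v.sum fun t b => star a * toFun s t * b

namespace PosDefKernel

variable {A S : Type*} [CStarAlgebra A]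

/-- The free right `A`-module on `S`, to be equipped with the inner product
`⟨s a, t b⟩ = a⋆ K(s, t) b`. -/
def Pre (_K : PosDefKernel A S) : Type _ := S →₀ A

variable (K : PosDefKernel A S)

instance : AddCommGroup K.Pre := inferInstanceAs (AddCommGroup (S →₀ A))
instance : Module ℂ K.Pre := inferInstanceAs (Module ℂ (S →₀ A))
instance : Module Aᵐᵒᵖ K.Pre := inferInstanceAs (Module Aᵐᵒᵖ (S →₀ A))
instance : SMulCommClass ℂ Aᵐᵒᵖ K.Pre := inferInstanceAs (SMulCommClass ℂ Aᵐᵒᵖ (S →₀ A))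

/-- The element `s a` of the free right module. -/
def single (s : S) (a : A) : K.Pre := (Finsupp.single s a : S →₀ A)

/-- The inner product on the free right module. -/
def preInner (v w : S →₀ A) : A :=
  v.sum fun s a => w.sum fun t b => star a * K.toFun s t * b

theorem preInner_add (v w x : S →₀ A) :
    K.preInner v (w + x) = K.preInner v w + K.preInner v x := by
  rw [preInner, preInner, preInner, ← Finsupp.sum_add]
  refine Finsupp.sum_congr fun s _ => ?_
  exact Finsupp.sum_add_index' (by simp) (by simp [mul_add])

theorem preInner_smul (c : ℂ) (v w : S →₀ A) :
    K.preInner v (c • w) = c • K.preInner v w := by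
  rw [preInner, preInner, Finsupp.smul_sum]
  refine Finsupp.sum_congr fun s _ => ?_
  rw [Finsupp.sum_smul_index' (by simp), Finsupp.smul_sum]
  simp only [mul_smul_comm]

theorem preInner_op_smul (a : A) (v w : S →₀ A) :
    K.preInner v (MulOpposite.op a • w) = K.preInner v w * a := by
  rw [preInner, preInner, Finsupp.sum_mul]
  refine Finsupp.sum_congr fun s _ => ?_
  rw [Finsupp.sum_smul_index' (by simp), Finsupp.sum_mul]
  simp only [MulOpposite.smul_eq_mul_unop, MulOpposite.unop_op, mul_assoc]

theorem preInner_star (v w : S →₀ A) : star (K.preInner v w) = K.preInner w v := by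
  rw [preInner, preInner, Finsupp.sum_comm]
  simp only [Finsupp.sum, star_sum, star_mul, star_star, K.star_apply', mul_assoc]

theorem single_add (s : S) (a b : A) : K.single s (a + b) = K.single s a + K.single s b :=
  Finsupp.single_add s a b

theorem op_smul_single (s : S) (a b : A) :
    MulOpposite.op a • K.single s b = K.single s (b * a) :=
  Finsupp.smul_single (M := A) (MulOpposite.op a) s b

theorem smul_single (s : S) (c : ℂ) (b : A) : c • K.single s b = K.single s (c • b) :=
  Finsupp.smul_single (M := A) c s b

theorem single_induction {p : K.Pre → Prop} (v : K.Pre) (h0 : p 0)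
    (hadd : ∀ v w, p v → p w → p (v + w)) (hs : ∀ s a, p (K.single s a)) : p v :=
  Finsupp.induction_linear (M := A) v h0 hadd hs

instance : PreHilbertModule A K.Pre where
  inner v w := K.preInner v w
  inner_add_right := K.preInner_add
  inner_smul_right := K.preInner_smul
  inner_op_smul_right := K.preInner_op_smul
  star_inner := K.preInner_star
  inner_self_nonneg := K.nonneg'

theorem inner_eq (v w : K.Pre) : inner A v w = K.preInner v w := rfl

theorem inner_single (s t : S) (a b : A) :
    inner A (K.single s a) (K.single t b) = star a * K.toFun s t * b := by
  change K.preInner (Finsupp.single s a) (Finsupp.single t b) = _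
  rw [preInner]
  exact (Finsupp.sum_single_index (by simp)).trans (Finsupp.sum_single_index (by simp))

instance : SeminormedAddCommGroup K.Pre :=
  (PreHilbertModule.seminorm A (E := K.Pre)).toAddGroupSeminorm.toSeminormedAddCommGroup

theorem norm_pre (v : K.Pre) : ‖v‖ = PreHilbertModule.seminorm A v := rfl

theorem norm_pre_mul_self (v : K.Pre) : ‖v‖ * ‖v‖ = ‖inner A v v‖ :=
  PreHilbertModule.seminorm_mul_self v

instance : NormedSpace ℂ K.Pre where
  __ := (inferInstance : Module ℂ K.Pre)
  norm_smul_le c x := (map_smul_eq_mul (PreHilbertModule.seminorm A (E := K.Pre)) c x).le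

theorem norm_op_smul_le (a : A) (v : K.Pre) : ‖MulOpposite.op a • v‖ ≤ ‖a‖ * ‖v‖ := by
  refine abs_le_of_sq_le_sq' ?_ (mul_nonneg (norm_nonneg _) (norm_nonneg _)) |>.2
  rw [sq, norm_pre_mul_self, PreHilbertModule.inner_op_smul_right,
    PreHilbertModule.inner_op_smul_left]
  refine (norm_mul_le _ _).trans ((mul_le_mul_of_nonneg_right (norm_mul_le _ _)
    (norm_nonneg _)).trans ?_)
  rw [norm_star, ← norm_pre_mul_self]
  exact le_of_eq (by ring)

instance : UniformContinuousConstSMul Aᵐᵒᵖ K.Pre where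
  uniformContinuous_const_smul a := by
    apply LipschitzWith.uniformContinuous (K := ‖a.unop‖₊)
    refine LipschitzWith.of_dist_le_mul fun x y => ?_
    rw [dist_eq_norm, dist_eq_norm, ← smul_sub]
    exact K.norm_op_smul_le a.unop (x - y)

/-- The inner product, as a continuous sesquilinear map. -/
def preInnerSL : K.Pre →L⋆[ℂ] K.Pre →L[ℂ] A :=
  LinearMap.mkContinuous₂
    { toFun := fun v => PreHilbertModule.innerₗ (A := A) v
      map_add' := fun v w => LinearMap.ext fun x => PreHilbertModule.inner_add_left (A := A) v w x
      map_smul' := fun c v =>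
        LinearMap.ext fun x => PreHilbertModule.inner_smul_left (A := A) c v x } 1
    (fun v w => by
      rw [one_mul]
      exact PreHilbertModule.norm_inner_le (A := A) v w)

/-- The Hilbert `A`-module generated by the elements of `S`, with inner products given by the
kernel: the separation-completion of the free right module. -/
def Mod : Type _ := UniformSpace.Completion K.Pre

instance : NormedAddCommGroup K.Mod :=
  inferInstanceAs (NormedAddCommGroup (UniformSpace.Completion K.Pre))
instance : NormedSpace ℂ K.Mod := inferInstanceAs (NormedSpace ℂ (UniformSpace.Completion K.Pre))
instance : Module Aᵐᵒᵖ K.Mod := inferInstanceAs (Module Aᵐᵒᵖ (UniformSpace.Completion K.Pre))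
instance : UniformContinuousConstSMul Aᵐᵒᵖ K.Mod :=
  inferInstanceAs (UniformContinuousConstSMul Aᵐᵒᵖ (UniformSpace.Completion K.Pre))
instance : CompleteSpace K.Mod := inferInstanceAs (CompleteSpace (UniformSpace.Completion K.Pre))

/-- The canonical map to the completion. -/
def toMod : K.Pre →ₗᵢ[ℂ] K.Mod := UniformSpace.Completion.toComplₗᵢ

theorem denseRange_toMod : DenseRange K.toMod :=
  UniformSpace.Completion.denseRange_coe (α := K.Pre)

theorem toMod_op_smul (a : Aᵐᵒᵖ) (v : K.Pre) : K.toMod (a • v) = a • K.toMod v :=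
  UniformSpace.Completion.coe_smul (M := Aᵐᵒᵖ) (X := K.Pre) a v

theorem isDenseInducing_toMod : IsDenseInducing K.toMod :=
  UniformSpace.Completion.isDenseInducing_coe (α := K.Pre)

theorem induction₁ {p : K.Mod → Prop} (x : K.Mod)
    (hp : IsClosed {x | p x}) (h : ∀ v : K.Pre, p (K.toMod v)) : p x :=
  UniformSpace.Completion.induction_on (α := K.Pre) x hp h

/-- The inner product on the completion. -/
def modInner : K.Mod → K.Mod → A :=
  Function.curry <| (K.isDenseInducing_toMod.prodMap K.isDenseInducing_toMod).extend
      fun p : K.Pre × K.Pre => K.preInnerSL p.1 p.2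

theorem continuous_modInner : Continuous fun p : K.Mod × K.Mod => K.modInner p.1 p.2 := by
  let f : K.Pre →+ K.Pre →+ A :=
    { toFun := fun x => (K.preInnerSL x).toLinearMap.toAddMonoidHom
      map_zero' := by ext x; simp
      map_add' := fun x y => by ext z; simp }
  have hf : Continuous fun p : K.Pre × K.Pre => f p.1 p.2 := by
    change Continuous fun p : K.Pre × K.Pre => K.preInnerSL p.1 p.2
    fun_prop
  exact K.isDenseInducing_toMod.extend_Z_bilin
    (e := (K.toMod.toLinearMap.toAddMonoidHom)) (f := (K.toMod.toLinearMap.toAddMonoidHom))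
    (φ := f)
    K.isDenseInducing_toMod hf

theorem modInner_toMod (v w : K.Pre) : K.modInner (K.toMod v) (K.toMod w) = inner A v w := by
  have hf : Continuous fun p : K.Pre × K.Pre => K.preInnerSL p.1 p.2 := by fun_prop
  exact (K.isDenseInducing_toMod.prodMap K.isDenseInducing_toMod).extend_eq hf (v, w)

theorem continuous_op_smul (a : A) : Continuous fun y : K.Mod => MulOpposite.op a • y :=
  UniformContinuous.continuous (uniformContinuous_const_smul (MulOpposite.op a))

theorem modInner_op_smul (a : A) (x y : K.Mod) :
    K.modInner x (MulOpposite.op a • y) = K.modInner x y * a := by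
  have h := K.continuous_modInner
  have hs := K.continuous_op_smul a
  have h1 : IsClosed {x : K.Mod | K.modInner x (MulOpposite.op a • y) = K.modInner x y * a} :=
    isClosed_eq (h.comp (continuous_id.prodMk continuous_const))
        ((h.comp (continuous_id.prodMk continuous_const)).mul continuous_const)
  refine K.induction₁ x h1 fun x => ?_
  have h2 : IsClosed {y : K.Mod | K.modInner (K.toMod x) (MulOpposite.op a • y) =
      K.modInner (K.toMod x) y * a} :=
    isClosed_eq (h.comp (continuous_const.prodMk hs))
        ((h.comp (continuous_const.prodMk continuous_id)).mul continuous_const)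
  refine K.induction₁ y h2 fun y => ?_
  rw [← toMod_op_smul, modInner_toMod, modInner_toMod]
  exact PreHilbertModule.inner_op_smul_right a x y

theorem modInner_smul (c : ℂ) (x y : K.Mod) :
    K.modInner x (c • y) = c • K.modInner x y := by
  have h := K.continuous_modInner
  have hs : Continuous fun y : K.Mod => c • y := continuous_const_smul c
  have h1 : IsClosed {x : K.Mod | K.modInner x (c • y) = c • K.modInner x y} :=
    isClosed_eq (h.comp (continuous_id.prodMk continuous_const))
        ((continuous_const_smul c).comp (h.comp (continuous_id.prodMk continuous_const)))
  refine K.induction₁ x h1 fun x => ?_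
  have h2 : IsClosed {y : K.Mod | K.modInner (K.toMod x) (c • y) =
      c • K.modInner (K.toMod x) y} :=
    isClosed_eq (h.comp (continuous_const.prodMk hs))
        ((continuous_const_smul c).comp (h.comp (continuous_const.prodMk continuous_id)))
  refine K.induction₁ y h2 fun y => ?_
  rw [← map_smul, modInner_toMod, modInner_toMod]
  exact PreHilbertModule.inner_smul_right c x y

instance : HilbertModule A K.Mod where
  inner := K.modInner
  inner_add_right x y z := by
    have h := K.continuous_modInner
    refine K.induction₁ (p := fun x => K.modInner x (y + z) = K.modInner x y + K.modInner x z) x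
      (isClosed_eq (by fun_prop) (by fun_prop)) fun x => ?_
    refine K.induction₁ (p := fun y => K.modInner _ (y + z) = K.modInner _ y + K.modInner _ z) y
      (isClosed_eq (by fun_prop) (by fun_prop)) fun y => ?_
    refine K.induction₁ (p := fun z => K.modInner _ (_ + z) = K.modInner _ _ + K.modInner _ z) z
      (isClosed_eq (by fun_prop) (by fun_prop)) fun z => ?_
    rw [← map_add, modInner_toMod, modInner_toMod, modInner_toMod]
    exact PreHilbertModule.inner_add_right x y z
  inner_smul_right := K.modInner_smul
  inner_op_smul_right := K.modInner_op_smul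
  star_inner x y := by
    have h := K.continuous_modInner
    refine K.induction₁ (p := fun x => star (K.modInner x y) = K.modInner y x) x
      (isClosed_eq (by fun_prop) (by fun_prop)) fun x => ?_
    refine K.induction₁ (p := fun y => star (K.modInner _ y) = K.modInner y _) y
      (isClosed_eq (by fun_prop) (by fun_prop)) fun y => ?_
    rw [modInner_toMod, modInner_toMod]
    exact PreHilbertModule.star_inner x y
  inner_self_nonneg x := by
    have h := K.continuous_modInner
    refine K.induction₁ (p := fun x => 0 ≤ K.modInner x x) x ?_ fun x => ?_
    · exact CStarAlgebra.isClosed_nonneg.preimage (f := fun x => K.modInner x x) (by fun_prop)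
    · rw [modInner_toMod]
      exact PreHilbertModule.inner_self_nonneg x
  norm_mul_self x := by
    have h := K.continuous_modInner
    refine K.induction₁ (p := fun x => ‖x‖ * ‖x‖ = ‖K.modInner x x‖) x
      (isClosed_eq (by fun_prop) (by fun_prop)) fun x => ?_
    rw [modInner_toMod, LinearIsometry.norm_map]
    exact K.norm_pre_mul_self x

theorem continuous_inner : Continuous fun p : K.Mod × K.Mod => (inner A p.1 p.2 : A) :=
  K.continuous_modInner

theorem inner_toMod (v w : K.Pre) : inner A (K.toMod v) (K.toMod w) = inner A v w :=
  K.modInner_toMod v w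

end PosDefKernel

theorem exists_eq_star_mul_self {A : Type*} [NonUnitalCStarAlgebra A] [PartialOrder A]
    [StarOrderedRing A] {a : A} (ha : 0 ≤ a) : ∃ b, a = star b * b :=
  CStarAlgebra.nonneg_iff_eq_star_mul_self.1 ha

namespace CStarMatrix

variable {A ι : Type*} [CStarAlgebra A] [Fintype ι]

theorem exists_gram {M : CStarMatrix ι ι A} (hM : 0 ≤ M) :
    ∃ N : CStarMatrix ι ι A, ∀ i j, M i j = ∑ k, star (N k i) * N k j := by
  obtain ⟨N, rfl⟩ := exists_eq_star_mul_self hM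
  exact ⟨N, fun i j => by simp [CStarMatrix.mul_apply, CStarMatrix.star_apply]⟩

theorem nonneg_of_gram {M N : CStarMatrix ι ι A}
    (h : ∀ i j, M i j = ∑ k, star (N k i) * N k j) : 0 ≤ M := by
  have : M = star N * N := by
    ext i j
    simp [h, CStarMatrix.mul_apply, CStarMatrix.star_apply]
  rw [this]
  exact star_mul_self_nonneg N

/-- Positive matrices give positive quadratic forms. -/
theorem sum_nonneg {M : CStarMatrix ι ι A} (hM : 0 ≤ M) (c : ι → A) :
    0 ≤ ∑ i, ∑ j, star (c i) * M i j * c j := by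
  obtain ⟨N, hN⟩ := exists_gram hM
  have : ∑ i, ∑ j, star (c i) * M i j * c j =
      ∑ k, star (∑ i, N k i * c i) * ∑ j, N k j * c j := by
    simp only [hN, star_sum, star_mul, Finset.sum_mul, Finset.mul_sum, mul_assoc]
    calc _ = ∑ i, ∑ k, ∑ j, star (c i) * (star (N k i) * (N k j * c j)) :=
          Finset.sum_congr rfl fun i _ => Finset.sum_comm
      _ = ∑ k, ∑ i, ∑ j, star (c i) * (star (N k i) * (N k j * c j)) := Finset.sum_comm
      _ = _ := Finset.sum_congr rfl fun k _ => Finset.sum_comm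
  rw [this]
  exact Finset.sum_nonneg fun k _ => star_mul_self_nonneg _

end CStarMatrix

/-- The adjointable operators from a Hilbert `A`-module `E` to a Hilbert `A`-module `F`. -/
structure Adjointable (A E F : Type*) [CStarAlgebra A]
    [NormedAddCommGroup E] [NormedSpace ℂ E] [Module Aᵐᵒᵖ E] [HilbertModule A E]
    [NormedAddCommGroup F] [NormedSpace ℂ F] [Module Aᵐᵒᵖ F] [HilbertModule A F] where
  toCLM : E →L[ℂ] F
  adjCLM : F →L[ℂ] E
  inner_adj : ∀ x y, inner A (toCLM x) y = inner A x (adjCLM y)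

namespace HilbertModule

variable {A E : Type*} [CStarAlgebra A]
    [NormedAddCommGroup E] [NormedSpace ℂ E] [Module Aᵐᵒᵖ E] [HilbertModule A E]

theorem norm_eq (x : E) : ‖x‖ = PreHilbertModule.seminorm A x := by
  rw [← mul_self_inj (norm_nonneg _) (apply_nonneg _ _), norm_mul_self (A := A),
    PreHilbertModule.seminorm_mul_self]

theorem norm_inner_le (x y : E) : ‖inner A x y‖ ≤ ‖x‖ * ‖y‖ := by
  rw [norm_eq (A := A) x, norm_eq (A := A) y]
  exact PreHilbertModule.norm_inner_le x y

variable (A) in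
theorem ext_inner {x y : E} (h : ∀ z, inner A z x = inner A z y) : x = y := by
  rw [← sub_eq_zero, ← norm_eq_zero, ← mul_self_eq_zero, norm_mul_self (A := A), norm_eq_zero,
    PreHilbertModule.inner_sub_right, h, sub_self]

end HilbertModule

namespace Adjointable

variable {A E F G : Type*} [CStarAlgebra A]
    [NormedAddCommGroup E] [NormedSpace ℂ E] [Module Aᵐᵒᵖ E] [HilbertModule A E]
    [NormedAddCommGroup F] [NormedSpace ℂ F] [Module Aᵐᵒᵖ F] [HilbertModule A F]
    [NormedAddCommGroup G] [NormedSpace ℂ G] [Module Aᵐᵒᵖ G] [HilbertModule A G]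

theorem inner_adj' (T : Adjointable A E F) (x : F) (y : E) :
    inner A (T.adjCLM x) y = inner A x (T.toCLM y) := by
  rw [← PreHilbertModule.star_inner, ← T.inner_adj, PreHilbertModule.star_inner]

@[ext]
theorem ext {T S : Adjointable A E F} (h : T.toCLM = S.toCLM) : T = S := by
  have h' : T.adjCLM = S.adjCLM := by
    ext y
    refine HilbertModule.ext_inner A fun z => ?_
    rw [← T.inner_adj, h, S.inner_adj]
  cases T; cases S; congr

theorem toCLM_injective : Function.Injective (toCLM : Adjointable A E F → E →L[ℂ] F) :=
  fun _ _ => ext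

/-- The adjoint operator. -/
def adjoint (T : Adjointable A E F) : Adjointable A F E where
  toCLM := T.adjCLM
  adjCLM := T.toCLM
  inner_adj := T.inner_adj'

/-- The identity operator. -/
protected def id : Adjointable A E E where
  toCLM := ContinuousLinearMap.id ℂ E
  adjCLM := ContinuousLinearMap.id ℂ E
  inner_adj _ _ := rfl

/-- The composition of adjointable operators. -/
def comp (T : Adjointable A F G) (S : Adjointable A E F) : Adjointable A E G where
  toCLM := T.toCLM.comp S.toCLM
  adjCLM := S.adjCLM.comp T.adjCLM
  inner_adj _ _ := (T.inner_adj _ _).trans (S.inner_adj _ _)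

theorem comp_assoc {H : Type*} [NormedAddCommGroup H] [NormedSpace ℂ H] [Module Aᵐᵒᵖ H]
    [HilbertModule A H] (R : Adjointable A G H) (T : Adjointable A F G) (S : Adjointable A E F) :
    (R.comp T).comp S = R.comp (T.comp S) := rfl

theorem comp_id (T : Adjointable A E F) : T.comp .id = T := rfl

theorem id_comp (T : Adjointable A E F) : Adjointable.comp .id T = T := rfl

theorem adjoint_comp (T : Adjointable A F G) (S : Adjointable A E F) :
    (T.comp S).adjoint = S.adjoint.comp T.adjoint := rfl

theorem adjoint_adjoint (T : Adjointable A E F) : T.adjoint.adjoint = T := rfl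

theorem norm_toCLM_le (T : Adjointable A E F) : ‖T.toCLM‖ ≤ ‖T.adjCLM‖ := by
  refine T.toCLM.opNorm_le_bound (norm_nonneg _) fun x => ?_
  have h1 : ‖T.toCLM x‖ * ‖T.toCLM x‖ ≤ (‖T.adjCLM‖ * ‖x‖) * ‖T.toCLM x‖ := by
    rw [HilbertModule.norm_mul_self (A := A), T.inner_adj]
    refine (HilbertModule.norm_inner_le _ _).trans ?_
    have := T.adjCLM.le_opNorm (T.toCLM x)
    nlinarith [norm_nonneg x]
  rcases (norm_nonneg (T.toCLM x)).eq_or_lt with h | h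
  · rw [← h]; positivity
  · exact le_of_mul_le_mul_right h1 h

theorem norm_adjCLM (T : Adjointable A E F) : ‖T.adjCLM‖ = ‖T.toCLM‖ :=
  le_antisymm T.adjoint.norm_toCLM_le T.norm_toCLM_le

instance : Zero (Adjointable A E F) where
  zero := ⟨0, 0, fun x y =>
    (PreHilbertModule.inner_zero_left y).trans (PreHilbertModule.inner_zero_right x).symm⟩

instance : Add (Adjointable A E F) where
  add T S := ⟨T.toCLM + S.toCLM, T.adjCLM + S.adjCLM, fun x y => by
    rw [add_apply, add_apply,
      PreHilbertModule.inner_add_left, PreHilbertModule.inner_add_right, T.inner_adj, S.inner_adj]⟩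

instance : SMul ℂ (Adjointable A E F) where
  smul c T := ⟨c • T.toCLM, star c • T.adjCLM, fun x y => by
    rw [smul_apply, smul_apply,
      PreHilbertModule.inner_smul_left, PreHilbertModule.inner_smul_right, T.inner_adj]⟩

instance : Neg (Adjointable A E F) where
  neg T := ⟨-T.toCLM, -T.adjCLM, fun x y => by
    rw [neg_apply, neg_apply,
      ← neg_one_smul ℂ (T.toCLM x), PreHilbertModule.inner_smul_left,
      PreHilbertModule.inner_neg_right, T.inner_adj]
    simp⟩

instance : Sub (Adjointable A E F) where
  sub T S := ⟨T.toCLM - S.toCLM, T.adjCLM - S.adjCLM, fun x y => by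
    rw [sub_apply, sub_apply,
      PreHilbertModule.inner_sub_left, PreHilbertModule.inner_sub_right, T.inner_adj, S.inner_adj]⟩

instance : SMul ℕ (Adjointable A E F) where
  smul n T := ⟨n • T.toCLM, n • T.adjCLM, fun x y => by
    rw [← Nat.cast_smul_eq_nsmul ℂ n T.toCLM, ← Nat.cast_smul_eq_nsmul ℂ n T.adjCLM,
      smul_apply, smul_apply,
      PreHilbertModule.inner_smul_left, PreHilbertModule.inner_smul_right, T.inner_adj]
    simp⟩

instance : SMul ℤ (Adjointable A E F) where
  smul n T := ⟨n • T.toCLM, n • T.adjCLM, fun x y => by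
    rw [← Int.cast_smul_eq_zsmul ℂ n T.toCLM, ← Int.cast_smul_eq_zsmul ℂ n T.adjCLM,
      smul_apply, smul_apply,
      PreHilbertModule.inner_smul_left, PreHilbertModule.inner_smul_right, T.inner_adj]
    simp⟩

instance : One (Adjointable A E E) := ⟨.id⟩

instance : Mul (Adjointable A E E) := ⟨.comp⟩

instance : Star (Adjointable A E E) := ⟨adjoint⟩

instance : NatCast (Adjointable A E E) := ⟨fun n => n • (1 : Adjointable A E E)⟩

instance : IntCast (Adjointable A E E) := ⟨fun n => n • (1 : Adjointable A E E)⟩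

instance : Pow (Adjointable A E E) ℕ := ⟨fun T n => npowRec n T⟩

theorem toCLM_pow (T : Adjointable A E E) (n : ℕ) : (T ^ n).toCLM = T.toCLM ^ n := by
  induction n with
  | zero => rfl
  | succ n ih =>
    rw [pow_succ, ← ih]
    rfl

instance : Ring (Adjointable A E E) :=
  toCLM_injective.ring (toCLM : Adjointable A E E → E →L[ℂ] E) rfl rfl (fun _ _ => rfl)
    (fun _ _ => rfl) (fun _ => rfl) (fun _ _ => rfl) (fun _ _ => rfl) (fun _ _ => rfl)
    toCLM_pow (fun n => by
      change n • (1 : E →L[ℂ] E) = n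
      simp) (fun n => by
      change n • (1 : E →L[ℂ] E) = n
      simp)

/-- The underlying operator, as a ring homomorphism. -/
def toCLMHom : Adjointable A E E →+* (E →L[ℂ] E) where
  toFun := toCLM
  map_one' := rfl
  map_mul' _ _ := rfl
  map_zero' := rfl
  map_add' _ _ := rfl

instance : NormedRing (Adjointable A E E) :=
  NormedRing.induced _ _ (toCLMHom (A := A) (E := E)) toCLM_injective

theorem norm_def (T : Adjointable A E E) : ‖T‖ = ‖T.toCLM‖ := rfl

instance : Module ℂ (Adjointable A E E) :=
  toCLM_injective.module ℂ (toCLMHom (A := A) (E := E)).toAddMonoidHom (fun _ _ => rfl)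

instance : Algebra ℂ (Adjointable A E E) :=
  Algebra.ofModule (fun c T S => ext (smul_mul_assoc c T.toCLM S.toCLM))
    (fun c T S => ext (mul_smul_comm c T.toCLM S.toCLM))

instance : NormedAlgebra ℂ (Adjointable A E E) where
  norm_smul_le c T := norm_smul_le c T.toCLM

instance : StarRing (Adjointable A E E) where
  star_involutive _ := rfl
  star_mul _ _ := rfl
  star_add _ _ := rfl

instance : StarModule ℂ (Adjointable A E E) where
  star_smul c T := ext (show star c • T.adjCLM = star c • T.adjCLM from rfl)

instance : CStarRing (Adjointable A E E) where
  norm_mul_self_le T := by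
    have h : ‖T.toCLM‖ ≤ √‖star T * T‖ := by
      refine T.toCLM.opNorm_le_bound (Real.sqrt_nonneg _) fun x => ?_
      refine abs_le_of_sq_le_sq' ?_ (by positivity) |>.2
      rw [mul_pow, Real.sq_sqrt (norm_nonneg _), sq, HilbertModule.norm_mul_self (A := A),
        T.inner_adj, sq]
      refine (HilbertModule.norm_inner_le _ _).trans ?_
      have := (star T * T).toCLM.le_opNorm x
      have h2 : (star T * T).toCLM x = T.adjCLM (T.toCLM x) := rfl
      rw [h2] at this
      rw [norm_def]
      nlinarith [norm_nonneg x]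
    have h3 := mul_self_le_mul_self (norm_nonneg T.toCLM) h
    rwa [Real.mul_self_sqrt (norm_nonneg _)] at h3

instance : CompleteSpace (Adjointable A E E) := by
  have hiso : Isometry (toCLMHom (A := A) (E := E)) :=
    AddMonoidHomClass.isometry_of_norm _ fun _ => rfl
  have : IsClosed (Set.range (toCLMHom (A := A) (E := E))) := by
    refine isClosed_of_closure_subset fun T hT => ?_
    obtain ⟨u, hu, hlim⟩ := mem_closure_iff_seq_limit.1 hT
    choose v hv using hu
    have hc : CauchySeq v := by
      have h1 := hlim.cauchySeq
      rw [Metric.cauchySeq_iff] at h1 ⊢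
      intro ε hε
      obtain ⟨N, hN⟩ := h1 ε hε
      refine ⟨N, fun m hm n hn => ?_⟩
      rw [← hiso.dist_eq, hv, hv]
      exact hN m hm n hn
    have hadj : CauchySeq fun n => (v n).adjCLM := by
      rw [Metric.cauchySeq_iff] at hc ⊢
      intro ε hε
      obtain ⟨N, hN⟩ := hc ε hε
      refine ⟨N, fun m hm n hn => ?_⟩
      have := hN m hm n hn
      rw [dist_eq_norm] at this ⊢
      rw [norm_def, ← norm_adjCLM] at this
      exact this
    obtain ⟨S, hS⟩ := cauchySeq_tendsto_of_complete hadj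
    refine ⟨⟨T, S, fun x y => ?_⟩, rfl⟩
    have hcont : Continuous fun p : E × E => (inner A p.1 p.2 : A) := by
      let f : E →L⋆[ℂ] E →L[ℂ] A := LinearMap.mkContinuous₂
        { toFun := fun v => PreHilbertModule.innerₗ (A := A) v
          map_add' := fun v w => LinearMap.ext fun x =>
            PreHilbertModule.inner_add_left (A := A) v w x
          map_smul' := fun c v =>
            LinearMap.ext fun x => PreHilbertModule.inner_smul_left (A := A) c v x } 1
        (fun v w => by
          rw [one_mul]
          exact HilbertModule.norm_inner_le (A := A) v w)
      change Continuous fun p : E × E => f p.1 p.2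
      fun_prop
    have h1 : Filter.Tendsto (fun n => (inner A ((v n).toCLM x) y : A)) Filter.atTop
        (nhds (inner A (T x) y)) := by
      have ht : Filter.Tendsto (fun n => (v n).toCLM x) Filter.atTop (nhds (T x)) := by
        have : (fun n => (v n).toCLM) = u := funext hv
        have h2 := ((ContinuousLinearMap.apply ℂ E x).continuous.tendsto T).comp hlim
        rw [← this] at h2
        exact h2
      exact (hcont.tendsto (T x, y)).comp (ht.prodMk_nhds tendsto_const_nhds)
    have h2 : Filter.Tendsto (fun n => (inner A x ((v n).adjCLM y) : A)) Filter.atTop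
        (nhds (inner A x (S y))) := by
      have ht : Filter.Tendsto (fun n => (v n).adjCLM y) Filter.atTop (nhds (S y)) :=
        ((ContinuousLinearMap.apply ℂ E y).continuous.tendsto S).comp hS
      exact (hcont.tendsto (x, S y)).comp (tendsto_const_nhds.prodMk_nhds ht)
    refine tendsto_nhds_unique h1 ?_
    simp_rw [(v _).inner_adj]
    exact h2
  have hc := this.isComplete
  rw [← Set.image_univ] at hc
  exact completeSpace_iff_isComplete_univ.2
    ((isComplete_image_iff hiso.isUniformInducing).1 hc)

/-- The adjointable operators of a Hilbert module form a C⋆-algebra. -/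
instance : CStarAlgebra (Adjointable A E E) where

theorem mul_eq_comp (T S : Adjointable A E E) : T * S = T.comp S := rfl

theorem star_eq_adjoint (T : Adjointable A E E) : star T = T.adjoint := rfl

end Adjointable

namespace PosDefKernel

section extend

variable {A S S' : Type*} [CStarAlgebra A] (K : PosDefKernel A S) (K' : PosDefKernel A S')

/-- The right-linear extension of a map defined on the generators. -/
def linExt (φ : S → K'.Pre) : K.Pre →ₗ[ℂ] K'.Pre :=
  Finsupp.lsum ℂ (M := A) (N := K'.Pre) fun s =>
    { toFun := fun a => MulOpposite.op a • φ s
      map_add' := fun a b => by rw [MulOpposite.op_add, add_smul]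
      map_smul' := fun c a => by
        rw [MulOpposite.op_smul]
        exact smul_assoc (M := ℂ) (N := Aᵐᵒᵖ) (α := S' →₀ A) c (MulOpposite.op a) (φ s) }

variable {K K'}

theorem linExt_single (φ : S → K'.Pre) (s : S) (a : A) :
    K.linExt K' φ (K.single s a) = MulOpposite.op a • φ s :=
  (Finsupp.lsum_single ℂ _ s a)

theorem single_eq (s : S) (a : A) : K.single s a = MulOpposite.op a • K.single s 1 := by
  rw [op_smul_single, one_mul]

theorem inner_linExt_comm {φ : S → K'.Pre} {ψ : S' → K.Pre}
    (h : ∀ s t, inner A (φ s) (K'.single t 1) = inner A (K.single s 1) (ψ t))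
    (v : K.Pre) (w : K'.Pre) :
    inner A (K.linExt K' φ v) w = inner A v (K'.linExt K ψ w) := by
  induction v using K.single_induction with
  | h0 => rw [map_zero, PreHilbertModule.inner_zero_left, PreHilbertModule.inner_zero_left]
  | hadd v v' hv hv' => rw [map_add, PreHilbertModule.inner_add_left, hv, hv',
      PreHilbertModule.inner_add_left]
  | hs s a =>
    induction w using K'.single_induction with
    | h0 => rw [map_zero, PreHilbertModule.inner_zero_right, PreHilbertModule.inner_zero_right]
    | hadd w w' hw hw' => rw [map_add, PreHilbertModule.inner_add_right, hw, hw',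
        PreHilbertModule.inner_add_right]
    | hs t b =>
      rw [linExt_single, linExt_single, single_eq s, single_eq t,
        PreHilbertModule.inner_op_smul_left, PreHilbertModule.inner_op_smul_left,
        PreHilbertModule.inner_op_smul_right, PreHilbertModule.inner_op_smul_right, h]

variable (K K') in
/-- The extension of a bounded operator to the completions. -/
def extendCLM (f : K.Pre →ₗ[ℂ] K'.Pre) (C : ℝ) (hf : ∀ v, ‖f v‖ ≤ C * ‖v‖) : K.Mod →L[ℂ] K'.Mod :=
  (K'.toMod.toContinuousLinearMap.comp (f.mkContinuous C hf)).extend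
    K.toMod.toContinuousLinearMap

theorem extendCLM_toMod (f : K.Pre →ₗ[ℂ] K'.Pre) (C : ℝ) (hf : ∀ v, ‖f v‖ ≤ C * ‖v‖) (v : K.Pre) :
    K.extendCLM K' f C hf (K.toMod v) = K'.toMod (f v) :=
  ContinuousLinearMap.extend_eq (K'.toMod.toContinuousLinearMap.comp (f.mkContinuous C hf))
    (e := K.toMod.toContinuousLinearMap) K.denseRange_toMod K.toMod.isometry.isUniformInducing v

theorem inner_of_toMod (F : K.Mod → K'.Mod) (G : K'.Mod → K.Mod) (hF : Continuous F)
    (hG : Continuous G)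
    (h : ∀ v w, inner A (F (K.toMod v)) (K'.toMod w) = inner A (K.toMod v) (G (K'.toMod w)))
    (x : K.Mod) (y : K'.Mod) : inner A (F x) y = inner A x (G y) := by
  have hc := K.continuous_inner
  have hc' := K'.continuous_inner
  have h1 : IsClosed {x : K.Mod | (inner A (F x) y : A) = inner A x (G y)} :=
    isClosed_eq (hc'.comp (hF.prodMk continuous_const)) (hc.comp (continuous_id.prodMk continuous_const))
  refine K.induction₁ x h1 fun v => ?_
  have h2 : IsClosed {y : K'.Mod | (inner A (F (K.toMod v)) y : A) = inner A (K.toMod v) (G y)} :=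
    isClosed_eq (hc'.comp (continuous_const.prodMk continuous_id))
      (hc.comp (continuous_const.prodMk hG))
  exact K'.induction₁ y h2 fun w => h v w

theorem inner_extendCLM (f : K.Pre →ₗ[ℂ] K'.Pre) (g : K'.Pre →ₗ[ℂ] K.Pre)
    (hfg : ∀ v w, inner A (f v) w = inner A v (g w)) (C : ℝ) (hf : ∀ v, ‖f v‖ ≤ C * ‖v‖)
    (hg : ∀ v, ‖g v‖ ≤ C * ‖v‖) (x : K.Mod) (y : K'.Mod) :
    inner A (K.extendCLM K' f C hf x) y = inner A x (K'.extendCLM K g C hg y) :=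
  inner_of_toMod _ _ (ContinuousLinearMap.continuous _) (ContinuousLinearMap.continuous _)
    (fun v w => by rw [extendCLM_toMod, extendCLM_toMod, inner_toMod, inner_toMod, hfg]) x y

variable (K K') in
/-- The extension of a bounded operator with an adjoint to the completions. -/
def extendOp (f : K.Pre →ₗ[ℂ] K'.Pre) (g : K'.Pre →ₗ[ℂ] K.Pre)
    (hfg : ∀ v w, inner A (f v) w = inner A v (g w)) (C : ℝ) (hf : ∀ v, ‖f v‖ ≤ C * ‖v‖)
    (hg : ∀ v, ‖g v‖ ≤ C * ‖v‖) : Adjointable A K.Mod K'.Mod where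
  toCLM := K.extendCLM K' f C hf
  adjCLM := K'.extendCLM K g C hg
  inner_adj := inner_extendCLM f g hfg C hf hg

theorem extendOp_toMod (f : K.Pre →ₗ[ℂ] K'.Pre) (g : K'.Pre →ₗ[ℂ] K.Pre)
    (hfg : ∀ v w, inner A (f v) w = inner A v (g w)) (C : ℝ) (hf : ∀ v, ‖f v‖ ≤ C * ‖v‖)
    (hg : ∀ v, ‖g v‖ ≤ C * ‖v‖) (v : K.Pre) :
    (K.extendOp K' f g hfg C hf hg).toCLM (K.toMod v) = K'.toMod (f v) :=
  extendCLM_toMod f C hf v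

variable (K) in
/-- The vector of the Hilbert module given by a generator. -/
def gen (s : S) : K.Mod := K.toMod (K.single s 1)

theorem toMod_single (s : S) (a : A) : K.toMod (K.single s a) = MulOpposite.op a • K.gen s := by
  rw [single_eq, toMod_op_smul, gen]

theorem extendOp_gen (f : K.Pre →ₗ[ℂ] K'.Pre) (g : K'.Pre →ₗ[ℂ] K.Pre)
    (hfg : ∀ v w, inner A (f v) w = inner A v (g w)) (C : ℝ) (hf : ∀ v, ‖f v‖ ≤ C * ‖v‖)
    (hg : ∀ v, ‖g v‖ ≤ C * ‖v‖) (s : S) :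
    (K.extendOp K' f g hfg C hf hg).toCLM (K.gen s) = K'.toMod (f (K.single s 1)) :=
  extendOp_toMod f g hfg C hf hg _

theorem inner_gen (s t : S) : inner A (K.gen s) (K.gen t) = K.toFun s t := by
  rw [gen, gen, inner_toMod, inner_single, star_one, one_mul, mul_one]

theorem adjointable_ext {T R : Adjointable A K.Mod K'.Mod}
    (h : ∀ s t, inner A (K'.gen t) (T.toCLM (K.gen s)) = inner A (K'.gen t) (R.toCLM (K.gen s))) :
    T = R := by
  have hlin : ∀ (T : Adjointable A K.Mod K'.Mod) (a : A) (x : K.Mod),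
      T.toCLM (MulOpposite.op a • x) = MulOpposite.op a • T.toCLM x := fun T a x => by
    refine HilbertModule.ext_inner A fun z => ?_
    rw [← T.inner_adj', PreHilbertModule.inner_op_smul_right,
      PreHilbertModule.inner_op_smul_right, T.inner_adj']
  have key : ∀ (v : K.Pre) (w : K'.Pre),
      inner A (K'.toMod w) (T.toCLM (K.toMod v)) = inner A (K'.toMod w) (R.toCLM (K.toMod v)) := by
    intro v w
    induction v using K.single_induction with
    | h0 => rw [map_zero, map_zero, map_zero]
    | hadd v v' hv hv' =>
      rw [map_add, map_add, map_add, PreHilbertModule.inner_add_right, hv, hv',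
        PreHilbertModule.inner_add_right]
    | hs s a =>
      rw [toMod_single, hlin, hlin, PreHilbertModule.inner_op_smul_right,
        PreHilbertModule.inner_op_smul_right]
      congr 1
      induction w using K'.single_induction with
      | h0 => rw [map_zero, PreHilbertModule.inner_zero_left, PreHilbertModule.inner_zero_left]
      | hadd w w' hw hw' =>
        rw [map_add, PreHilbertModule.inner_add_left, hw, hw', PreHilbertModule.inner_add_left]
      | hs t b =>
        rw [toMod_single, PreHilbertModule.inner_op_smul_left,
          PreHilbertModule.inner_op_smul_left, h]
  have hc' := K'.continuous_inner
  refine Adjointable.ext (ContinuousLinearMap.ext fun x => ?_)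
  refine K.induction₁ x (isClosed_eq T.toCLM.continuous R.toCLM.continuous) fun v => ?_
  refine HilbertModule.ext_inner A fun z => ?_
  have h2 : IsClosed {z : K'.Mod | (inner A z (T.toCLM (K.toMod v)) : A) =
      inner A z (R.toCLM (K.toMod v))} :=
    isClosed_eq (hc'.comp (continuous_id.prodMk continuous_const))
      (hc'.comp (continuous_id.prodMk continuous_const))
  exact K'.induction₁ z h2 fun w => key v w

/-- A map that preserves the inner products of the generators is isometric. -/
theorem norm_linExt_le {φ : S → K'.Pre}
    (h' : ∀ s t, inner A (φ s) (φ t) = K.toFun s t) (v : K.Pre) :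
    ‖K.linExt K' φ v‖ ≤ 1 * ‖v‖ := by
  have key : ∀ v w, inner A (K.linExt K' φ v) (K.linExt K' φ w) = inner A v w := by
    intro v w
    induction v using K.single_induction with
    | h0 => rw [map_zero, PreHilbertModule.inner_zero_left, PreHilbertModule.inner_zero_left]
    | hadd v v' hv hv' => rw [map_add, PreHilbertModule.inner_add_left, hv, hv',
        PreHilbertModule.inner_add_left]
    | hs s a =>
      induction w using K.single_induction with
      | h0 => rw [map_zero, PreHilbertModule.inner_zero_right, PreHilbertModule.inner_zero_right]
      | hadd w w' hw hw' => rw [map_add, PreHilbertModule.inner_add_right, hw, hw',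
          PreHilbertModule.inner_add_right]
      | hs t b =>
        rw [linExt_single, linExt_single, inner_single, PreHilbertModule.inner_op_smul_left,
          PreHilbertModule.inner_op_smul_right, h', mul_assoc]
  refine le_of_eq ?_
  rw [one_mul, ← mul_self_inj (norm_nonneg _) (norm_nonneg _), norm_pre_mul_self,
    norm_pre_mul_self, key]

end extend

/-- A ⋆-representation of a C⋆-algebra `D` on the Hilbert module of a kernel, prescribed on the
generators: `act d s` represents `d s`, and `coef s t d` is the inner product `⟨s, d t⟩`. -/
structure PreRep (D : Type*) {A S : Type*} [CStarAlgebra D] [CStarAlgebra A]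
    (K : PosDefKernel A S) where
  act : D → S → K.Pre
  coef : S → S → D →ₗ[ℂ] A
  inner_act : ∀ s d t, inner A (K.single s 1) (act d t) = coef s t d
  inner_act_act : ∀ d s d' t, inner A (act d s) (act d' t) = coef s t (star d * d')
  coef_star : ∀ s t d, star (coef s t d) = coef t s (star d)
  coef_one : ∀ s t, coef s t 1 = K.toFun s t

namespace PreRep

variable {D A S : Type*} [CStarAlgebra D] [CStarAlgebra A] {K : PosDefKernel A S}
  (ρ : PreRep D K)

theorem inner_act_left (d : D) (s t : S) :
    inner A (ρ.act d s) (K.single t 1) = inner A (K.single s 1) (ρ.act (star d) t) := by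
  rw [← PreHilbertModule.star_inner, ρ.inner_act, ρ.coef_star, ρ.inner_act]

/-- The operator given by `d` on the pre-Hilbert module. -/
def preOp (d : D) : K.Pre →ₗ[ℂ] K.Pre := K.linExt K (ρ.act d)

theorem inner_preOp (d : D) (v w : K.Pre) :
    inner A (ρ.preOp d v) w = inner A v (ρ.preOp (star d) w) :=
  inner_linExt_comm (ρ.inner_act_left d) v w

theorem exists_coef (v w : K.Pre) : ∃ Φ : D →ₗ[ℂ] A,
    (∀ d d', inner A (ρ.preOp d v) (ρ.preOp d' w) = Φ (star d * d')) ∧ Φ 1 = inner A v w := by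
  induction v using K.single_induction with
  | h0 => exact ⟨0, fun d d' => by rw [map_zero, PreHilbertModule.inner_zero_left]; rfl,
      by rw [PreHilbertModule.inner_zero_left]; rfl⟩
  | hadd v v' hv hv' =>
    obtain ⟨Φ, h1, h2⟩ := hv
    obtain ⟨Φ', h1', h2'⟩ := hv'
    exact ⟨Φ + Φ', fun d d' => by
      rw [map_add, PreHilbertModule.inner_add_left, h1, h1']; rfl, by
      rw [PreHilbertModule.inner_add_left, ← h2, ← h2']; rfl⟩
  | hs s a =>
    induction w using K.single_induction with
    | h0 => exact ⟨0, fun d d' => by rw [map_zero, PreHilbertModule.inner_zero_right]; rfl,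
        by rw [PreHilbertModule.inner_zero_right]; rfl⟩
    | hadd v v' hv hv' =>
      obtain ⟨Φ, h1, h2⟩ := hv
      obtain ⟨Φ', h1', h2'⟩ := hv'
      exact ⟨Φ + Φ', fun d d' => by
        rw [map_add, PreHilbertModule.inner_add_right, h1, h1']; rfl, by
        rw [PreHilbertModule.inner_add_right, ← h2, ← h2']; rfl⟩
    | hs t b =>
      refine ⟨(LinearMap.mulLeft ℂ (star a)).comp ((LinearMap.mulRight ℂ b).comp (ρ.coef s t)),
        fun d d' => ?_, ?_⟩
      · rw [preOp, preOp, linExt_single, linExt_single, PreHilbertModule.inner_op_smul_left,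
          PreHilbertModule.inner_op_smul_right, ρ.inner_act_act]
        rfl
      · rw [inner_single, mul_assoc, ← ρ.coef_one]
        rfl

theorem norm_preOp_le (d : D) (v : K.Pre) : ‖ρ.preOp d v‖ ≤ ‖d‖ * ‖v‖ := by
  obtain ⟨Φ, h1, h2⟩ := ρ.exists_coef v v
  have hd : star d * d ≤ (‖d‖ * ‖d‖) • (1 : D) := by
    have := (IsSelfAdjoint.star_mul_self d).le_algebraMap_norm_self
    rwa [CStarRing.norm_star_mul_self, Algebra.algebraMap_eq_smul_one] at this
  obtain ⟨c, hc⟩ := exists_eq_star_mul_self (sub_nonneg.2 hd)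
  have h3 : inner A (ρ.preOp d v) (ρ.preOp d v) ≤ ((‖d‖ * ‖d‖ : ℝ) : ℂ) • inner A v v := by
    rw [← sub_nonneg, h1, ← h2, ← map_smul, ← map_sub, Complex.coe_smul, hc, ← h1]
    exact PreHilbertModule.inner_self_nonneg _
  have h4 := CStarAlgebra.norm_le_norm_of_nonneg_of_le
    (PreHilbertModule.inner_self_nonneg (A := A) (ρ.preOp d v)) h3
  rw [norm_smul, ← norm_pre_mul_self, ← norm_pre_mul_self, Complex.norm_real, norm_mul,
    norm_norm] at h4
  refine abs_le_of_sq_le_sq' ?_ (by positivity) |>.2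
  nlinarith

/-- The operator given by `d` on the Hilbert module. -/
def oper (d : D) : Adjointable A K.Mod K.Mod :=
  K.extendOp K (ρ.preOp d) (ρ.preOp (star d)) (ρ.inner_preOp d) ‖d‖ (ρ.norm_preOp_le d)
    (fun v => by simpa using ρ.norm_preOp_le (star d) v)

theorem oper_gen (d : D) (s : S) : (ρ.oper d).toCLM (K.gen s) = K.toMod (ρ.act d s) := by
  rw [oper, extendOp_gen, preOp, linExt_single, MulOpposite.op_one, one_smul]

theorem inner_oper_gen (d : D) (s t : S) :
    inner A (K.gen s) ((ρ.oper d).toCLM (K.gen t)) = ρ.coef s t d := by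
  rw [oper_gen, gen, inner_toMod, inner_act]

theorem oper_star (d : D) : ρ.oper (star d) = (ρ.oper d).adjoint := by
  refine adjointable_ext fun s t => ?_
  rw [inner_oper_gen]
  change _ = inner A (K.gen t) ((ρ.oper d).adjCLM (K.gen s))
  rw [← Adjointable.inner_adj, ← PreHilbertModule.star_inner, inner_oper_gen, coef_star]

/-- The ⋆-representation on the Hilbert module. -/
def toHom : D →⋆ₐ[ℂ] Adjointable A K.Mod K.Mod where
  toFun := ρ.oper
  map_one' := adjointable_ext fun s t => by
    rw [inner_oper_gen, coef_one, ← inner_gen]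
    rfl
  map_mul' d d' := adjointable_ext fun s t => by
    rw [inner_oper_gen]
    change _ = inner A (K.gen t) ((ρ.oper d).toCLM ((ρ.oper d').toCLM (K.gen s)))
    rw [← Adjointable.inner_adj']
    change _ = inner A ((ρ.oper d).adjoint.toCLM (K.gen t)) ((ρ.oper d').toCLM (K.gen s))
    rw [← oper_star, oper_gen, oper_gen, inner_toMod, inner_act_act, star_star]
  map_zero' := adjointable_ext fun s t => by
    rw [inner_oper_gen, map_zero]
    exact (PreHilbertModule.inner_zero_right _).symm
  map_add' d d' := adjointable_ext fun s t => by
    rw [inner_oper_gen, map_add, ← inner_oper_gen, ← inner_oper_gen]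
    exact (PreHilbertModule.inner_add_right _ _ _).symm
  commutes' c := adjointable_ext fun s t => by
    rw [inner_oper_gen, Algebra.algebraMap_eq_smul_one, map_smul, coef_one, ← inner_gen]
    exact (PreHilbertModule.inner_smul_right _ _ _).symm
  map_star' := ρ.oper_star

theorem toHom_gen (d : D) (s : S) : (ρ.toHom d).toCLM (K.gen s) = K.toMod (ρ.act d s) :=
  ρ.oper_gen d s

theorem inner_toHom_gen (d : D) (s t : S) :
    inner A (K.gen s) ((ρ.toHom d).toCLM (K.gen t)) = ρ.coef s t d :=
  ρ.inner_oper_gen d s t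

end PreRep

end PosDefKernel

namespace CompletelyPositiveMap

variable {D B : Type*} [CStarAlgebra D] [CStarAlgebra B] (φ : D →CP B)

theorem gram_nonneg {ι : Type*} [Fintype ι] (a : ι → D) :
    0 ≤ (CStarMatrix.ofMatrix (Matrix.of fun i j => φ (star (a i) * a j)) : CStarMatrix ι ι B) := by
  classical
  refine φ.map_cstarMatrix_nonneg
    (CStarMatrix.ofMatrix (Matrix.of fun i j => star (a i) * a j)) ?_
  cases isEmpty_or_nonempty ι with
  | inl h => exact le_of_eq (CStarMatrix.ext fun i => isEmptyElim i)
  | inr h =>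
    obtain ⟨i₀⟩ := h
    refine CStarMatrix.nonneg_of_gram
      (N := CStarMatrix.ofMatrix (Matrix.of fun k j => if k = i₀ then a j else 0)) fun i j => ?_
    change star (a i) * a j = ∑ k, star (if k = i₀ then a i else 0) * (if k = i₀ then a j else 0)
    rw [Finset.sum_eq_single i₀ (fun b _ hb => by rw [if_neg hb, star_zero, zero_mul]) (by simp),
      if_pos rfl, if_pos rfl]

theorem star_map (x : D) : star (φ x) = φ (star x) := by
  obtain ⟨N, hN⟩ := CStarMatrix.exists_gram (φ.gram_nonneg (ι := Bool) fun b => if b then x else 1)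
  have h1 : φ (star 1 * x) = ∑ k, star (N k false) * N k true := hN false true
  have h2 : φ (star x * 1) = ∑ k, star (N k true) * N k false := hN true false
  rw [star_one, one_mul] at h1
  rw [mul_one] at h2
  rw [h1, h2]
  simp

/-- The kernel `(a, a') ↦ φ (a⋆ a')` on `D`. -/
def gnsKernel : PosDefKernel B D where
  toFun a a' := φ (star a * a')
  star_apply' a a' := by rw [star_map, star_mul, star_star]
  nonneg' v := by
    have := CStarMatrix.sum_nonneg (φ.gram_nonneg (ι := v.support) fun i => (i : D))
      (fun i => v i)
    change 0 ≤ ∑ i ∈ v.support, ∑ j ∈ v.support, star (v i) * φ (star i * j) * v j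
    rw [← Finset.sum_coe_sort]
    simp_rw [← Finset.sum_coe_sort v.support]
    exact this

/-- The ⋆-representation `π` in the GNS construction `(H, π, ξ)` of a completely positive map
`φ : D → B`. The Hilbert `B`-module `H` is the completion of the span of the `π(a) ξ b`, with
`⟨π(a) ξ b, π(a') ξ b'⟩ = b⋆ φ(a⋆ a') b'`; the generator of index `a` is `π(a) ξ`. -/
def gnsRep : D →⋆ₐ[ℂ] Adjointable B φ.gnsKernel.Mod φ.gnsKernel.Mod :=
  PosDefKernel.PreRep.toHom (K := φ.gnsKernel)
    { act := fun d a => φ.gnsKernel.single (d * a) 1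
      coef := fun a a' => φ.toLinearMap.comp
        ((LinearMap.mulLeft ℂ (star a)).comp (LinearMap.mulRight ℂ a'))
      inner_act := fun s d t => by
        rw [PosDefKernel.inner_single, star_one, one_mul, mul_one]
        rfl
      inner_act_act := fun d s d' t => by
        rw [PosDefKernel.inner_single, star_one, one_mul, mul_one]
        change φ (star (d * s) * (d' * t)) = φ (star s * (star d * d' * t))
        rw [star_mul]
        simp only [mul_assoc]
      coef_star := fun s t d => by
        change star (φ (star s * (d * t))) = φ (star t * (star d * s))
        rw [star_map, star_mul, star_mul, star_star, mul_assoc]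
      coef_one := fun s t => by
        change φ (star s * (1 * t)) = φ (star s * t)
        rw [one_mul] }

end CompletelyPositiveMap

/-- A family of completely positive maps is GNS-faithful if the kernels of the representations in
their GNS constructions have intersection zero. -/
def GNSFaithful {ι D : Type*} {B : ι → Type*} [CStarAlgebra D] [∀ i, CStarAlgebra (B i)]
    (φ : ∀ i, D →CP B i) : Prop :=
  ∀ x : D, (∀ i, (φ i).gnsRep x = 0) → x = 0

/-- A graph of unital C⋆-algebras. The graph (in the sense of Serre) is a quiver `V` with an
involutive reversal `e ↦ ē` of edges such that `ē ≠ e`. There is a unital C⋆-algebra `A q` for each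
vertex, a unital C⋆-algebra `B e` for each edge, and faithful unital ⋆-homomorphisms
`s e : B e → A q`, `r e : B e → A q'` for each edge `e` from `q` to `q'`. The ⋆-isomorphism
`flip e` is the identification `B e = B ē`, under which `r e = s ē`. -/
structure GraphOfCStarAlgebras (V : Type u) [Quiver.{v} V] [Quiver.HasInvolutiveReverse V] where
  reverse_ne : ∀ (q : V) (e : q ⟶ q), Quiver.reverse e ≠ e
  A : V → Type w
  B : ∀ {q q' : V}, (q ⟶ q') → Type x
  [instA : ∀ q, CStarAlgebra (A q)]
  [instB : ∀ {q q' : V} (e : q ⟶ q'), CStarAlgebra (B e)]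
  s : ∀ {q q' : V} (e : q ⟶ q'), B e →⋆ₐ[ℂ] A q
  r : ∀ {q q' : V} (e : q ⟶ q'), B e →⋆ₐ[ℂ] A q'
  s_injective : ∀ {q q' : V} (e : q ⟶ q'), Function.Injective (s e)
  flip : ∀ {q q' : V} (e : q ⟶ q'), B e ≃⋆ₐ[ℂ] B (Quiver.reverse e)
  s_flip : ∀ {q q' : V} (e : q ⟶ q') (b : B e), s (Quiver.reverse e) (flip e b) = r e b
  r_flip : ∀ {q q' : V} (e : q ⟶ q') (b : B e), r (Quiver.reverse e) (flip e b) = s e b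

attribute [instance] GraphOfCStarAlgebras.instA GraphOfCStarAlgebras.instB

/-- `EdgePath p q` is the type of paths from `q` to `p`, including the empty path if `q = p`. -/
inductive EdgePath {V : Type u} [Quiver.{v} V] (p : V) : V → Type (max u v)
  | nil : EdgePath p p
  | cons {q q' : V} (e : q ⟶ q') (l : EdgePath p q') : EdgePath p q

namespace EdgePath

variable {V : Type u} [Quiver.{v} V] [Quiver.HasInvolutiveReverse V] {p : V}

/-- The path `(e₁, …, eₙ)` has no backtracking: `eᵢ₊₁ ≠ ēᵢ` for all `i`. -/
def NoBacktrack : ∀ {q : V}, EdgePath p q → Prop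
  | _, nil => True
  | _, cons e l => (∀ l', l ≠ cons (Quiver.reverse e) l') ∧ NoBacktrack l

/-- All edges of the path belong to `T`. -/
def EdgesIn (T : ∀ {q q' : V}, (q ⟶ q') → Prop) : ∀ {q : V}, EdgePath p q → Prop
  | _, nil => True
  | _, cons e l => T e ∧ EdgesIn T l

end EdgePath

/-- A maximal subtree of a connected graph: a set of edges, stable under reversal, such that any
two vertices are joined by exactly one path without backtracking with edges in this set (the
geodesic path). -/
structure MaximalSubtree (V : Type u) [Quiver.{v} V] [Quiver.HasInvolutiveReverse V] where
  Mem : ∀ {q q' : V}, (q ⟶ q') → Prop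
  reverse_mem : ∀ {q q' : V} (e : q ⟶ q'), Mem e → Mem (Quiver.reverse e)
  existsUnique : ∀ p q : V, ∃! l : EdgePath p q, l.EdgesIn Mem ∧ l.NoBacktrack

/-- The geodesic path in the subtree from `q` to `p`. -/
def MaximalSubtree.geodesic {V : Type u} [Quiver.{v} V] [Quiver.HasInvolutiveReverse V]
    (T : MaximalSubtree V) (p q : V) : EdgePath p q :=
  (T.existsUnique p q).choose

namespace GraphOfCStarAlgebras

variable {V : Type u} [Quiver.{v} V] [Quiver.HasInvolutiveReverse V]
  (G : GraphOfCStarAlgebras.{u, v, w, x} V)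

/-- Conditional expectations `E_e^s : A q → s e (B e)`, one for each edge `e` with source `q`. The
map `E e` is `s_e⁻¹ ∘ E_e^s : A q → B e`. -/
structure CondExps where
  E : ∀ {q q' : V} (e : q ⟶ q'), G.A q →CP G.B e
  E_s : ∀ {q q' : V} (e : q ⟶ q') (b : G.B e), E e (G.s e b) = b
  E_s_mul : ∀ {q q' : V} (e : q ⟶ q') (b : G.B e) (a : G.A q), E e (G.s e b * a) = b * E e a
  E_mul_s : ∀ {q q' : V} (e : q ⟶ q') (a : G.A q) (b : G.B e), E e (a * G.s e b) = E e a * b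

/-- Words `(a₀, e₁, a₁, e₂, …, aₙ₋₁, eₙ)` where `(e₁, …, eₙ)` is a path from `q` to `p`, `a₀ ∈ A q`
and `aᵢ ∈ A (r(eᵢ))` for `1 ≤ i ≤ n - 1`. The case `n = 0`, `q = p` is allowed. -/
inductive Word (p : V) : V → Type (max u v w)
  | nil : Word p p
  | cons {q q' : V} (a : G.A q) (e : q ⟶ q') (t : Word p q') : Word p q

namespace Word

variable {G} {p : V}

/-- The path of a word. -/
def path : ∀ {q : V}, G.Word p q → EdgePath p q
  | _, nil => .nil
  | _, cons _ e t => .cons e t.path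

/-- The word is reduced: for `1 ≤ i ≤ n - 1`, if `eᵢ₊₁ = ēᵢ` then the conditional expectation
`E_{eᵢ₊₁}^s` vanishes at `aᵢ`. -/
def Reduced (𝓔 : G.CondExps) : ∀ {q : V}, G.Word p q → Prop
  | _, nil => True
  | _, cons _ e t =>
    (∀ b t', t = cons b (Quiver.reverse e) t' → 𝓔.E (Quiver.reverse e) b = 0) ∧ t.Reduced 𝓔

theorem Reduced.change {𝓔 : G.CondExps} {q q' : V} {a : G.A q} {e : q ⟶ q'} {t : G.Word p q'}
    (h : (cons a e t).Reduced 𝓔) (b : G.A q) : (cons b e t).Reduced 𝓔 := h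

theorem Reduced.tail {𝓔 : G.CondExps} {q q' : V} {a : G.A q} {e : q ⟶ q'} {t : G.Word p q'}
    (h : (cons a e t).Reduced 𝓔) : t.Reduced 𝓔 := h.2

theorem cons_inj {q q' : V} {a a' : G.A q} {e : q ⟶ q'} {t t' : G.Word p q'} :
    cons a e t = cons a' e t' ↔ a = a' ∧ t = t' := by
  constructor
  · intro h
    cases h
    exact ⟨rfl, rfl⟩
  · rintro ⟨rfl, rfl⟩
    rfl

theorem path_eq_cons {q q' : V} {e : q ⟶ q'} {l : EdgePath p q'} {s : G.Word p q}
    (h : s.path = .cons e l) : ∃ a t, s = cons a e t ∧ t.path = l := by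
  cases s with
  | nil => cases h
  | cons a e' t =>
    cases h
    exact ⟨a, t, rfl, rfl⟩

theorem path_eq_nil {s : G.Word p p} (h : s.path = .nil) : s = nil := by
  cases s with
  | nil => rfl
  | cons a e' t => cases h

/-- The map `x ↦ ⟨s, λ(x) t⟩` for two words `s`, `t`, viewed as vectors `ρ(a₀)η ⊗ ⋯ ⊗ ρ(aₙ₋₁)η ⊗ 1`
of the direct sum of the interior tensor products `K₀ ⊗ ⋯ ⊗ Kₙ`: it vanishes if the words have
different paths, and otherwise
`⟨ρ(a)η ⊗ s, λ(x) (ρ(a')η ⊗ t)⟩ = ⟨s, λ(r_e(s_e⁻¹ E_e^s(a⋆ x a'))) t⟩`. -/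
def coef (𝓔 : G.CondExps) : ∀ {q : V}, G.Word p q → G.Word p q → G.A q →ₗ[ℂ] G.A p
  | _, nil, t => open Classical in if t = nil then LinearMap.id else 0
  | _, cons a e s, t => open Classical in
    if h : ∃ a' t', t = cons a' e t' then
      (s.coef 𝓔 h.choose_spec.choose).comp ((G.r e : G.B e →ₗ[ℂ] _).comp
        ((𝓔.E e).toLinearMap.comp ((LinearMap.mulLeft ℂ (star a)).comp
          (LinearMap.mulRight ℂ h.choose))))
    else 0

variable (𝓔 : G.CondExps)

theorem coef_nil_nil (y : G.A p) : (nil : G.Word p p).coef 𝓔 nil y = y := by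
  rw [coef, if_pos rfl]
  rfl

theorem coef_nil_cons {q' : V} (a : G.A p) (e : p ⟶ q') (t : G.Word p q') (y : G.A p) :
    (nil : G.Word p p).coef 𝓔 (cons a e t) y = 0 := by
  rw [coef, if_neg (by simp)]
  rfl

theorem coef_cons_cons {q q' : V} (a a' : G.A q) (e : q ⟶ q') (s t : G.Word p q') (y : G.A q) :
    (cons a e s).coef 𝓔 (cons a' e t) y = s.coef 𝓔 t (G.r e (𝓔.E e (star a * (y * a')))) := by
  have h : ∃ a'' t'', cons a' e t = cons a'' e t'' := ⟨a', t, rfl⟩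
  obtain ⟨h1, h2⟩ := cons_inj.1 h.choose_spec.choose_spec
  rw [coef, dif_pos h, ← h2]
  change s.coef 𝓔 t (G.r e (𝓔.E e (star a * (y * h.choose)))) = _
  rw [← h1]

theorem coef_cons_ne {q q' : V} (a : G.A q) (e : q ⟶ q') (s : G.Word p q') (t : G.Word p q)
    (h : ∀ a' t', t ≠ cons a' e t') (y : G.A q) : (cons a e s).coef 𝓔 t y = 0 := by
  rw [coef, dif_neg (by simpa using h)]
  rfl

theorem coef_star {q : V} (s t : G.Word p q) (y : G.A q) :
    star (s.coef 𝓔 t y) = t.coef 𝓔 s (star y) := by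
  induction s with
  | nil =>
    cases t with
    | nil => rw [coef_nil_nil, coef_nil_nil]
    | cons a e t =>
      rw [coef_nil_cons, coef_cons_ne _ _ _ _ _ (by simp), star_zero]
  | cons a e s ih =>
    by_cases h : ∃ a' t', t = cons a' e t'
    · obtain ⟨a', t', rfl⟩ := h
      rw [coef_cons_cons, coef_cons_cons, ih, ← map_star, CompletelyPositiveMap.star_map]
      congr 3
      rw [star_mul, star_mul, star_star, mul_assoc]
    · have h' : ∀ a' t', t ≠ cons a' e t' := by simpa using h
      rw [coef_cons_ne _ _ _ _ _ h', star_zero]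
      cases t with
      | nil => rw [coef_nil_cons]
      | cons a' e' t' =>
        rw [coef_cons_ne]
        rintro a'' t'' h2
        cases h2
        exact h' _ _ rfl

theorem coef_of_path_ne {q : V} (s t : G.Word p q) (h : s.path ≠ t.path) (y : G.A q) :
    s.coef 𝓔 t y = 0 := by
  induction s with
  | nil =>
    cases t with
    | nil => exact absurd rfl h
    | cons a e t => rw [coef_nil_cons]
  | cons a e s ih =>
    by_cases h' : ∃ a' t', t = cons a' e t'
    · obtain ⟨a', t', rfl⟩ := h'
      rw [coef_cons_cons, ih]
      intro h2
      exact h (congrArg (EdgePath.cons e) h2)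
    · rw [coef_cons_ne _ _ _ _ _ (by simpa using h')]

theorem coef_nonneg {q : V} (l : EdgePath p q) {ι : Type*} [Fintype ι] (s : ι → G.Word p q)
    (hs : ∀ i, (s i).path = l) (X : CStarMatrix ι ι (G.A q)) (hX : 0 ≤ X) :
    0 ≤ (CStarMatrix.ofMatrix (Matrix.of fun i j => (s i).coef 𝓔 (s j) (X i j)) :
      CStarMatrix ι ι (G.A p)) := by
  induction l with
  | nil =>
    convert hX using 1
    ext i j
    change (s i).coef 𝓔 (s j) (X i j) = X i j
    rw [path_eq_nil (hs i), path_eq_nil (hs j), coef_nil_nil]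
  | cons e l ih =>
    choose a t h1 h2 using fun i => path_eq_cons (hs i)
    obtain ⟨N, hN⟩ := CStarMatrix.exists_gram hX
    have hY : 0 ≤ (CStarMatrix.ofMatrix (Matrix.of fun i j => star (a i) * (X i j * a j)) :
        CStarMatrix ι ι _) := by
      refine CStarMatrix.nonneg_of_gram
        (N := CStarMatrix.ofMatrix (Matrix.of fun k j => N k j * a j)) fun i j => ?_
      change star (a i) * (X i j * a j) = ∑ k, star (N k i * a i) * (N k j * a j)
      rw [hN, Finset.sum_mul, Finset.mul_sum]
      simp only [star_mul, mul_assoc]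
    have hZ := CompletelyPositiveMap.map_cstarMatrix_nonneg
      (CompletelyPositiveMapClass.toCompletelyPositiveLinearMap (G.r e)) _
      ((𝓔.E e).map_cstarMatrix_nonneg _ hY)
    convert ih t h2 _ hZ using 1
    ext i j
    change (s i).coef 𝓔 (s j) (X i j) =
      (t i).coef 𝓔 (t j) (G.r e (𝓔.E e (star (a i) * (X i j * a j))))
    rw [h1, h1, coef_cons_cons]

end Word

/-- The reduced words with a path from `q` to `p`. -/
structure RedWord (𝓔 : G.CondExps) (p q : V) where
  word : G.Word p q
  reduced : word.Reduced 𝓔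

variable {G}

/-- The kernel of the inner products of the vectors given by the reduced words. -/
def kernel (𝓔 : G.CondExps) (p q : V) : PosDefKernel (G.A p) (G.RedWord 𝓔 p q) where
  toFun s t := s.1.coef 𝓔 t.1 1
  star_apply' s t := by rw [Word.coef_star, star_one]
  nonneg' f := by
    classical
    have key : ∀ l : EdgePath p q, 0 ≤ ∑ i ∈ f.support.filter (fun i => i.1.path = l),
        ∑ j ∈ f.support.filter (fun j => j.1.path = l), star (f i) * i.1.coef 𝓔 j.1 1 * f j := by
      intro l
      let F : Finset (G.RedWord 𝓔 p q) := f.support.filter (fun i => i.1.path = l)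
      have h1 : 0 ≤ (CStarMatrix.ofMatrix (Matrix.of fun _ _ => 1) : CStarMatrix F F (G.A q)) := by
        have := (CompletelyPositiveMapClass.toCompletelyPositiveLinearMap
          (StarAlgHom.id ℂ (G.A q))).gram_nonneg (ι := F) fun _ => 1
        convert this using 1
        ext i j
        change (1 : G.A q) = star 1 * 1
        rw [star_one, mul_one]
      have h2 := CStarMatrix.sum_nonneg (Word.coef_nonneg 𝓔 l (fun i : F => i.1.1)
        (fun i => (Finset.mem_filter.1 i.2).2) _ h1) (fun i => f i.1)
      change 0 ≤ ∑ i ∈ F, ∑ j ∈ F, star (f i) * i.1.coef 𝓔 j.1 1 * f j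
      rw [← Finset.sum_coe_sort]
      simp_rw [← Finset.sum_coe_sort F]
      exact h2
    change 0 ≤ ∑ i ∈ f.support, ∑ j ∈ f.support, star (f i) * i.1.coef 𝓔 j.1 1 * f j
    rw [← Finset.sum_fiberwise_of_maps_to (t := f.support.image fun i => i.1.path)
      (g := fun i => i.1.path) fun i hi => Finset.mem_image_of_mem _ hi]
    refine Finset.sum_nonneg fun l _ => ?_
    convert key l using 1
    refine Finset.sum_congr rfl fun i hi => ?_
    rw [Finset.sum_filter]
    refine Finset.sum_congr rfl fun j _ => ?_
    split_ifs with h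
    · rfl
    · rw [Word.coef_of_path_ne, mul_zero, zero_mul]
      rw [(Finset.mem_filter.1 hi).2]
      exact fun h' => h h'.symm

/-- The Hilbert `A p`-module `H_{q,p}`, the direct sum over all paths `(e₁, …, eₙ)` from `q` to `p`
of the interior tensor products `K₀ ⊗ ⋯ ⊗ Kₙ`. Here `Kᵢ`, for `i < n`, is the GNS module of
`s_e⁻¹ ∘ E_e^s` with `e = eᵢ₊₁`, or if `eᵢ₊₁ = ēᵢ` the closure of the set of its elements `ρ(a)η`
with `E_e^s(a) = 0`, and `Kₙ = A p`. It is generated by the vectors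
`ρ(a₀)η ⊗ ⋯ ⊗ ρ(aₙ₋₁)η ⊗ 1` with `(a₀, e₁, …, aₙ₋₁, eₙ)` a reduced word. -/
abbrev HMod (𝓔 : G.CondExps) (p q : V) : Type _ := (kernel 𝓔 p q).Mod

section action

variable (𝓔 : G.CondExps)

/-- The multiplication of the first letter of a reduced word. For the empty word the result is
`1 · y` in the summand `A p` of the empty path. -/
def act {p q : V} (y : G.A q) (s : G.RedWord 𝓔 p q) : (kernel 𝓔 p q).Pre :=
  go s.1 y s.2
where
  go : ∀ {q : V} (s : G.Word p q), G.A q → s.Reduced 𝓔 → (kernel 𝓔 p q).Pre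
    | _, .nil, y, h => (kernel 𝓔 p p).single ⟨.nil, h⟩ y
    | _, .cons a e t, y, h => (kernel 𝓔 p _).single ⟨.cons (y * a) e t, h.change _⟩ 1

theorem act_nil {p : V} (y : G.A p) (h : (Word.nil : G.Word p p).Reduced 𝓔) :
    act 𝓔 y ⟨.nil, h⟩ = (kernel 𝓔 p p).single ⟨.nil, h⟩ y := rfl

theorem act_cons {p q q' : V} (y a : G.A q) (e : q ⟶ q') (t : G.Word p q')
    (h : (Word.cons a e t).Reduced 𝓔) :
    act 𝓔 y ⟨.cons a e t, h⟩ = (kernel 𝓔 p q).single ⟨.cons (y * a) e t, h.change _⟩ 1 := rfl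

theorem inner_single_single {p q : V} (s t : G.RedWord 𝓔 p q) :
    inner (G.A p) ((kernel 𝓔 p q).single s 1) ((kernel 𝓔 p q).single t 1) =
      s.1.coef 𝓔 t.1 1 := by
  rw [PosDefKernel.inner_single, star_one, one_mul, mul_one]
  rfl

theorem coef_mul_cons {p q q' : V} (s : G.Word p q) (y z a : G.A q) (e : q ⟶ q')
    (t : G.Word p q') : s.coef 𝓔 (.cons (z * a) e t) y = s.coef 𝓔 (.cons a e t) (y * z) := by
  cases s with
  | nil => rw [Word.coef_nil_cons, Word.coef_nil_cons]
  | cons b f s =>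
    by_cases h : ∃ a' t', Word.cons a e t = .cons a' f t'
    · obtain ⟨a', t', h⟩ := h
      cases h
      rw [Word.coef_cons_cons, Word.coef_cons_cons]
      simp only [mul_assoc]
    · rw [Word.coef_cons_ne, Word.coef_cons_ne]
      · exact fun a' t' h' => h ⟨a', t', h'⟩
      · rintro a' t' h'
        cases h'
        exact h ⟨_, _, rfl⟩

theorem inner_act {p q : V} (s t : G.RedWord 𝓔 p q) (y : G.A q) :
    inner (G.A p) ((kernel 𝓔 p q).single s 1) (act 𝓔 y t) = s.1.coef 𝓔 t.1 y := by
  obtain ⟨t, ht⟩ := t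
  cases t with
  | nil =>
    rw [act_nil, PosDefKernel.inner_single, star_one, one_mul]
    change s.1.coef 𝓔 _ 1 * y = _
    obtain ⟨s, hs⟩ := s
    cases s with
    | nil => rw [Word.coef_nil_nil, Word.coef_nil_nil, one_mul]
    | cons a e s =>
      rw [Word.coef_cons_ne _ _ _ _ _ (by simp), Word.coef_cons_ne _ _ _ _ _ (by simp), zero_mul]
  | cons a e t =>
    rw [act_cons, inner_single_single, coef_mul_cons, one_mul]

theorem coef_mul_cons_left {p q q' : V} (s : G.Word p q) (y z a : G.A q) (e : q ⟶ q')
    (t : G.Word p q') :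
    (Word.cons (z * a) e t).coef 𝓔 s y = (Word.cons a e t).coef 𝓔 s (star z * y) := by
  rw [← star_star (Word.coef _ _ _ _), Word.coef_star, coef_mul_cons, Word.coef_star, star_mul,
    star_star]

theorem inner_act_act {p q : V} (s t : G.RedWord 𝓔 p q) (y z : G.A q) :
    inner (G.A p) (act 𝓔 y s) (act 𝓔 z t) = s.1.coef 𝓔 t.1 (star y * z) := by
  obtain ⟨s, hs⟩ := s
  cases s with
  | nil =>
    obtain ⟨t, ht⟩ := t
    rw [act_nil, PosDefKernel.single_eq, PreHilbertModule.inner_op_smul_left, inner_act]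
    cases t with
    | nil => rw [Word.coef_nil_nil, Word.coef_nil_nil]
    | cons a e t => rw [Word.coef_nil_cons, Word.coef_nil_cons, mul_zero]
  | cons a e s =>
    rw [act_cons, inner_act, coef_mul_cons_left]

/-- The left action `λ_{q,p}` of `A q` on `H_{q,p}`. -/
def leftAction (p q : V) : G.A q →⋆ₐ[ℂ] Adjointable (G.A p) (HMod 𝓔 p q) (HMod 𝓔 p q) :=
  PosDefKernel.PreRep.toHom (K := kernel 𝓔 p q)
    { act := act 𝓔
      coef := fun s t => s.1.coef 𝓔 t.1
      inner_act := fun s d t => inner_act 𝓔 s t d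
      inner_act_act := fun d s d' t => inner_act_act 𝓔 s t d d'
      coef_star := fun s t d => Word.coef_star 𝓔 s.1 t.1 d
      coef_one := fun _ _ => rfl }

theorem leftAction_gen {p q : V} (y : G.A q) (s : G.RedWord 𝓔 p q) :
    (leftAction 𝓔 p q y).toCLM ((kernel 𝓔 p q).gen s) = (kernel 𝓔 p q).toMod (act 𝓔 y s) :=
  PosDefKernel.PreRep.toHom_gen _ _ _

end action

end GraphOfCStarAlgebras

namespace GraphOfCStarAlgebras

variable {V : Type u} [Quiver.{v} V] [Quiver.HasInvolutiveReverse V]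
  {G : GraphOfCStarAlgebras.{u, v, w, x} V} (𝓔 : G.CondExps)

section range

theorem r_range {q q' : V} (e : q ⟶ q') (f : q' ⟶ q) (hf : f = Quiver.reverse e) (b : G.B e) :
    ∃ c : G.B f, G.s f c = G.r e b ∧ G.r f c = G.s e b := by
  subst hf
  exact ⟨G.flip e b, G.s_flip e b, G.r_flip e b⟩

/-- `a - E(a)`, where `E` is the conditional expectation onto `s e (B e)`. -/
def cen {q q' : V} (e : q ⟶ q') (a : G.A q) : G.A q := a - G.s e (𝓔.E e a)

theorem E_cen {q q' : V} (e : q ⟶ q') (a : G.A q) : 𝓔.E e (cen 𝓔 e a) = 0 := by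
  rw [cen, map_sub, 𝓔.E_s, sub_self]

theorem E_star {q q' : V} (e : q ⟶ q') (a : G.A q) : star (𝓔.E e a) = 𝓔.E e (star a) :=
  CompletelyPositiveMap.star_map _ _

theorem star_cen {q q' : V} (e : q ⟶ q') (a : G.A q) : star (cen 𝓔 e a) = cen 𝓔 e (star a) := by
  rw [cen, cen, star_sub, ← map_star, E_star]

theorem E_cen_mul {q q' : V} (e : q ⟶ q') (a c : G.A q) (b : G.B e) (hc : 𝓔.E e c = 0) :
    𝓔.E e (cen 𝓔 e a * (G.s e b * c)) = 𝓔.E e (a * (G.s e b * c)) := by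
  rw [cen, sub_mul, map_sub, 𝓔.E_s_mul, 𝓔.E_s_mul, hc, mul_zero, mul_zero, sub_zero]

theorem E_mul_cen {q q' : V} (e : q ⟶ q') (a c : G.A q) (b : G.B e) (hc : 𝓔.E e c = 0) :
    𝓔.E e (c * (G.s e b * cen 𝓔 e a)) = 𝓔.E e (c * (G.s e b * a)) := by
  rw [cen, mul_sub, mul_sub, map_sub, ← mul_assoc c _ (G.s e _), 𝓔.E_mul_s, 𝓔.E_mul_s, hc,
    zero_mul, zero_mul, sub_zero]

theorem E_mul {q q' : V} (e : q ⟶ q') (a b : G.A q) :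
    𝓔.E e (star (cen 𝓔 e a) * cen 𝓔 e b) + star (𝓔.E e a) * 𝓔.E e b = 𝓔.E e (star a * b) := by
  rw [star_cen, cen, cen, mul_sub, sub_mul, sub_mul, map_sub, map_sub, map_sub, 𝓔.E_mul_s,
    𝓔.E_s_mul, 𝓔.E_s_mul, 𝓔.E_s, E_star]
  abel

end range

namespace Word

/-- The first edge of the word is `e`. -/
def Begins {p q q' : V} (s : G.Word p q) (e : q ⟶ q') : Prop := ∃ a t, s = cons a e t

theorem coef_of_not_begins {p q q' : V} (a : G.A q) (e : q ⟶ q') (s : G.Word p q') {t : G.Word p q}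
    (h : ¬ t.Begins e) (y : G.A q) : (cons a e s).coef 𝓔 t y = 0 :=
  coef_cons_ne _ _ _ _ _ (fun a' t' h' => h ⟨a', t', h'⟩) y

theorem coef_of_not_begins_left {p q q' : V} (a : G.A q) (e : q ⟶ q') (s : G.Word p q')
    {t : G.Word p q} (h : ¬ t.Begins e) (y : G.A q) : t.coef 𝓔 (cons a e s) y = 0 := by
  rw [← star_star (coef _ _ _ _), coef_star, coef_of_not_begins _ _ _ _ h, star_zero]

theorem Reduced.prefix {𝓔 : G.CondExps} {p q q' : V} {e : q ⟶ q'} {f : q' ⟶ q}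
    (hf : f = Quiver.reverse e) {s : G.Word p q'} (hs : s.Reduced 𝓔) (h : ¬ s.Begins f) (a : G.A q) :
    (cons a e s).Reduced 𝓔 := by
  subst hf
  exact ⟨fun b t' h' => absurd ⟨b, t', h'⟩ h, hs⟩

theorem Reduced.prefix_cen {𝓔 : G.CondExps} {p q q' : V} {e : q ⟶ q'} {f : q' ⟶ q}
    (hf : f = Quiver.reverse e) {a : G.A q'} {t : G.Word p q} (hs : (cons a f t).Reduced 𝓔)
    (c : G.A q) : (cons c e (cons (cen 𝓔 f a) f t)).Reduced 𝓔 := by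
  subst hf
  refine ⟨fun b t' h' => ?_, hs⟩
  rw [← (cons_inj.1 h').1, E_cen]

/-- In a reduced word, after the edge `e` the reverse edge can only follow a letter on which the
conditional expectation vanishes. -/
theorem Reduced.head {𝓔 : G.CondExps} {p q q' : V} {e : q ⟶ q'} {f : q' ⟶ q}
    (hf : f = Quiver.reverse e) {a : G.A q} {b : G.A q'} {t : G.Word p q}
    (h : (cons a e (cons b f t)).Reduced 𝓔) : 𝓔.E f b = 0 := by
  subst hf
  exact h.1 b t rfl

end Word

section edgeOperator

variable {p : V}

open Classical in
/-- The operator `u_e` on the vectors given by the reduced words, with `f = ē`: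
`u_e s = η ⊗ s` if the path of `s` does not begin with `f`, and
`u_e (ρ(a)η ⊗ t) = η ⊗ ρ(a - E(a))η ⊗ t + λ(r_f(s_f⁻¹(E(a)))) t` for `ρ(a)η ⊗ t` with a path
that begins with `f`, where `E = E_f^s`. -/
def edgeAct {q q' : V} (e : q ⟶ q') (f : q' ⟶ q) (hf : f = Quiver.reverse e)
    (s : G.RedWord 𝓔 p q') : (kernel 𝓔 p q).Pre :=
  if h : s.word.Begins f then
    (kernel 𝓔 p q).single
      ⟨.cons 1 e (.cons (cen 𝓔 f h.choose) f h.choose_spec.choose),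
        Word.Reduced.prefix_cen hf (h.choose_spec.choose_spec ▸ s.reduced) 1⟩ 1 +
    act 𝓔 (G.r f (𝓔.E f h.choose))
      ⟨h.choose_spec.choose, (h.choose_spec.choose_spec ▸ s.reduced : Word.Reduced 𝓔 _).tail⟩
  else (kernel 𝓔 p q).single ⟨.cons 1 e s.word, s.reduced.prefix hf h 1⟩ 1

variable {q q' : V} (e : q ⟶ q') (f : q' ⟶ q) (hf : f = Quiver.reverse e)

theorem edgeAct_of_not (t : G.RedWord 𝓔 p q') (h : ¬ t.word.Begins f) :
    edgeAct 𝓔 e f hf t = (kernel 𝓔 p q).single ⟨.cons 1 e t.word, t.reduced.prefix hf h 1⟩ 1 := by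
  rw [edgeAct, dif_neg h]

theorem edgeAct_cons (a : G.A q') (t : G.Word p q) (h : (Word.cons a f t).Reduced 𝓔) :
    edgeAct 𝓔 e f hf ⟨.cons a f t, h⟩ =
      (kernel 𝓔 p q).single ⟨.cons 1 e (.cons (cen 𝓔 f a) f t), h.prefix_cen hf 1⟩ 1 +
        act 𝓔 (G.r f (𝓔.E f a)) ⟨t, h.tail⟩ := by
  have hb : (Word.cons a f t).Begins f := ⟨a, t, rfl⟩
  obtain ⟨h1, h2⟩ := Word.cons_inj.1 hb.choose_spec.choose_spec
  rw [edgeAct, dif_pos hb]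
  congr 1
  · congr 4
    · rw [← h1]
    · exact h2.symm
  · congr 2
    · rw [← h1]
    · exact h2.symm

theorem inner_edgeAct_cons (s : G.RedWord 𝓔 p q) (a : G.A q') (t : G.Word p q)
    (h : (Word.cons a f t).Reduced 𝓔) :
    inner (G.A p) ((kernel 𝓔 p q).single s 1) (edgeAct 𝓔 e f hf ⟨.cons a f t, h⟩) =
      s.word.coef 𝓔 (.cons 1 e (.cons (cen 𝓔 f a) f t)) 1 +
        s.word.coef 𝓔 t (G.r f (𝓔.E f a)) := by
  rw [edgeAct_cons, PreHilbertModule.inner_add_right, inner_single_single, inner_act]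

theorem inner_edgeAct_of_not (s : G.RedWord 𝓔 p q) (t : G.RedWord 𝓔 p q')
    (h : ¬ t.word.Begins f) :
    inner (G.A p) ((kernel 𝓔 p q).single s 1) (edgeAct 𝓔 e f hf t) =
      s.word.coef 𝓔 (.cons 1 e t.word) 1 := by
  rw [edgeAct_of_not _ _ _ _ _ h, inner_single_single]

/-- Letters on which the conditional expectation vanishes are orthogonal to its range. -/
theorem coef_cen (hf : f = Quiver.reverse e) (a : G.A q') (s : G.Word p q) (t' : G.Word p q')
    (b : G.A q) (ht : (Word.cons b e t').Reduced 𝓔) (β : G.B f) :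
    (Word.cons (cen 𝓔 f a) f s).coef 𝓔 t' (G.s f β) =
      (Word.cons a f s).coef 𝓔 t' (G.s f β) := by
  by_cases h : t'.Begins f
  · obtain ⟨c, t'', rfl⟩ := h
    rw [Word.coef_cons_cons, Word.coef_cons_cons, star_cen, E_cen_mul _ _ _ _ _ (ht.head hf)]
  · rw [Word.coef_of_not_begins _ _ _ _ h, Word.coef_of_not_begins _ _ _ _ h]

theorem coef_cen_right (hf : f = Quiver.reverse e) (a : G.A q') (s : G.Word p q)
    (t' : G.Word p q') (b : G.A q) (ht : (Word.cons b e t').Reduced 𝓔) (β : G.B f) :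
    t'.coef 𝓔 (Word.cons (cen 𝓔 f a) f s) (G.s f β) =
      t'.coef 𝓔 (Word.cons a f s) (G.s f β) := by
  rw [← star_star (Word.coef _ _ _ _), Word.coef_star, ← map_star (G.s f),
    coef_cen 𝓔 e f hf a s t' b ht, Word.coef_star, map_star (G.s f), star_star]

/-- A word that can follow the edge `e` is orthogonal to `η_f ⊗ s` and its translates by the
range. -/
theorem coef_one_cons (hf : f = Quiver.reverse e) (s : G.Word p q) (t' : G.Word p q')
    (b : G.A q) (ht : (Word.cons b e t').Reduced 𝓔) (β : G.B f) :
    t'.coef 𝓔 (Word.cons 1 f s) (G.s f β) = 0 := by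
  rw [← coef_cen_right 𝓔 e f hf 1 s t' b ht, cen, ← map_one (G.s f), 𝓔.E_s, sub_self]
  by_cases h : t'.Begins f
  · obtain ⟨c, t'', rfl⟩ := h
    rw [Word.coef_cons_cons, mul_zero, mul_zero, map_zero, map_zero, map_zero]
  · rw [Word.coef_of_not_begins_left _ _ _ _ h]

theorem coef_one_cons_left (hf : f = Quiver.reverse e) (s : G.Word p q) (t' : G.Word p q')
    (b : G.A q) (ht : (Word.cons b e t').Reduced 𝓔) (β : G.B f) :
    (Word.cons 1 f s).coef 𝓔 t' (G.s f β) = 0 := by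
  rw [← star_star (Word.coef _ _ _ _), Word.coef_star, ← map_star (G.s f),
    coef_one_cons 𝓔 e f hf s t' b ht, star_zero]

theorem edgeAct_adj (hf' : e = Quiver.reverse f) (s : G.RedWord 𝓔 p q') (t : G.RedWord 𝓔 p q) :
    inner (G.A p) (edgeAct 𝓔 e f hf s) ((kernel 𝓔 p q).single t 1) =
      inner (G.A p) ((kernel 𝓔 p q').single s 1) (edgeAct 𝓔 f e hf' t) := by
  obtain ⟨s, hs⟩ := s
  obtain ⟨t, ht⟩ := t
  rw [← PreHilbertModule.star_inner]
  by_cases h1 : s.Begins f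
  · obtain ⟨a, s', rfl⟩ := h1
    by_cases h2 : t.Begins e
    · obtain ⟨b, t', rfl⟩ := h2
      rw [inner_edgeAct_cons, inner_edgeAct_cons, star_add, Word.coef_star, Word.coef_star,
        add_comm]
      dsimp only
      obtain ⟨β, hβ, -⟩ := r_range e f hf (𝓔.E e b)
      obtain ⟨γ, hγ, -⟩ := r_range f e hf' (𝓔.E f a)
      congr 1
      · rw [Word.coef_cons_cons, one_mul, mul_one, ← E_star, map_star (G.r f), ← hγ, ← map_star (G.s e),
          coef_cen_right 𝓔 f e hf' b t' s' a hs]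
      · rw [Word.coef_cons_cons, star_one, one_mul, one_mul, ← hβ,
          coef_cen 𝓔 e f hf a s' t' b ht]
    · rw [inner_edgeAct_cons, inner_edgeAct_of_not _ _ _ _ _ _ h2, star_add, Word.coef_star,
        Word.coef_star]
      dsimp only
      rw [Word.coef_of_not_begins _ _ _ _ h2, zero_add, Word.coef_cons_cons, one_mul, mul_one,
        ← E_star, map_star (G.r f)]
  · by_cases h2 : t.Begins e
    · obtain ⟨b, t', rfl⟩ := h2
      rw [inner_edgeAct_cons, inner_edgeAct_of_not _ _ _ _ _ _ h1, Word.coef_star]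
      dsimp only
      rw [Word.coef_of_not_begins_left _ _ _ _ h1, zero_add, Word.coef_cons_cons, star_one,
        one_mul, one_mul]
    · rw [inner_edgeAct_of_not _ _ _ _ _ _ h1, inner_edgeAct_of_not _ _ _ _ _ _ h2]
      dsimp only
      rw [Word.coef_of_not_begins_left _ _ _ _ h2, Word.coef_of_not_begins_left _ _ _ _ h1,
        star_zero]

theorem edgeAct_isom (hf' : e = Quiver.reverse f) (s t : G.RedWord 𝓔 p q') :
    inner (G.A p) (edgeAct 𝓔 e f hf s) (edgeAct 𝓔 e f hf t) = (kernel 𝓔 p q').toFun s t := by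
  have hcross : ∀ (s t : G.RedWord 𝓔 p q') (hs : ¬ s.word.Begins f) (ht : t.word.Begins f),
      inner (G.A p) (edgeAct 𝓔 e f hf s) (edgeAct 𝓔 e f hf t) = 0 := by
    intro s t h1 h2
    obtain ⟨t, ht⟩ := t
    obtain ⟨b, t', rfl⟩ := h2
    obtain ⟨γ, hγ, -⟩ := r_range f e hf' (𝓔.E f b)
    rw [edgeAct_of_not _ _ _ _ _ h1, inner_edgeAct_cons, ← hγ]
    dsimp only
    rw [Word.coef_cons_cons, coef_one_cons_left 𝓔 f e hf' _ _ _ ht,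
      Word.coef_of_not_begins_left _ _ _ _ h1, add_zero]
  by_cases h1 : s.word.Begins f
  · by_cases h2 : t.word.Begins f
    · obtain ⟨s, hs⟩ := s
      obtain ⟨t, ht⟩ := t
      obtain ⟨a, s', rfl⟩ := h1
      obtain ⟨b, t', rfl⟩ := h2
      obtain ⟨γ, hγ, -⟩ := r_range f e hf' (𝓔.E f a)
      obtain ⟨β, hβ, -⟩ := r_range f e hf' (𝓔.E f b)
      rw [edgeAct_cons, edgeAct_cons, PreHilbertModule.inner_add_left,
        PreHilbertModule.inner_add_right, PreHilbertModule.inner_add_right, inner_single_single,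
        inner_act, inner_act_act, ← PreHilbertModule.star_inner, inner_act, ← hγ, ← hβ]
      dsimp only
      rw [Word.coef_cons_cons, Word.coef_cons_cons]
      rw [coef_one_cons_left 𝓔 f e hf' _ _ _ hs, coef_one_cons_left 𝓔 f e hf' _ _ _ ht, star_zero,
        add_zero, zero_add, hγ, hβ, ← map_star (G.r f), ← map_mul (G.r f)]
      change _ = (Word.cons a f s').coef 𝓔 (.cons b f t') 1
      have h1 : G.r e (𝓔.E e 1) = 1 := by rw [← map_one (G.s e), 𝓔.E_s, map_one]
      rw [Word.coef_cons_cons, star_one, one_mul, one_mul, h1, one_mul, one_mul, ← E_mul 𝓔 f a b,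
        map_add, map_add]
    · rw [← PreHilbertModule.star_inner, hcross t s h2 h1, star_zero]
      obtain ⟨s, hs⟩ := s
      obtain ⟨a, s', rfl⟩ := h1
      exact (Word.coef_of_not_begins 𝓔 _ _ _ h2 _).symm
  · by_cases h2 : t.word.Begins f
    · rw [hcross s t h1 h2]
      obtain ⟨t, ht⟩ := t
      obtain ⟨b, t', rfl⟩ := h2
      exact (Word.coef_of_not_begins_left 𝓔 _ _ _ h1 _).symm
    · rw [edgeAct_of_not _ _ _ _ _ h1, edgeAct_of_not _ _ _ _ _ h2, inner_single_single]
      dsimp only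
      rw [Word.coef_cons_cons, star_one, one_mul, one_mul, ← map_one (G.s e), 𝓔.E_s, map_one]
      rfl

end edgeOperator

/-- The operator `u_e^p : H_{r(e),p} → H_{s(e),p}`. -/
def edgeOp (p : V) {q q' : V} (e : q ⟶ q') :
    Adjointable (G.A p) (HMod 𝓔 p q') (HMod 𝓔 p q) :=
  (kernel 𝓔 p q').extendOp (kernel 𝓔 p q)
    (PosDefKernel.linExt _ _ (edgeAct 𝓔 e (Quiver.reverse e) rfl))
    (PosDefKernel.linExt _ _ (edgeAct 𝓔 (Quiver.reverse e) e (Quiver.reverse_reverse e).symm))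
    (PosDefKernel.inner_linExt_comm (edgeAct_adj 𝓔 _ _ _ _)) 1
    (PosDefKernel.norm_linExt_le (edgeAct_isom 𝓔 _ _ _ (Quiver.reverse_reverse e).symm))
    (PosDefKernel.norm_linExt_le (edgeAct_isom 𝓔 _ _ _ rfl))

theorem edgeOp_gen (p : V) {q q' : V} (e : q ⟶ q') (s : G.RedWord 𝓔 p q') :
    (edgeOp 𝓔 p e).toCLM ((kernel 𝓔 p q').gen s) =
      (kernel 𝓔 p q).toMod (edgeAct 𝓔 e (Quiver.reverse e) rfl s) := by
  rw [edgeOp, PosDefKernel.extendOp_gen, PosDefKernel.linExt_single, MulOpposite.op_one, one_smul]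

theorem edgeOp_reverse_gen (p : V) {q q' : V} (e : q ⟶ q') (s : G.RedWord 𝓔 p q) :
    (edgeOp 𝓔 p (Quiver.reverse e)).toCLM ((kernel 𝓔 p q).gen s) =
      (kernel 𝓔 p q').toMod
        (edgeAct 𝓔 (Quiver.reverse e) e (Quiver.reverse_reverse e).symm s) := by
  have h : ∀ (g : q ⟶ q') (hg : g = e), edgeAct 𝓔 (Quiver.reverse e) g
      (hg.trans (Quiver.reverse_reverse e).symm) s =
      edgeAct 𝓔 (Quiver.reverse e) e (Quiver.reverse_reverse e).symm s := by
    rintro g rfl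
    rfl
  rw [edgeOp_gen, ← h _ (Quiver.reverse_reverse e)]

theorem edgeOp_adjoint (p : V) {q q' : V} (e : q ⟶ q') :
    (edgeOp 𝓔 p e).adjoint = edgeOp 𝓔 p (Quiver.reverse e) := by
  refine PosDefKernel.adjointable_ext fun s t => ?_
  rw [edgeOp_reverse_gen]
  change inner _ _ ((edgeOp 𝓔 p e).adjCLM _) = _
  rw [← Adjointable.inner_adj, edgeOp_gen, PosDefKernel.gen, PosDefKernel.gen,
    PosDefKernel.inner_toMod, PosDefKernel.inner_toMod]
  exact edgeAct_adj 𝓔 _ _ _ _ _ _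

theorem edgeOp_adjoint_comp (p : V) {q q' : V} (e : q ⟶ q') :
    (edgeOp 𝓔 p e).adjoint.comp (edgeOp 𝓔 p e) = .id := by
  refine PosDefKernel.adjointable_ext fun s t => ?_
  change inner _ _ ((edgeOp 𝓔 p e).adjCLM ((edgeOp 𝓔 p e).toCLM _)) = inner _ _ _
  rw [← Adjointable.inner_adj, edgeOp_gen, edgeOp_gen, PosDefKernel.inner_toMod,
    edgeAct_isom 𝓔 _ _ _ (Quiver.reverse_reverse e).symm, ← PosDefKernel.inner_gen]
  rfl

theorem edgeOp_comp_adjoint (p : V) {q q' : V} (e : q ⟶ q') :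
    (edgeOp 𝓔 p e).comp (edgeOp 𝓔 p e).adjoint = .id := by
  have h := edgeOp_adjoint_comp 𝓔 p (Quiver.reverse e)
  rwa [← edgeOp_adjoint, Adjointable.adjoint_adjoint] at h

section intertwine

variable {p q q' : V}

theorem inner_act_single (s t : G.RedWord 𝓔 p q) (y : G.A q) :
    inner (G.A p) (act 𝓔 y s) ((kernel 𝓔 p q).single t 1) = s.word.coef 𝓔 t.word (star y) := by
  rw [← PreHilbertModule.star_inner, inner_act, Word.coef_star]

theorem inner_act_edgeAct (e : q ⟶ q') (f : q' ⟶ q) (hf : f = Quiver.reverse e)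
    (hf' : e = Quiver.reverse f) (t : G.RedWord 𝓔 p q) (s : G.RedWord 𝓔 p q') (b : G.B e) :
    inner (G.A p) (act 𝓔 (G.s e (star b)) t) (edgeAct 𝓔 e f hf s) =
      inner (G.A p) (edgeAct 𝓔 f e hf' t) (act 𝓔 (G.r e b) s) := by
  obtain ⟨β, hβ, hβ'⟩ := r_range e f hf b
  obtain ⟨s, hs⟩ := s
  obtain ⟨t, ht⟩ := t
  by_cases h1 : s.Begins f
  · obtain ⟨a, s', rfl⟩ := h1
    obtain ⟨γ, hγ, -⟩ := r_range f e hf' (𝓔.E f a)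
    rw [edgeAct_cons, PreHilbertModule.inner_add_right, inner_act_single, inner_act_act,
      ← map_star (G.s e), star_star]
    dsimp only
    by_cases h2 : t.Begins e
    · obtain ⟨c, t', rfl⟩ := h2
      obtain ⟨δ, hδ, -⟩ := r_range e f hf (𝓔.E e (star c))
      rw [edgeAct_cons, PreHilbertModule.inner_add_left, inner_act, inner_act_act, add_comm]
      dsimp only
      rw [← map_star (G.r e), E_star]
      congr 1
      · rw [Word.coef_cons_cons, star_one, one_mul, ← hβ, 𝓔.E_s_mul, map_mul (G.r f), hβ', ← hγ,
          ← map_mul (G.s e), coef_cen 𝓔 f e hf' c t' s' a hs]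
      · rw [Word.coef_cons_cons, mul_one, 𝓔.E_mul_s, map_mul (G.r e), ← hβ, ← hδ,
          ← map_mul (G.s f), coef_cen_right 𝓔 e f hf a s' t' c ht]
    · rw [edgeAct_of_not _ _ _ _ _ h2, inner_act]
      dsimp only
      rw [Word.coef_of_not_begins_left _ _ _ _ h2, zero_add, Word.coef_cons_cons, star_one,
        one_mul, ← hβ, 𝓔.E_s_mul, map_mul (G.r f), hβ']
  · rw [edgeAct_of_not _ _ _ _ _ h1, inner_act_single, ← map_star (G.s e), star_star]
    dsimp only
    by_cases h2 : t.Begins e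
    · obtain ⟨c, t', rfl⟩ := h2
      rw [edgeAct_cons, PreHilbertModule.inner_add_left, inner_act, inner_act_act]
      dsimp only
      rw [Word.coef_of_not_begins _ _ _ _ h1, zero_add, Word.coef_cons_cons, mul_one, 𝓔.E_mul_s,
        map_mul (G.r e), ← E_star, map_star (G.r e)]
    · rw [edgeAct_of_not _ _ _ _ _ h2, inner_act]
      dsimp only
      rw [Word.coef_of_not_begins _ _ _ _ h1, Word.coef_of_not_begins_left _ _ _ _ h2]

end intertwine

theorem edgeOp_intertwine (p : V) {q q' : V} (e : q ⟶ q') (b : G.B e) :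
    (leftAction 𝓔 p q (G.s e b)).comp (edgeOp 𝓔 p e) =
      (edgeOp 𝓔 p e).comp (leftAction 𝓔 p q' (G.r e b)) := by
  have hadj : (leftAction 𝓔 p q (G.s e b)).adjoint = leftAction 𝓔 p q (G.s e (star b)) := by
    rw [← Adjointable.star_eq_adjoint, ← map_star, ← map_star]
  refine PosDefKernel.adjointable_ext fun s t => ?_
  change inner _ _ ((leftAction 𝓔 p q (G.s e b)).toCLM ((edgeOp 𝓔 p e).toCLM _)) =
    inner _ _ ((edgeOp 𝓔 p e).toCLM ((leftAction 𝓔 p q' (G.r e b)).toCLM _))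
  rw [← (leftAction 𝓔 p q (G.s e b)).inner_adj', ← (edgeOp 𝓔 p e).inner_adj' _
    ((leftAction 𝓔 p q' (G.r e b)).toCLM _)]
  change inner (G.A p) ((leftAction 𝓔 p q (G.s e b)).adjoint.toCLM _) _ =
    inner (G.A p) ((edgeOp 𝓔 p e).adjoint.toCLM _) _
  rw [hadj, edgeOp_adjoint, leftAction_gen, leftAction_gen, edgeOp_gen, edgeOp_reverse_gen,
    PosDefKernel.inner_toMod, PosDefKernel.inner_toMod]
  exact inner_act_edgeAct 𝓔 _ _ _ _ _ _ _

theorem edgeOp_relation (p : V) {q q' : V} (e : q ⟶ q') (b : G.B e) :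
    (edgeOp 𝓔 p e).adjoint.comp ((leftAction 𝓔 p q (G.s e b)).comp (edgeOp 𝓔 p e)) =
      leftAction 𝓔 p q' (G.r e b) := by
  rw [edgeOp_intertwine, ← Adjointable.comp_assoc, edgeOp_adjoint_comp, Adjointable.id_comp]

/-- The operator `u_w^p = u_{e₁}^p ⋯ u_{eₙ}^p : H_{p',p} → H_{q,p}` for a path `w = (e₁, …, eₙ)`
from `q` to `p'`. -/
def pathOp (p : V) {p' : V} : ∀ {q : V}, EdgePath p' q →
    Adjointable (G.A p) (HMod 𝓔 p p') (HMod 𝓔 p q)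
  | _, .nil => .id
  | _, .cons e l => (edgeOp 𝓔 p e).comp (pathOp p l)

theorem pathOp_adjoint_comp (p : V) {p' q : V} (l : EdgePath p' q) :
    (pathOp 𝓔 p l).adjoint.comp (pathOp 𝓔 p l) = .id := by
  induction l with
  | nil => rfl
  | cons e l ih =>
    rw [pathOp, Adjointable.adjoint_comp, Adjointable.comp_assoc,
      ← Adjointable.comp_assoc (edgeOp 𝓔 p e).adjoint, edgeOp_adjoint_comp, Adjointable.id_comp, ih]

theorem pathOp_comp_adjoint (p : V) {p' q : V} (l : EdgePath p' q) :
    (pathOp 𝓔 p l).comp (pathOp 𝓔 p l).adjoint = .id := by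
  induction l with
  | nil => rfl
  | cons e l ih =>
    rw [pathOp, Adjointable.adjoint_comp, Adjointable.comp_assoc,
      ← Adjointable.comp_assoc (pathOp 𝓔 p l), ih, Adjointable.id_comp, edgeOp_comp_adjoint]

end GraphOfCStarAlgebras

/-- The free unital complex algebra on a set `X`, which becomes a ⋆-algebra for an involution
of `X`. -/
def FreeStarAlg {X : Type*} (σ : X → X) (_hσ : Function.Involutive σ) : Type _ :=
  FreeAlgebra ℂ X

namespace FreeStarAlg

variable {X : Type*} {σ : X → X} {hσ : Function.Involutive σ}

instance : Ring (FreeStarAlg σ hσ) := inferInstanceAs (Ring (FreeAlgebra ℂ X))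
instance : Algebra ℂ (FreeStarAlg σ hσ) := inferInstanceAs (Algebra ℂ (FreeAlgebra ℂ X))

/-- The generators. -/
def ι (x : X) : FreeStarAlg σ hσ := FreeAlgebra.ι ℂ x

/-- The ⋆-operation as a ring homomorphism to the opposite ring. -/
def starHom : FreeStarAlg σ hσ →+* (FreeStarAlg σ hσ)ᵐᵒᵖ :=
  letI : Algebra ℂ (FreeStarAlg σ hσ)ᵐᵒᵖ := Algebra.compHom _ (starRingEnd ℂ)
  (FreeAlgebra.lift ℂ fun x => MulOpposite.op (ι (hσ := hσ) (σ x))).toRingHom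

theorem starHom_ι (x : X) : starHom (ι x : FreeStarAlg σ hσ) = MulOpposite.op (ι (σ x)) :=
  letI : Algebra ℂ (FreeStarAlg σ hσ)ᵐᵒᵖ := Algebra.compHom _ (starRingEnd ℂ)
  FreeAlgebra.lift_ι_apply (R := ℂ) (fun x => MulOpposite.op (ι (hσ := hσ) (σ x))) x

theorem starHom_algebraMap (c : ℂ) : starHom (algebraMap ℂ (FreeStarAlg σ hσ) c) =
    MulOpposite.op (algebraMap ℂ _ (star c)) :=
  letI : Algebra ℂ (FreeStarAlg σ hσ)ᵐᵒᵖ := Algebra.compHom _ (starRingEnd ℂ)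
  (FreeAlgebra.lift ℂ fun x => MulOpposite.op (ι (hσ := hσ) (σ x))).commutes c

@[elab_as_elim]
theorem induction {C : FreeStarAlg σ hσ → Prop} (h1 : ∀ c, C (algebraMap ℂ _ c))
    (h2 : ∀ x, C (ι x)) (h3 : ∀ a b, C a → C b → C (a * b)) (h4 : ∀ a b, C a → C b → C (a + b))
    (a : FreeStarAlg σ hσ) : C a :=
  FreeAlgebra.induction ℂ X h1 h2 h3 h4 a

theorem starHom_starHom (a : FreeStarAlg σ hσ) : (starHom (starHom a).unop).unop = a := by
  induction a using induction with
  | h1 c =>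
    rw [starHom_algebraMap, MulOpposite.unop_op, starHom_algebraMap, star_star,
      MulOpposite.unop_op]
  | h2 x => rw [starHom_ι, MulOpposite.unop_op, starHom_ι, hσ, MulOpposite.unop_op]
  | h3 a b ha hb =>
    rw [map_mul, MulOpposite.unop_mul, map_mul, MulOpposite.unop_mul, ha, hb]
  | h4 a b ha hb =>
    rw [map_add, MulOpposite.unop_add, map_add, MulOpposite.unop_add, ha, hb]

instance : StarRing (FreeStarAlg σ hσ) where
  star a := (starHom a).unop
  star_involutive := starHom_starHom
  star_mul a b := by
    change (starHom (a * b)).unop = (starHom b).unop * (starHom a).unop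
    rw [map_mul, MulOpposite.unop_mul]
  star_add a b := by
    change (starHom (a + b)).unop = (starHom a).unop + (starHom b).unop
    rw [map_add, MulOpposite.unop_add]

theorem star_ι (x : X) : star (ι x : FreeStarAlg σ hσ) = ι (σ x) := by
  change (starHom (ι x)).unop = _
  rw [starHom_ι, MulOpposite.unop_op]

theorem star_algebraMap (c : ℂ) :
    star (algebraMap ℂ (FreeStarAlg σ hσ) c) = algebraMap ℂ _ (star c) := by
  change (starHom _).unop = _
  rw [starHom_algebraMap, MulOpposite.unop_op]

instance : StarModule ℂ (FreeStarAlg σ hσ) where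
  star_smul c a := by
    rw [Algebra.smul_def, Algebra.smul_def, star_mul, star_algebraMap, Algebra.commutes]

/-- The algebra homomorphism given by images of the generators. -/
def liftAlg {C : Type*} [Ring C] [Algebra ℂ C] (φ : X → C) : FreeStarAlg σ hσ →ₐ[ℂ] C :=
  (FreeAlgebra.lift ℂ φ : FreeAlgebra ℂ X →ₐ[ℂ] C)

theorem liftAlg_ι {C : Type*} [Ring C] [Algebra ℂ C] (φ : X → C) (x : X) :
    liftAlg (hσ := hσ) φ (ι x) = φ x :=
  FreeAlgebra.lift_ι_apply (R := ℂ) φ x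

/-- The ⋆-homomorphism given by images of the generators that are compatible with the
involution. -/
def lift {C : Type*} [Ring C] [StarRing C] [Algebra ℂ C] [StarModule ℂ C] (φ : X → C)
    (hφ : ∀ x, φ (σ x) = star (φ x)) : FreeStarAlg σ hσ →⋆ₐ[ℂ] C :=
  StarAlgHom.mk (liftAlg φ) fun a => by
    change liftAlg φ (star a) = star (liftAlg φ a)
    induction a using induction with
    | h1 c => rw [star_algebraMap, AlgHom.commutes, AlgHom.commutes, algebraMap_star_comm]
    | h2 x => rw [star_ι, liftAlg_ι, liftAlg_ι, hφ]
    | h3 a b ha hb => rw [star_mul, map_mul, map_mul, star_mul, ha, hb]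
    | h4 a b ha hb => rw [star_add, map_add, map_add, star_add, ha, hb]

theorem lift_ι {C : Type*} [Ring C] [StarRing C] [Algebra ℂ C] [StarModule ℂ C] (φ : X → C)
    (hφ : ∀ x, φ (σ x) = star (φ x)) (x : X) : lift (hσ := hσ) φ hφ (ι x) = φ x :=
  liftAlg_ι φ x

end FreeStarAlg

namespace GraphOfCStarAlgebras

variable {V : Type u} [Quiver.{v} V] [Quiver.HasInvolutiveReverse V]
  (G : GraphOfCStarAlgebras.{u, v, w, x} V) (T : MaximalSubtree V)

/-- The generators of the maximal fundamental C⋆-algebra: the elements of the algebras `A q`, and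
the unitaries `u_e`. -/
inductive Gen : Type (max u v w)
  | elt (q : V) (a : G.A q) : Gen
  | edge {q q' : V} (e : q ⟶ q') : Gen

/-- The involution of the generators: `u_e⋆ = u_ē`. -/
def Gen.inv : G.Gen → G.Gen
  | .elt q a => .elt q (star a)
  | .edge e => .edge (Quiver.reverse e)

theorem Gen.inv_involutive : Function.Involutive (Gen.inv G) := by
  intro x
  cases x with
  | elt q a => rw [inv, inv, star_star]
  | edge e => rw [inv, inv, Quiver.reverse_reverse]

/-- The free ⋆-algebra on the generators. -/
abbrev FreeAlg : Type (max u v w) := FreeStarAlg (Gen.inv G) (Gen.inv_involutive G)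

variable {G}

/-- The generator of the free ⋆-algebra given by an element of `A q`. -/
def FreeAlg.elt {q : V} (a : G.A q) : G.FreeAlg := FreeStarAlg.ι (.elt q a)

/-- The generator `u_e` of the free ⋆-algebra. -/
def FreeAlg.edge {q q' : V} (e : q ⟶ q') : G.FreeAlg := FreeStarAlg.ι (.edge e)

theorem FreeAlg.star_elt {q : V} (a : G.A q) : star (FreeAlg.elt a) = FreeAlg.elt (star a) :=
  FreeStarAlg.star_ι _

theorem FreeAlg.star_edge {q q' : V} (e : q ⟶ q') :
    star (FreeAlg.edge (G := G) e) = FreeAlg.edge (Quiver.reverse e) :=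
  FreeStarAlg.star_ι _

/-- The elements of the free ⋆-algebra that vanish in the maximal fundamental C⋆-algebra: the
relations of the algebras `A q` (with their units), `u_e⋆ u_e = 1`, `u_ē s_e(b) u_e = r_e(b)`, and
`u_e = 1` for the edges of `T`. The relation `u_e⋆ = u_ē` is in the definition of the
⋆-operation, and `u_e u_e⋆ = u_ē⋆ u_ē = 1` is the relation for `ē`. -/
inductive Relator : G.FreeAlg → Prop
  | add {q : V} (a b : G.A q) :
      Relator (FreeAlg.elt (a + b) - (FreeAlg.elt a + FreeAlg.elt b))
  | smul {q : V} (c : ℂ) (a : G.A q) : Relator (FreeAlg.elt (c • a) - c • FreeAlg.elt a)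
  | mul {q : V} (a b : G.A q) : Relator (FreeAlg.elt (a * b) - FreeAlg.elt a * FreeAlg.elt b)
  | one (q : V) : Relator (FreeAlg.elt (1 : G.A q) - 1)
  | unitary {q q' : V} (e : q ⟶ q') : Relator (star (FreeAlg.edge e) * FreeAlg.edge e - 1)
  | edge {q q' : V} (e : q ⟶ q') (b : G.B e) : Relator
      (FreeAlg.edge (Quiver.reverse e) * FreeAlg.elt (G.s e b) * FreeAlg.edge e -
        FreeAlg.elt (G.r e b))
  | tree {q q' : V} (e : q ⟶ q') (he : T.Mem e) : Relator (FreeAlg.edge e - 1)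

variable (G)

/-- The C⋆-seminorms on the free ⋆-algebra that vanish on the relators. -/
structure Admissible where
  seminorm : CStarSeminorm G.FreeAlg
  vanish : ∀ y, Relator T y → seminorm.toSeminorm y = 0

variable {G} {T}

theorem Admissible.toCompletion_eq (σ : G.Admissible T) {y z : G.FreeAlg}
    (h : Relator T (y - z)) : σ.1.toCompletion y = σ.1.toCompletion z := by
  rw [← sub_eq_zero, ← map_sub, ← norm_eq_zero, CStarSeminorm.norm_toCompletion]
  exact σ.2 _ h

/-- The ⋆-homomorphism from `A q` to the completion for an admissible C⋆-seminorm. -/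
def Admissible.vertexHom (σ : G.Admissible T) (q : V) : G.A q →⋆ₐ[ℂ] σ.1.Completion where
  toFun a := σ.1.toCompletion (FreeAlg.elt a)
  map_one' := (σ.toCompletion_eq (.one q)).trans (map_one _)
  map_mul' a b := (σ.toCompletion_eq (.mul a b)).trans (map_mul _ _ _)
  map_zero' := by
    have := σ.toCompletion_eq (.smul 0 (0 : G.A q))
    rwa [zero_smul, zero_smul, map_zero] at this
  map_add' a b := (σ.toCompletion_eq (.add a b)).trans (map_add _ _ _)
  commutes' c := by
    rw [Algebra.algebraMap_eq_smul_one, Algebra.algebraMap_eq_smul_one,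
      σ.toCompletion_eq (.smul c 1), map_smul, σ.toCompletion_eq (.one q), map_one]
  map_star' a := by rw [← FreeAlg.star_elt, map_star]

theorem Admissible.elt_le (σ : G.Admissible T) {q : V} (a : G.A q) :
    σ.1.toSeminorm (FreeAlg.elt a) ≤ ‖a‖ := by
  rw [← CStarSeminorm.norm_toCompletion]
  exact NonUnitalStarAlgHom.norm_apply_le (σ.vertexHom q) a

theorem Admissible.one_le (σ : G.Admissible T) : σ.1.toSeminorm 1 ≤ 1 := by
  have h := σ.1.star_mul_self' 1
  rw [star_one, one_mul] at h
  have h' : σ.1.toSeminorm 1 = σ.1.toSeminorm 1 * σ.1.toSeminorm 1 := h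
  nlinarith [apply_nonneg σ.1.toSeminorm 1, sq_nonneg (σ.1.toSeminorm 1 - 1)]

theorem Admissible.edge_le (σ : G.Admissible T) {q q' : V} (e : q ⟶ q') :
    σ.1.toSeminorm (FreeAlg.edge e) ≤ 1 := by
  have h := σ.toCompletion_eq (.unitary e)
  rw [map_mul, map_star, map_one] at h
  rw [← CStarSeminorm.norm_toCompletion]
  have h2 := CStarRing.norm_star_mul_self (x := σ.1.toCompletion (FreeAlg.edge e))
  rw [h, ← map_one σ.1.toCompletion, CStarSeminorm.norm_toCompletion] at h2
  nlinarith [σ.one_le, norm_nonneg (σ.1.toCompletion (FreeAlg.edge e))]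

variable (T) in
theorem admissible_bdd (y : G.FreeAlg) : ∃ C : ℝ, 0 ≤ C ∧ ∀ σ : G.Admissible T,
    σ.1.toSeminorm y ≤ C := by
  induction y using FreeStarAlg.induction with
  | h1 c =>
    refine ⟨‖c‖, norm_nonneg _, fun σ => ?_⟩
    rw [Algebra.algebraMap_eq_smul_one, map_smul_eq_mul]
    exact mul_le_of_le_one_right (norm_nonneg _) σ.one_le
  | h2 z =>
    cases z with
    | elt q a => exact ⟨‖a‖, norm_nonneg _, fun σ => σ.elt_le a⟩
    | edge e => exact ⟨1, zero_le_one, fun σ => σ.edge_le e⟩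
  | h3 a b ha hb =>
    obtain ⟨C, hC, h⟩ := ha
    obtain ⟨D, hD, h'⟩ := hb
    exact ⟨C * D, mul_nonneg hC hD, fun σ => (σ.1.mul_le' a b).trans
      (mul_le_mul (h σ) (h' σ) (apply_nonneg σ.1.toSeminorm b) hC)⟩
  | h4 a b ha hb =>
    obtain ⟨C, hC, h⟩ := ha
    obtain ⟨D, hD, h'⟩ := hb
    exact ⟨C + D, add_nonneg hC hD, fun σ => (map_add_le_add _ a b).trans
      (add_le_add (h σ) (h' σ))⟩

theorem admissible_bddAbove (y : G.FreeAlg) :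
    BddAbove (Set.range fun σ : G.Admissible T => σ.1.toSeminorm y) := by
  obtain ⟨C, -, h⟩ := admissible_bdd T y
  exact ⟨C, Set.forall_mem_range.2 h⟩

instance : Nonempty (G.Admissible T) :=
  ⟨⟨{ (0 : Seminorm ℂ G.FreeAlg) with
      mul_le' := fun _ _ => (mul_zero _).ge
      star_mul_self' := fun _ => (mul_zero _).symm }, fun _ _ => rfl⟩⟩

theorem Admissible.sq_eq (σ : G.Admissible T) (y : G.FreeAlg) :
    σ.1.toSeminorm (star y * y) = σ.1.toSeminorm y * σ.1.toSeminorm y := σ.1.star_mul_self' y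

variable (G) (T)

/-- The supremum of the C⋆-seminorms on the free ⋆-algebra that vanish on the relators. -/
def maxSeminorm : CStarSeminorm G.FreeAlg where
  toFun y := ⨆ σ : G.Admissible T, σ.1.toSeminorm y
  map_zero' := by simp
  add_le' y z := ciSup_le fun σ => (map_add_le_add _ y z).trans
    (add_le_add (le_ciSup (admissible_bddAbove y) σ) (le_ciSup (admissible_bddAbove z) σ))
  neg' y := by simp
  smul' c y := by
    simp only [map_smul_eq_mul]
    rw [Real.mul_iSup_of_nonneg (norm_nonneg c)]
  mul_le' y z := ciSup_le fun σ => (σ.1.mul_le' y z).trans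
    (mul_le_mul (le_ciSup (admissible_bddAbove y) σ) (le_ciSup (admissible_bddAbove z) σ)
      (apply_nonneg σ.1.toSeminorm z) (Real.iSup_nonneg fun σ => apply_nonneg σ.1.toSeminorm y))
  star_mul_self' y := by
    have h0 : 0 ≤ ⨆ σ : G.Admissible T, σ.1.toSeminorm y :=
      Real.iSup_nonneg fun σ => apply_nonneg σ.1.toSeminorm y
    refine le_antisymm (ciSup_le fun σ => ?_) ?_
    · rw [σ.sq_eq]
      exact mul_self_le_mul_self (apply_nonneg _ _) (le_ciSup (admissible_bddAbove y) σ)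
    · have h1 : ⨆ σ : G.Admissible T, σ.1.toSeminorm y ≤
          √(⨆ σ : G.Admissible T, σ.1.toSeminorm (star y * y)) := ciSup_le fun σ =>
        Real.le_sqrt_of_sq_le (by
          rw [sq, ← σ.sq_eq]
          exact le_ciSup (admissible_bddAbove (star y * y)) σ)
      refine (mul_self_le_mul_self h0 h1).trans (le_of_eq (Real.mul_self_sqrt ?_))
      exact Real.iSup_nonneg fun σ => apply_nonneg σ.1.toSeminorm _

theorem maxSeminorm_vanish (y : G.FreeAlg) (hy : Relator T y) :
    (G.maxSeminorm T).toSeminorm y = 0 := by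
  change ⨆ σ : G.Admissible T, σ.1.toSeminorm y = 0
  simp_rw [Admissible.vanish _ y hy, ciSup_const]

/-- The maximal fundamental C⋆-algebra of the graph of C⋆-algebras with respect to the maximal
subtree: the universal C⋆-algebra for the generators and relations above, that is the
separation-completion of the free ⋆-algebra on the generators for the largest C⋆-seminorm that
vanishes on the relators. -/
abbrev MaxAlg : Type (max u v w) := (G.maxSeminorm T).Completion

variable {G}

/-- The canonical ⋆-homomorphism from `A q` to the maximal fundamental C⋆-algebra. -/
def ofVertex (q : V) : G.A q →⋆ₐ[ℂ] G.MaxAlg T :=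
  Admissible.vertexHom ⟨G.maxSeminorm T, G.maxSeminorm_vanish T⟩ q

variable (G) in
/-- The unitary `u_e` of the maximal fundamental C⋆-algebra. -/
def ofEdge {q q' : V} (e : q ⟶ q') : G.MaxAlg T :=
  (G.maxSeminorm T).toCompletion (FreeAlg.edge e)

/-- ⋆-homomorphisms of the `A q` to a unital C⋆-algebra and unitaries that satisfy the relations of
the maximal fundamental C⋆-algebra. -/
structure Rep (G : GraphOfCStarAlgebras.{u, v, w, x} V) (T : MaximalSubtree V) (C : Type*)
    [CStarAlgebra C] where
  ν : ∀ q : V, G.A q →⋆ₐ[ℂ] C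
  U : ∀ {q q' : V}, (q ⟶ q') → C
  star_U : ∀ {q q' : V} (e : q ⟶ q'), star (U e) = U (Quiver.reverse e)
  star_U_mul : ∀ {q q' : V} (e : q ⟶ q'), star (U e) * U e = 1
  U_mul : ∀ {q q' : V} (e : q ⟶ q') (b : G.B e), U (Quiver.reverse e) * ν q (G.s e b) * U e =
    ν q' (G.r e b)
  tree : ∀ {q q' : V} (e : q ⟶ q'), T.Mem e → U e = 1

namespace Rep

variable {T} {C : Type*} [CStarAlgebra C] (ρ : G.Rep T C)

/-- The ⋆-homomorphism from the free ⋆-algebra. -/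
def freeHom : G.FreeAlg →⋆ₐ[ℂ] C :=
  FreeStarAlg.lift (fun y : G.Gen => match y with
    | .elt q a => ρ.ν q a
    | .edge e => ρ.U e) (fun y => by
      cases y with
      | elt q a => exact map_star (ρ.ν q) a
      | edge e => exact (ρ.star_U e).symm)

theorem freeHom_elt {q : V} (a : G.A q) : ρ.freeHom (FreeAlg.elt a) = ρ.ν q a :=
  FreeStarAlg.lift_ι _ _ _

theorem freeHom_edge {q q' : V} (e : q ⟶ q') : ρ.freeHom (FreeAlg.edge e) = ρ.U e :=
  FreeStarAlg.lift_ι _ _ _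

theorem freeHom_relator (y : G.FreeAlg) (hy : Relator T y) : ρ.freeHom y = 0 := by
  induction hy with
  | add a b => rw [map_sub, map_add, freeHom_elt, freeHom_elt, freeHom_elt, map_add, sub_self]
  | smul c a => rw [map_sub, map_smul, freeHom_elt, freeHom_elt, map_smul, sub_self]
  | mul a b => rw [map_sub, map_mul, freeHom_elt, freeHom_elt, freeHom_elt, map_mul, sub_self]
  | one q => rw [map_sub, freeHom_elt, map_one, map_one, sub_self]
  | unitary e => rw [map_sub, map_mul, map_star, freeHom_edge, star_U_mul, map_one, sub_self]
  | edge e b =>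
    rw [map_sub, map_mul, map_mul, freeHom_edge, freeHom_edge, freeHom_elt, freeHom_elt, U_mul,
      sub_self]
  | tree e he => rw [map_sub, freeHom_edge, ρ.tree e he, map_one, sub_self]

theorem norm_freeHom_le (y : G.FreeAlg) : ‖ρ.freeHom y‖ ≤ (G.maxSeminorm T).toSeminorm y :=
  le_ciSup (f := fun σ : G.Admissible T => σ.1.toSeminorm y) (admissible_bddAbove y)
    ⟨CStarSeminorm.ofHom ρ.freeHom, fun z hz => by
      change ‖ρ.freeHom z‖ = 0
      rw [ρ.freeHom_relator z hz, norm_zero]⟩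

/-- The ⋆-homomorphism from the maximal fundamental C⋆-algebra given by its universal property. -/
def hom : G.MaxAlg T →⋆ₐ[ℂ] C := (G.maxSeminorm T).lift ρ.freeHom ρ.norm_freeHom_le

theorem hom_ofVertex {q : V} (a : G.A q) : ρ.hom (ofVertex T q a) = ρ.ν q a :=
  (CStarSeminorm.lift_toCompletion _ _ _ _).trans (ρ.freeHom_elt a)

theorem hom_ofEdge {q q' : V} (e : q ⟶ q') : ρ.hom (G.ofEdge T e) = ρ.U e :=
  (CStarSeminorm.lift_toCompletion _ _ _ _).trans (ρ.freeHom_edge e)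

end Rep

end GraphOfCStarAlgebras

namespace GraphOfCStarAlgebras

variable {V : Type u} [Quiver.{v} V] [Quiver.HasInvolutiveReverse V]
  {G : GraphOfCStarAlgebras.{u, v, w, x} V} (T : MaximalSubtree V) (𝓔 : G.CondExps)

theorem geodesic_edgesIn (p q : V) : (T.geodesic p q).EdgesIn T.Mem :=
  (T.existsUnique p q).choose_spec.1.1

theorem geodesic_noBacktrack (p q : V) : (T.geodesic p q).NoBacktrack :=
  (T.existsUnique p q).choose_spec.1.2

theorem eq_geodesic {p q : V} (l : EdgePath p q) (h : l.EdgesIn T.Mem) (h' : l.NoBacktrack) :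
    l = T.geodesic p q :=
  (T.existsUnique p q).choose_spec.2 l ⟨h, h'⟩

theorem geodesic_cons (p : V) {q q' : V} (e : q ⟶ q') (he : T.Mem e) :
    T.geodesic p q = .cons e (T.geodesic p q') ∨
      T.geodesic p q' = .cons (Quiver.reverse e) (T.geodesic p q) := by
  by_cases h : ∃ l, T.geodesic p q' = .cons (Quiver.reverse e) l
  · obtain ⟨l, hl⟩ := h
    right
    have h1 := geodesic_edgesIn T p q'
    have h2 := geodesic_noBacktrack T p q'
    rw [hl] at h1 h2
    rw [hl, eq_geodesic T l h1.2 h2.2]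
  · left
    exact (eq_geodesic T (.cons e (T.geodesic p q')) ⟨he, geodesic_edgesIn T p q'⟩
      ⟨fun l hl => h ⟨l, hl⟩, geodesic_noBacktrack T p q'⟩).symm

/-- The unitary operator `w_e^p = (u_{g_{s(e)p}}^p)⋆ u_{(e, g_{r(e)p})}^p` of `H_{p,p}`, where `g`
denotes geodesic paths in the maximal subtree. -/
def loopOp (p : V) {q q' : V} (e : q ⟶ q') :
    Adjointable (G.A p) (HMod 𝓔 p p) (HMod 𝓔 p p) :=
  (pathOp 𝓔 p (T.geodesic p q)).adjoint.comp (pathOp 𝓔 p (.cons e (T.geodesic p q')))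

theorem loopOp_tree (p : V) {q q' : V} (e : q ⟶ q') (he : T.Mem e) : loopOp T 𝓔 p e = .id := by
  rcases geodesic_cons T p e he with h | h
  · rw [loopOp, ← h, pathOp_adjoint_comp]
  · rw [loopOp, h, pathOp, pathOp, ← Adjointable.comp_assoc (edgeOp 𝓔 p e), ← edgeOp_adjoint,
      edgeOp_comp_adjoint, Adjointable.id_comp, pathOp_adjoint_comp]

theorem loopOp_adjoint (p : V) {q q' : V} (e : q ⟶ q') :
    (loopOp T 𝓔 p e).adjoint = loopOp T 𝓔 p (Quiver.reverse e) := by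
  rw [loopOp, loopOp, pathOp, pathOp, Adjointable.adjoint_comp, Adjointable.adjoint_comp,
    Adjointable.adjoint_adjoint, edgeOp_adjoint, Adjointable.comp_assoc]

theorem loopOp_adjoint_comp (p : V) {q q' : V} (e : q ⟶ q') :
    (loopOp T 𝓔 p e).adjoint.comp (loopOp T 𝓔 p e) = .id := by
  rw [loopOp, Adjointable.adjoint_comp, Adjointable.adjoint_adjoint, Adjointable.comp_assoc,
    ← Adjointable.comp_assoc (pathOp 𝓔 p (T.geodesic p q)), pathOp_comp_adjoint,
    Adjointable.id_comp, pathOp_adjoint_comp]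

/-- The ⋆-homomorphism `π_{q,p} : A q → 𝓛(H_{p,p})`,
`π_{q,p}(a) = (u_{g_{qp}}^p)⋆ λ_{q,p}(a) u_{g_{qp}}^p`. -/
def vertexRep (p q : V) : G.A q →⋆ₐ[ℂ] Adjointable (G.A p) (HMod 𝓔 p p) (HMod 𝓔 p p) where
  toFun a := (pathOp 𝓔 p (T.geodesic p q)).adjoint.comp
    ((leftAction 𝓔 p q a).comp (pathOp 𝓔 p (T.geodesic p q)))
  map_one' := by
    rw [map_one]
    exact pathOp_adjoint_comp _ _ _
  map_mul' a b := by
    rw [map_mul, Adjointable.mul_eq_comp, Adjointable.mul_eq_comp, Adjointable.comp_assoc,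
      Adjointable.comp_assoc, Adjointable.comp_assoc,
      ← Adjointable.comp_assoc (pathOp 𝓔 p (T.geodesic p q)), pathOp_comp_adjoint,
      Adjointable.id_comp]
  map_zero' := by
    rw [map_zero]
    refine Adjointable.ext (ContinuousLinearMap.ext fun y => ?_)
    exact map_zero (pathOp 𝓔 p (T.geodesic p q)).adjCLM
  map_add' a b := by
    rw [map_add]
    refine Adjointable.ext (ContinuousLinearMap.ext fun y => ?_)
    exact map_add (pathOp 𝓔 p (T.geodesic p q)).adjCLM _ _
  commutes' c := by
    rw [AlgHomClass.commutes, Algebra.algebraMap_eq_smul_one, Algebra.algebraMap_eq_smul_one,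
      ← show (pathOp 𝓔 p (T.geodesic p q)).adjoint.comp (pathOp 𝓔 p (T.geodesic p q)) = 1 from
        pathOp_adjoint_comp _ _ _]
    refine Adjointable.ext (ContinuousLinearMap.ext fun y => ?_)
    exact map_smul (pathOp 𝓔 p (T.geodesic p q)).adjCLM c _
  map_star' a := by
    rw [map_star, Adjointable.star_eq_adjoint, Adjointable.star_eq_adjoint,
      Adjointable.adjoint_comp, Adjointable.adjoint_comp, Adjointable.adjoint_adjoint,
      Adjointable.comp_assoc]

/-- The images in `𝓛(H_{p,p})` of the generators of the maximal fundamental C⋆-algebra. -/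
def reducedRep (p : V) : G.Rep T (Adjointable (G.A p) (HMod 𝓔 p p) (HMod 𝓔 p p)) where
  ν := vertexRep T 𝓔 p
  U e := loopOp T 𝓔 p e
  star_U e := loopOp_adjoint T 𝓔 p e
  star_U_mul e := loopOp_adjoint_comp T 𝓔 p e
  U_mul {q q'} e b := by
    rw [← loopOp_adjoint]
    change ((loopOp T 𝓔 p e).adjoint.comp ((pathOp 𝓔 p (T.geodesic p q)).adjoint.comp
      ((leftAction 𝓔 p q (G.s e b)).comp (pathOp 𝓔 p (T.geodesic p q))))).comp
        (loopOp T 𝓔 p e) = (pathOp 𝓔 p (T.geodesic p q')).adjoint.comp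
          ((leftAction 𝓔 p q' (G.r e b)).comp (pathOp 𝓔 p (T.geodesic p q')))
    have h := pathOp_comp_adjoint 𝓔 p (T.geodesic p q)
    have h1 : ∀ S : Adjointable (G.A p) (HMod 𝓔 p p) (HMod 𝓔 p q),
        (pathOp 𝓔 p (T.geodesic p q)).comp ((pathOp 𝓔 p (T.geodesic p q)).adjoint.comp S) = S :=
      fun S => by rw [← Adjointable.comp_assoc, h, Adjointable.id_comp]
    rw [loopOp, Adjointable.adjoint_comp, Adjointable.adjoint_adjoint]
    simp only [Adjointable.comp_assoc]
    rw [h1, h1, pathOp, Adjointable.adjoint_comp, Adjointable.comp_assoc,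
      ← Adjointable.comp_assoc _ (edgeOp 𝓔 p e), ← Adjointable.comp_assoc _ _ (pathOp 𝓔 p _),
      edgeOp_relation]
  tree e he := loopOp_tree T 𝓔 p e he

/-- The ⋆-homomorphism `λ_p` from the maximal fundamental C⋆-algebra to `𝓛(H_{p,p})`; its range is
the `p`-reduced fundamental C⋆-algebra. -/
def redHom (p : V) : G.MaxAlg T →⋆ₐ[ℂ] Adjointable (G.A p) (HMod 𝓔 p p) (HMod 𝓔 p p) :=
  (reducedRep T 𝓔 p).hom

theorem norm_redHom_le (p : V) (y : G.MaxAlg T) : ‖redHom T 𝓔 p y‖ ≤ ‖y‖ :=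
  NonUnitalStarAlgHom.norm_apply_le (redHom T 𝓔 p) y

theorem redHom_bddAbove (y : G.MaxAlg T) :
    BddAbove (Set.range fun p : V => ‖redHom T 𝓔 p y‖) :=
  ⟨‖y‖, Set.forall_mem_range.2 fun p => norm_redHom_le T 𝓔 p y⟩

/-- The C⋆-seminorm `‖y‖_v = sup {‖λ_p(y)‖ : p ∈ V}` on the maximal fundamental C⋆-algebra. -/
def vertSeminorm : CStarSeminorm (G.MaxAlg T) where
  toFun y := ⨆ p : V, ‖redHom T 𝓔 p y‖
  map_zero' := by simp
  add_le' y z := Real.iSup_le (fun p => by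
    rw [map_add]
    exact (norm_add_le _ _).trans (add_le_add (le_ciSup (redHom_bddAbove T 𝓔 y) p)
      (le_ciSup (redHom_bddAbove T 𝓔 z) p)))
    (add_nonneg (Real.iSup_nonneg fun p => norm_nonneg _)
      (Real.iSup_nonneg fun p => norm_nonneg _))
  neg' y := by simp
  smul' c y := by
    simp only [map_smul, norm_smul]
    rw [Real.mul_iSup_of_nonneg (norm_nonneg c)]
  mul_le' y z := Real.iSup_le (fun p => by
    rw [map_mul]
    exact (norm_mul_le _ _).trans (mul_le_mul (le_ciSup (redHom_bddAbove T 𝓔 y) p)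
      (le_ciSup (redHom_bddAbove T 𝓔 z) p) (norm_nonneg _)
      (Real.iSup_nonneg fun p => norm_nonneg _)))
    (mul_nonneg (Real.iSup_nonneg fun p => norm_nonneg _)
      (Real.iSup_nonneg fun p => norm_nonneg _))
  star_mul_self' y := by
    have h0 : 0 ≤ ⨆ p : V, ‖redHom T 𝓔 p y‖ := Real.iSup_nonneg fun p => norm_nonneg _
    have h0' : 0 ≤ ⨆ p : V, ‖redHom T 𝓔 p (star y * y)‖ :=
      Real.iSup_nonneg fun p => norm_nonneg _
    refine le_antisymm (Real.iSup_le (fun p => ?_) (mul_nonneg h0 h0)) ?_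
    · rw [map_mul, map_star, CStarRing.norm_star_mul_self]
      exact mul_self_le_mul_self (norm_nonneg _) (le_ciSup (redHom_bddAbove T 𝓔 y) p)
    · have h1 : ⨆ p : V, ‖redHom T 𝓔 p y‖ ≤ √(⨆ p : V, ‖redHom T 𝓔 p (star y * y)‖) :=
        Real.iSup_le (fun p => Real.le_sqrt_of_sq_le (by
          rw [sq, ← CStarRing.norm_star_mul_self, ← map_star, ← map_mul]
          exact le_ciSup (redHom_bddAbove T 𝓔 (star y * y)) p)) (Real.sqrt_nonneg _)
      exact (mul_self_le_mul_self h0 h1).trans (le_of_eq (Real.mul_self_sqrt h0'))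

/-- The vertex-reduced fundamental C⋆-algebra `P_vert`: the separation-completion of the maximal
fundamental C⋆-algebra `P` for the C⋆-seminorm `‖·‖_v`. -/
abbrev VertAlg : Type (max u v w) := (vertSeminorm T 𝓔).Completion

/-- The canonical surjection `λ : P → P_vert`. -/
def toVert : G.MaxAlg T →⋆ₐ[ℂ] VertAlg T 𝓔 := (vertSeminorm T 𝓔).toCompletion

variable {T}

/-- The element `a₀ u_{e₁} a₁ ⋯ u_{eₙ} y` of the maximal fundamental C⋆-algebra, for a word
`(a₀, e₁, …, aₙ₋₁, eₙ)` and `y ∈ A p`. -/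
def Word.eval (T : MaximalSubtree V) {p : V} : ∀ {q : V}, G.Word p q → G.A p → G.MaxAlg T
  | _, .nil, y => ofVertex T p y
  | q, .cons a e t, y => ofVertex T q a * G.ofEdge T e * t.eval T y

/-- `E` is a ucp map on the quotient `C` of the maximal fundamental C⋆-algebra that is the identity
on `A p` and vanishes on the reduced operators `a₀ u_{e₁} a₁ ⋯ u_{eₙ} aₙ`, `n ≥ 1`, from `p` to
`p`. -/
structure IsCanonicalUCP {C : Type*} [CStarAlgebra C] (π : G.MaxAlg T →⋆ₐ[ℂ] C) (p : V)
    (E : C →CP G.A p) : Prop where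
  map_one : E 1 = 1
  map_vertex : ∀ a : G.A p, E (π (ofVertex T p a)) = a
  map_reduced : ∀ (s : G.Word p p) (y : G.A p), s ≠ .nil → s.Reduced 𝓔 → E (π (s.eval T y)) = 0

end GraphOfCStarAlgebras

end

/-! Write Ω for the vacuum of H_{p,p}, the unit of the summand A_p that belongs to the empty path.
An operator u_e acts on an elementary tensor by adding a tensor factor, except for a term that
removes one; this term carries the factor E(a) for the first letter a after a backtracking. In a
reduced word that factor is zero each time, so a₀u_{e₁}a₁⋯u_{eₙ}aₙ sends Ω to ρ(a₀)η ⊗ ⋯ ⊗ ρ(aₙ₋₁)η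
⊗ aₙ (`redHom_eval_vacuum`). Conjugation by tree unitaries does not disturb this, because the
unitaries cancel between neighbouring letters (`redHom_eval`).

Existence and injectivity: the vector map x ↦ ⟨Ω, λ_p(x)Ω⟩ returns a for a ∈ A_p and vanishes on
reduced operators from p to p, which send Ω to other summands. It extends to P_vert, and being a
left inverse of A_p → P_vert it makes that map injective.

Uniqueness: A_p and the reduced operators from p to p span a dense subspace of P (`dense_redSpan`).
Left multiplication by a generator preserves the span after splitting a letter b into b - E(b) and
E(b), and the base vertex can be moved for free because u_e = 1 on the tree. So the composition of a
canonical ucp map with P → C is the same map on P for every C (`IsCanonicalUCP.apply_eq`).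

GNS-faithfulness: Ω is cyclic, so the matrix coefficients of λ_p(z) are the values 𝔼_p(a⋆zb). If all
of them vanish for all p, every λ_p(z) is zero, and so is z (`eq_zero_of_vertExp_eq_zero`).

Universal property: by GNS-faithfulness, π(x) = 0 exactly when E_p(π(a⋆xb)) = 0 for all p, a, b.
These values do not depend on π, so π and λ have the same kernel. The norm of the image under a
⋆-homomorphism depends only on the kernel (`StarAlgHom.norm_apply_le_of_ker_le`), hence ‖π(x)‖ =
‖λ(x)‖ and π factors through an isometry of P_vert onto C. -/

noncomputable section

/-! ### Functional calculus in C⋆-algebras -/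

/-- A ⋆-homomorphism with a larger kernel gives a smaller C⋆-seminorm. -/
theorem StarAlgHom.norm_apply_le_of_ker_le {P D D' : Type*} [CStarAlgebra P] [CStarAlgebra D]
    [CStarAlgebra D'] (φ : P →⋆ₐ[ℂ] D) (ψ : P →⋆ₐ[ℂ] D') (h : ∀ x, ψ x = 0 → φ x = 0) (x : P) :
    ‖φ x‖ ≤ ‖ψ x‖ := by
  set a : P := star x * x with ha_def
  have ha : IsSelfAdjoint a := IsSelfAdjoint.star_mul_self x
  have hφa : IsSelfAdjoint (φ a) := ha.map φ
  have hψa : IsSelfAdjoint (ψ a) := ha.map ψ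
  have hcφ : Continuous φ := map_continuous φ
  have hcψ : Continuous ψ := map_continuous ψ
  set r : ℝ := ‖ψ a‖ with hr
  -- This f vanishes exactly on (-∞, r]. Since the spectrum of ψ(a) lies there, f(a) is in the
  -- kernel of ψ, hence of φ; then f(φ(a)) = 0 forces the spectrum of φ(a) into (-∞, r] as well.
  -- Positivity of φ(a) turns this into a norm bound.
  set f : ℝ → ℝ := fun t => max (t - r) 0 with hf
  have hfc : Continuous f := by fun_prop
  have h1 : ψ (cfc f a) = 0 := by
    rw [StarAlgHomClass.map_cfc ψ f a hfc.continuousOn hcψ ha hψa, ← cfc_zero ℝ (ψ a)]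
    refine cfc_congr fun t ht => ?_
    have := (le_algebraMap_iff_spectrum_le hψa).1 hψa.le_algebraMap_norm_self t ht
    exact max_eq_right (sub_nonpos.2 this)
  have h2 : cfc f (φ a) = cfc (0 : ℝ → ℝ) (φ a) := by
    rw [cfc_zero ℝ (φ a), ← StarAlgHomClass.map_cfc φ f a hfc.continuousOn hcφ ha hφa, h _ h1]
  have h3 := eqOn_of_cfc_eq_cfc h2 hfc.continuousOn continuousOn_const hφa
  have h4 : ‖φ a‖ ≤ r := by
    have h0 : 0 ≤ φ a := by rw [ha_def, map_mul, map_star]; exact star_mul_self_nonneg _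
    rw [CStarAlgebra.norm_le_iff_le_algebraMap _ (norm_nonneg _) h0,
      le_algebraMap_iff_spectrum_le hφa]
    intro t ht
    exact sub_nonpos.1 (max_eq_right_iff.1 (h3 ht))
  rw [hr, ha_def, map_mul, map_mul, map_star, map_star, CStarRing.norm_star_mul_self,
    CStarRing.norm_star_mul_self] at h4
  exact abs_le_of_sq_le_sq' (by rwa [sq, sq]) (norm_nonneg _) |>.2

/-- The compression of a self-adjoint element by its negative part. -/
theorem exists_conjugate_eq_neg {A : Type*} [NonUnitalCStarAlgebra A] [PartialOrder A]
    [StarOrderedRing A] {M : A} (hM : IsSelfAdjoint M) :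
    ∃ N K : A, star N = N ∧ N * M * N = -(star K * K) ∧ (K = 0 → 0 ≤ M) := by
  have hN0 : 0 ≤ M⁻ := CFC.negPart_nonneg M
  have hNs : star M⁻ = M⁻ := hN0.isSelfAdjoint
  obtain ⟨b, hb⟩ := exists_eq_star_mul_self hN0
  refine ⟨M⁻, b * M⁻, hNs, ?_, fun h => ?_⟩
  -- The product of the negative and the positive part is zero. Thus N M N = -N³ for N = M⁻, and N =
  -- b⋆b makes this -(bN)⋆(bN).
  · have h1 : M⁻ * M = -(M⁻ * M⁻) := by
      conv_lhs => rw [← CFC.posPart_sub_negPart M hM]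
      rw [mul_sub, CFC.posPart_sub_negPart M hM, CFC.negPart_mul_posPart, zero_sub]
    rw [h1, star_mul, hNs, mul_assoc M⁻ (star b), ← mul_assoc (star b), ← hb, neg_mul, mul_assoc]
  -- If bN = 0 then N² = b⋆(bN) = 0, so the negative part is zero.
  · refine CStarAlgebra.nonneg_iff_isSelfAdjoint_and_negPart_eq_zero.2 ⟨hM, ?_⟩
    rw [← CStarRing.star_mul_self_eq_zero_iff, hNs]
    nth_rw 1 [hb]
    rw [mul_assoc, h, mul_zero]

/-! ### Positive matrices and Gram matrices -/

namespace CStarMatrix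

variable {A ι : Type*} [CStarAlgebra A] [Fintype ι]

/-- A self-adjoint matrix is positive if its quadratic form is. -/
theorem nonneg_of_forall_sum_nonneg {M : CStarMatrix ι ι A} (hM : IsSelfAdjoint M)
    (h : ∀ c : ι → A, 0 ≤ ∑ i, ∑ j, star (c i) * M i j * c j) : 0 ≤ M := by
  classical
  obtain ⟨N, K, hNs, h1, hK⟩ := exists_conjugate_eq_neg hM
  refine hK ?_
  -- The diagonal entry (j, j) of N M N = -K⋆K is on one side the quadratic form of M at the j-th
  -- column of N, hence nonnegative, and on the other side minus a sum of squares. So column j of K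
  -- is zero.
  have h3 : ∀ j, ∑ k, star (K k j) * K k j = 0 := fun j => by
    refine le_antisymm ?_ (Finset.sum_nonneg fun k _ => star_mul_self_nonneg _)
    have h4 := congrFun (congrFun h1 j) j
    have h5 : (N * M * N) j j = ∑ i, ∑ k, star (N i j) * M i k * N k j := by
      simp only [CStarMatrix.mul_apply, Finset.sum_mul]
      rw [Finset.sum_comm]
      refine Finset.sum_congr rfl fun i _ => Finset.sum_congr rfl fun k _ => ?_
      rw [← CStarMatrix.star_apply, hNs]
    have h6 : (-(star K * K)) j j = -∑ k, star (K k j) * K k j := by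
      change -((star K * K) j j) = _
      rw [CStarMatrix.mul_apply]
      simp only [CStarMatrix.star_apply]
    have h7 := h fun i => N i j
    rw [← h5, h4, h6] at h7
    exact neg_nonneg.1 h7
  ext k j
  have h4 := (Finset.sum_eq_zero_iff_of_nonneg fun k _ =>
    star_mul_self_nonneg (K k j)).1 (h3 j) k (Finset.mem_univ k)
  exact CStarRing.star_mul_self_eq_zero_iff _ |>.1 h4

end CStarMatrix

namespace PreHilbertModule

variable {A E ι : Type*} [CStarAlgebra A] [AddCommGroup E] [Module ℂ E] [Module Aᵐᵒᵖ E]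
  [PreHilbertModule A E]

theorem inner_sum_right (s : Finset ι) (x : E) (y : ι → E) :
    inner A x (∑ i ∈ s, y i) = ∑ i ∈ s, inner A x (y i) := map_sum (innerₗ x) y s

theorem inner_sum_left (s : Finset ι) (x : ι → E) (y : E) :
    inner A (∑ i ∈ s, x i) y = ∑ i ∈ s, inner A (x i) y := by
  rw [← star_inner, inner_sum_right, star_sum]
  simp only [star_inner]

/-- Gram matrices of vectors of a Hilbert module are positive. -/
theorem gram_nonneg [Fintype ι] (x : ι → E) :
    0 ≤ (CStarMatrix.ofMatrix (Matrix.of fun i j => inner A (x i) (x j)) :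
      CStarMatrix ι ι A) := by
  refine CStarMatrix.nonneg_of_forall_sum_nonneg ?_ fun c => ?_
  · ext i j
    exact star_inner (x j) (x i)
  -- The quadratic form of the Gram matrix at c is the inner square of ∑ xᵢ cᵢ.
  · have h := inner_self_nonneg (A := A) (∑ i, MulOpposite.op (c i) • x i)
    simp only [inner_sum_left, inner_sum_right, inner_op_smul_left, inner_op_smul_right] at h
    simp only [Finset.sum_mul] at h
    rw [Finset.sum_comm] at h
    exact h

end PreHilbertModule

/-! ### Vector maps of representations on Hilbert modules -/

namespace Adjointable

variable {A E F D : Type*} [CStarAlgebra A] [CStarAlgebra D]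
    [NormedAddCommGroup E] [NormedSpace ℂ E] [Module Aᵐᵒᵖ E] [HilbertModule A E]
    [NormedAddCommGroup F] [NormedSpace ℂ F] [Module Aᵐᵒᵖ F] [HilbertModule A F]

/-- Right linearity is not part of the structure `Adjointable`; it is forced by the existence of an
adjoint and the nondegeneracy of the inner product. -/
theorem toCLM_op_smul (T : Adjointable A E F) (a : A) (x : E) :
    T.toCLM (MulOpposite.op a • x) = MulOpposite.op a • T.toCLM x := by
  refine HilbertModule.ext_inner A fun z => ?_
  rw [← T.inner_adj', PreHilbertModule.inner_op_smul_right,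
    PreHilbertModule.inner_op_smul_right, T.inner_adj']

/-- It serves twice: it exhibits the matrices arising from a vector map as sums of Gram matrices,
and later it reads the values of a vector map at a⋆zb as matrix coefficients of z. -/
theorem inner_map_star_mul (ρ : D →⋆ₐ[ℂ] Adjointable A E E) (a b : D) (ξ ζ : E) :
    inner A ξ ((ρ (star a * b)).toCLM ζ) = inner A ((ρ a).toCLM ξ) ((ρ b).toCLM ζ) := by
  rw [map_mul, map_star, (ρ a).inner_adj]
  rfl

/-- The completely positive map `x ↦ ⟨ξ, ρ(x) ξ⟩` given by a representation `ρ` on a Hilbert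
module and a vector `ξ`. -/
def vectorMap (ρ : D →⋆ₐ[ℂ] Adjointable A E E) (ξ : E) : D →CP A where
  toFun x := inner A ξ ((ρ x).toCLM ξ)
  map_add' x y := by
    rw [map_add]
    exact PreHilbertModule.inner_add_right _ _ _
  map_smul' c x := by
    rw [map_smul]
    exact PreHilbertModule.inner_smul_right _ _ _
  map_cstarMatrix_nonneg' k M hM := by
    obtain ⟨N, hN⟩ := CStarMatrix.exists_gram hM
    -- With M = N⋆N, the matrix of the ⟨ξ, ρ(M i j) ξ⟩ is the sum over l of the Gram matrices of the
    -- vectors ρ(N l i) ξ, one for each row l of N.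
    have h : 0 ≤ ∑ l, (CStarMatrix.ofMatrix (Matrix.of fun i j =>
        inner A ((ρ (N l i)).toCLM ξ) ((ρ (N l j)).toCLM ξ)) : CStarMatrix (Fin k) (Fin k) A) :=
      Finset.sum_nonneg fun l _ => PreHilbertModule.gram_nonneg _
    convert h using 1
    have hsum : ∀ (s : Finset (Fin k)) (f : Fin k → CStarMatrix (Fin k) (Fin k) A) (i j : Fin k),
        (∑ l ∈ s, f l) i j = ∑ l ∈ s, f l i j := fun s f i j => by
      induction s using Finset.cons_induction with
      | empty => rfl
      | cons a s ha ih => rw [Finset.sum_cons, Finset.sum_cons, ← ih]; rfl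
    ext i j
    rw [hsum]
    change inner A ξ ((ρ (M i j)).toCLM ξ) = ∑ l, inner A ((ρ (N l i)).toCLM ξ)
      ((ρ (N l j)).toCLM ξ)
    simp only [← inner_map_star_mul]
    rw [hN, map_sum, ← PreHilbertModule.inner_sum_right]
    congr 1
    -- Evaluation of operators at ξ, bundled as an additive map so that it passes through the sum.
    exact map_sum ({ toFun := fun T => T.toCLM ξ, map_zero' := rfl, map_add' := fun _ _ => rfl } :
      Adjointable A E E →+ E) _ _

theorem vectorMap_apply (ρ : D →⋆ₐ[ℂ] Adjointable A E E) (ξ : E) (x : D) :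
    vectorMap ρ ξ x = inner A ξ ((ρ x).toCLM ξ) := rfl

end Adjointable

/-! ### The kernel of a GNS representation -/

namespace CompletelyPositiveMap

variable {D B : Type*} [CStarAlgebra D] [CStarAlgebra B] (φ : D →CP B)

theorem continuous_apply : Continuous φ := map_continuous φ

/-- The numbers on the right are the matrix coefficients of the operator between the generators of
the GNS module, and an adjointable operator is determined by these. GNS-faithfulness thereby becomes
a condition on values of the maps alone, which can be compared between different algebras. -/
theorem gnsRep_eq_zero_iff (x : D) : φ.gnsRep x = 0 ↔ ∀ a b : D, φ (star a * (x * b)) = 0 := by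
  have h : ∀ a b : D, inner B (φ.gnsKernel.gen a) ((φ.gnsRep x).toCLM (φ.gnsKernel.gen b)) =
      φ (star a * (x * b)) := fun a b => PosDefKernel.PreRep.inner_toHom_gen _ x a b
  constructor
  · intro hx a b
    rw [← h, hx]
    exact PreHilbertModule.inner_zero_right _
  · intro hx
    refine PosDefKernel.adjointable_ext fun b a => ?_
    rw [h, hx]
    exact (PreHilbertModule.inner_zero_right _).symm

end CompletelyPositiveMap

namespace GraphOfCStarAlgebras

variable {V : Type u} [Quiver.{v} V] [Quiver.HasInvolutiveReverse V]
  {G : GraphOfCStarAlgebras.{u, v, w, x} V} (T : MaximalSubtree V) (𝓔 : G.CondExps)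

/-! ### Reduced operators are total in the maximal algebra -/

section maximal

variable (G)

theorem ofEdge_tree {q q' : V} (e : q ⟶ q') (he : T.Mem e) : G.ofEdge T e = 1 := by
  have h := Admissible.toCompletion_eq ⟨G.maxSeminorm T, G.maxSeminorm_vanish T⟩ (.tree e he)
  exact h.trans (map_one _)

/-- The reverse edge is a variable with an equation because the relation is needed for ē in the role
of e, and the reverse of ē is e only up to a propositional equality. -/
theorem ofEdge_mul_ofVertex_mul_ofEdge {q q' : V} (e : q ⟶ q') (f : q' ⟶ q)
    (hf : f = Quiver.reverse e) (b : G.B e) :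
    G.ofEdge T f * ofVertex T q (G.s e b) * G.ofEdge T e = ofVertex T q' (G.r e b) := by
  subst hf
  have h := Admissible.toCompletion_eq ⟨G.maxSeminorm T, G.maxSeminorm_vanish T⟩ (.edge e b)
  rw [map_mul, map_mul] at h
  exact h

variable {G}

/-- The span in the maximal fundamental C⋆-algebra of the elements given by the reduced words with
a path from `q` to `p`. -/
def redSpan (p q : V) : Submodule ℂ (G.MaxAlg T) :=
  Submodule.span ℂ {z | ∃ (s : G.Word p q) (y : G.A p), s.Reduced 𝓔 ∧ s.eval T y = z}

variable {T 𝓔}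

theorem Word.reduced_nil {p : V} : (Word.nil : G.Word p p).Reduced 𝓔 := by
  rw [Word.Reduced]
  trivial

theorem Word.Reduced.eval_mem {p q : V} {s : G.Word p q} (h : s.Reduced 𝓔) (y : G.A p) :
    s.eval T y ∈ redSpan T 𝓔 p q :=
  Submodule.subset_span ⟨s, y, h, rfl⟩

theorem mul_mem_of_forall_eval {p q q' : V} (c : G.MaxAlg T)
    (h : ∀ (s : G.Word p q) (y : G.A p), s.Reduced 𝓔 → c * s.eval T y ∈ redSpan T 𝓔 p q')
    {z : G.MaxAlg T} (hz : z ∈ redSpan T 𝓔 p q) : c * z ∈ redSpan T 𝓔 p q' := by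
  induction hz using Submodule.span_induction with
  | mem z hz =>
    obtain ⟨s, y, hs, rfl⟩ := hz
    exact h s y hs
  | zero =>
    rw [mul_zero]
    exact zero_mem _
  | add z z' _ _ h h' =>
    rw [mul_add]
    exact add_mem h h'
  | smul a z _ h =>
    rw [mul_smul_comm]
    exact Submodule.smul_mem _ a h

/-- The factor is absorbed in the first letter, on which no reducedness condition depends, or in the
last factor y when the word is empty. -/
theorem ofVertex_mul_mem {p q : V} (a : G.A q) {z : G.MaxAlg T} (hz : z ∈ redSpan T 𝓔 p q) :
    ofVertex T q a * z ∈ redSpan T 𝓔 p q := by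
  refine mul_mem_of_forall_eval _ (fun s y hs => ?_) hz
  cases s with
  | nil =>
    rw [Word.eval, ← map_mul]
    exact hs.eval_mem (a * y)
  | cons b e t =>
    rw [Word.eval, ← mul_assoc, ← mul_assoc, ← map_mul]
    exact Word.Reduced.eval_mem (hs.change (a * b)) y

/-- The only obstruction is a word that begins with f = ē. Its first letter b is the sum of b -
E(b), for which the longer word is again reduced, and of an element s_f(β), for which u_e s_f(β) u_f
= r_f(β) cancels both edges and leaves an element of A q in front of the tail. This mirrors the two
terms in the definition of the operators u_e on the Hilbert modules. -/
theorem ofEdge_mul_mem {p q q' : V} (e : q ⟶ q') {z : G.MaxAlg T}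
    (hz : z ∈ redSpan T 𝓔 p q') : G.ofEdge T e * z ∈ redSpan T 𝓔 p q := by
  refine mul_mem_of_forall_eval _ (fun s y hs => ?_) hz
  by_cases h : s.Begins (Quiver.reverse e)
  · obtain ⟨b, t, rfl⟩ := h
    set f := Quiver.reverse e with hf
    have h1 : (Word.cons (cen 𝓔 f b) f t).eval T y = (Word.cons b f t).eval T y -
        ofVertex T q' (G.s f (𝓔.E f b)) * G.ofEdge T f * t.eval T y := by
      rw [Word.eval, Word.eval, cen, map_sub, sub_mul, sub_mul]
    have h2 : G.ofEdge T e * (Word.cons b f t).eval T y =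
        (Word.cons 1 e (Word.cons (cen 𝓔 f b) f t)).eval T y +
          ofVertex T q (G.r f (𝓔.E f b)) * t.eval T y := by
      have h3 : (Word.cons 1 e (Word.cons (cen 𝓔 f b) f t)).eval T y =
          G.ofEdge T e * (Word.cons (cen 𝓔 f b) f t).eval T y := by
        rw [Word.eval, map_one, one_mul]
      -- The element r_f(β) is expanded back to u_e s_f(β) u_f, so that it cancels the correction
      -- term of the centred letter.
      rw [h3, h1, mul_sub,
        ← ofEdge_mul_ofVertex_mul_ofEdge G T f e (Quiver.reverse_reverse e).symm]
      simp only [mul_assoc, sub_add_cancel]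
    rw [h2]
    exact add_mem (Word.Reduced.eval_mem (hs.prefix_cen hf 1) y)
      (ofVertex_mul_mem _ (hs.tail.eval_mem y))
  -- Without backtracking the word remains reduced after prefixing e, with the letter 1 in front.
  · have h1 := Word.Reduced.eval_mem (T := T) (hs.prefix rfl h (1 : G.A q)) y
    rwa [Word.eval, map_one, one_mul] at h1

/-- Multiplication by u_e for an edge e of the tree moves the initial vertex of the words, while the
element itself is unchanged because u_e = 1. -/
theorem mem_redSpan_of_edgesIn {p q q' : V} (l : EdgePath q' q) (hl : l.EdgesIn T.Mem)
    {z : G.MaxAlg T} (hz : z ∈ redSpan T 𝓔 p q') : z ∈ redSpan T 𝓔 p q := by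
  induction l with
  | nil => exact hz
  | cons e l ih =>
    have h := ofEdge_mul_mem e (ih hl.2)
    rwa [ofEdge_tree G T e hl.1, one_mul] at h

/-- Any two vertices are joined inside the tree, so as a subspace of the maximal algebra the span
does not depend on the initial vertex. -/
theorem mem_redSpan {p q q' : V} {z : G.MaxAlg T} (hz : z ∈ redSpan T 𝓔 p q') :
    z ∈ redSpan T 𝓔 p q :=
  mem_redSpan_of_edgesIn _ (geodesic_edgesIn T q' q) hz

theorem toCompletion_mem_redSpan (p : V) (x : G.FreeAlg) :
    (G.maxSeminorm T).toCompletion x ∈ redSpan T 𝓔 p p := by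
  -- Membership of x alone is not stable under products; the property that passes through the
  -- induction is that left multiplication by x preserves the span. It is applied at the end to the
  -- unit, which is the value of the empty word.
  have key : ∀ z ∈ redSpan T 𝓔 p p,
      (G.maxSeminorm T).toCompletion x * z ∈ redSpan T 𝓔 p p := by
    induction x using FreeStarAlg.induction with
    | h1 c =>
      intro z hz
      rw [AlgHomClass.commutes, ← Algebra.smul_def]
      exact Submodule.smul_mem _ c hz
    | h2 g =>
      intro z hz
      cases g with
      -- A generator at another vertex acts after a change of the initial vertex to its source, and
      -- the result is carried back to p.
      | elt q a => exact mem_redSpan (ofVertex_mul_mem a (mem_redSpan hz))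
      | edge e => exact mem_redSpan (ofEdge_mul_mem e (mem_redSpan hz))
    | h3 a b ha hb =>
      intro z hz
      rw [map_mul, mul_assoc]
      exact ha _ (hb z hz)
    | h4 a b ha hb =>
      intro z hz
      rw [map_add, add_mul]
      exact add_mem (ha z hz) (hb z hz)
  have h1 : (1 : G.MaxAlg T) ∈ redSpan T 𝓔 p p := by
    rw [← map_one (ofVertex T p)]
    exact Word.Reduced.eval_mem Word.reduced_nil 1
  simpa using key 1 h1

-- The span contains the image of the free ⋆-algebra, which is dense in its completion. Since the
-- empty word contributes A p and the other words from p to p contribute the reduced operators, a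
-- continuous linear map is determined by exactly the data that a canonical ucp map prescribes.
variable (T 𝓔) in
theorem dense_redSpan (p : V) : Dense (redSpan T 𝓔 p p : Set (G.MaxAlg T)) :=
  (G.maxSeminorm T).denseRange_toCompletion.mono
    (Set.range_subset_iff.2 (toCompletion_mem_redSpan p))

/-- The canonical ucp map is determined on the maximal fundamental C⋆-algebra. -/
theorem IsCanonicalUCP.apply_eq {C C' : Type*} [CStarAlgebra C] [CStarAlgebra C']
    {π : G.MaxAlg T →⋆ₐ[ℂ] C} {π' : G.MaxAlg T →⋆ₐ[ℂ] C'} {p : V} {E : C →CP G.A p}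
    {E' : C' →CP G.A p} (h : IsCanonicalUCP 𝓔 π p E) (h' : IsCanonicalUCP 𝓔 π' p E')
    (z : G.MaxAlg T) : E (π z) = E' (π' z) := by
  have hc : Continuous fun z => E (π z) := E.continuous_apply.comp (map_continuous π)
  have hc' : Continuous fun z => E' (π' z) := E'.continuous_apply.comp (map_continuous π')
  refine congrFun (hc.ext_on (dense_redSpan T 𝓔 p) hc' fun z hz => ?_) z
  dsimp only
  induction hz using Submodule.span_induction with
  | mem z hz =>
    obtain ⟨s, y, hs, rfl⟩ := hz
    -- The empty word gives an element of A p, with the value y for both maps; every other word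
    -- gives a reduced operator, with the value 0.
    by_cases h1 : s = .nil
    · subst h1
      exact (h.map_vertex y).trans (h'.map_vertex y).symm
    · rw [h.map_reduced s y h1 hs, h'.map_reduced s y h1 hs]
  | zero => simp only [map_zero]
  | add z z' _ _ h h' => simp only [map_add, h, h']
  | smul a z _ h => simp only [map_smul, h]

end maximal

/-! ### The action of reduced words on the vacuum -/

section reduced

variable {T}

/-- At the base vertex the conjugating path operator is therefore the identity, and λ_p restricts to
the left action itself on A p. -/
theorem geodesic_self (p : V) : T.geodesic p p = .nil :=
  (eq_geodesic T .nil (by rw [EdgePath.EdgesIn]; trivial)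
    (by rw [EdgePath.NoBacktrack]; trivial)).symm

/-- The operator from `H_{p,p}` to `H_{q,p}` given by a word with a path from `q` to `p` and an
element of `A p`. -/
def wordOp {p : V} : ∀ {q : V}, G.Word p q → G.A p →
    Adjointable (G.A p) (HMod 𝓔 p p) (HMod 𝓔 p q)
  | _, .nil, y => leftAction 𝓔 p p y
  | q, .cons a e t, y => (leftAction 𝓔 p q a).comp ((edgeOp 𝓔 p e).comp (wordOp t y))

theorem redHom_ofVertex (p q : V) (a : G.A q) :
    redHom T 𝓔 p (ofVertex T q a) = (pathOp 𝓔 p (T.geodesic p q)).adjoint.comp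
      ((leftAction 𝓔 p q a).comp (pathOp 𝓔 p (T.geodesic p q))) :=
  Rep.hom_ofVertex _ a

theorem redHom_ofVertex_self (p : V) (a : G.A p) :
    redHom T 𝓔 p (ofVertex T p a) = leftAction 𝓔 p p a := by
  rw [redHom_ofVertex, geodesic_self]
  rfl

/-- Each letter and each edge is represented with a geodesic unitary on its right and the adjoint of
one on its left. At every vertex between two factors the geodesic is the same, so the unitary and
the adjoint cancel and only the leftmost adjoint survives; the one at the end is trivial because the
geodesic from p to p is empty. -/
theorem redHom_eval {p q : V} (s : G.Word p q) (y : G.A p) :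
    redHom T 𝓔 p (s.eval T y) =
      (pathOp 𝓔 p (T.geodesic p q)).adjoint.comp (wordOp 𝓔 s y) := by
  induction s with
  | nil =>
    rw [Word.eval, redHom_ofVertex_self, geodesic_self]
    rfl
  | @cons q q' a e t ih =>
    have h1 : redHom T 𝓔 p (G.ofEdge T e) = (pathOp 𝓔 p (T.geodesic p q)).adjoint.comp
        ((edgeOp 𝓔 p e).comp (pathOp 𝓔 p (T.geodesic p q'))) := Rep.hom_ofEdge _ e
    -- The cancellation between neighbouring factors. It is used once at q and once at q'.
    have h2 : ∀ (r : V) (S : Adjointable (G.A p) (HMod 𝓔 p p) (HMod 𝓔 p r)),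
        (pathOp 𝓔 p (T.geodesic p r)).comp ((pathOp 𝓔 p (T.geodesic p r)).adjoint.comp S) = S :=
      fun r S => by rw [← Adjointable.comp_assoc, pathOp_comp_adjoint, Adjointable.id_comp]
    rw [Word.eval, map_mul, map_mul, ih, redHom_ofVertex, h1, wordOp, Adjointable.mul_eq_comp,
      Adjointable.mul_eq_comp]
    simp only [Adjointable.comp_assoc]
    rw [h2, h2]

/-- For a nonempty word this element of the free module is the generator of a word with first letter
0, which is not zero there; it becomes zero only in the separated completion. -/
theorem toMod_act_zero {p q : V} (s : G.RedWord 𝓔 p q) :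
    (kernel 𝓔 p q).toMod (act 𝓔 0 s) = 0 := by
  rw [← leftAction_gen, map_zero]
  rfl

/-- The vector `1` in the summand `A p` of the empty path in `H_{p,p}`. -/
def vacuum (p : V) : HMod 𝓔 p p := (kernel 𝓔 p p).gen ⟨.nil, Word.reduced_nil⟩

/-- The vector of a reduced word is built up from the vacuum from right to left: every u_e only adds
the tensor factor η, and the letter in front of it then replaces η by ρ(a)η. On the vacuum itself,
left multiplication by y is the same as right multiplication, since both take place in A p. -/
theorem wordOp_vacuum {p q : V} (s : G.Word p q) (hs : s.Reduced 𝓔) (y : G.A p) :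
    (wordOp 𝓔 s y).toCLM (vacuum 𝓔 p) = MulOpposite.op y • (kernel 𝓔 p q).gen ⟨s, hs⟩ := by
  induction s with
  | nil =>
    rw [wordOp, vacuum, leftAction_gen, act_nil, PosDefKernel.toMod_single]
  | @cons q q' a e t ih =>
    have h1 : (edgeOp 𝓔 p e).toCLM ((kernel 𝓔 p q').gen ⟨t, hs.tail⟩) =
        (kernel 𝓔 p q).gen ⟨.cons 1 e t, hs.change 1⟩ := by
      rw [edgeOp_gen]
      by_cases h : t.Begins (Quiver.reverse e)
      · obtain ⟨b, t', rfl⟩ := h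
        -- Reducedness of the whole word enters here: if the tail begins with ē, its first letter is
        -- already centred, so the tail is unchanged by centring and the term that removes a tensor
        -- factor is zero.
        have h2 : 𝓔.E (Quiver.reverse e) b = 0 := hs.head rfl
        have h3 : cen 𝓔 (Quiver.reverse e) b = b := by rw [cen, h2, map_zero, sub_zero]
        rw [edgeAct_cons, map_add, h2, map_zero, toMod_act_zero, add_zero, PosDefKernel.gen]
        simp only [h3]
      · rw [edgeAct_of_not _ _ _ _ _ h, PosDefKernel.gen]
    change (leftAction 𝓔 p q a).toCLM ((edgeOp 𝓔 p e).toCLM ((wordOp 𝓔 t y).toCLM _)) = _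
    -- The right factor y moves past all operators by right linearity, which leaves only the action
    -- on generators.
    rw [ih hs.tail, Adjointable.toCLM_op_smul, h1, Adjointable.toCLM_op_smul, leftAction_gen,
      act_cons, PosDefKernel.gen]
    simp only [mul_one]

-- For y = 1 every generator of H_{p,p} is obtained, so the vacuum is cyclic. For general y the
-- formula reduces the vector map of the vacuum on reduced operators to orthogonality of the
-- summands.
variable (T) in
theorem redHom_eval_vacuum {p : V} (s : G.Word p p) (hs : s.Reduced 𝓔) (y : G.A p) :
    (redHom T 𝓔 p (s.eval T y)).toCLM (vacuum 𝓔 p) =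
      MulOpposite.op y • (kernel 𝓔 p p).gen ⟨s, hs⟩ := by
  rw [redHom_eval, geodesic_self, ← wordOp_vacuum]
  rfl

theorem inner_vacuum_gen {p : V} (s : G.Word p p) (hs : s.Reduced 𝓔) (h : s ≠ .nil) :
    inner (G.A p) (vacuum 𝓔 p) ((kernel 𝓔 p p).gen ⟨s, hs⟩) = 0 := by
  rw [vacuum, PosDefKernel.inner_gen]
  change Word.nil.coef 𝓔 s 1 = 0
  cases s with
  | nil => exact absurd rfl h
  | cons a e t => rw [Word.coef_nil_cons]

theorem inner_vacuum_vacuum (p : V) : inner (G.A p) (vacuum 𝓔 p) (vacuum 𝓔 p) = 1 := by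
  rw [vacuum, PosDefKernel.inner_gen]
  exact Word.coef_nil_nil 𝓔 1

/-! ### The vertex-reduced algebra and its canonical ucp maps -/

variable (T)

/-- The extension of `λ_p` to the vertex-reduced fundamental C⋆-algebra. -/
def vertHom (p : V) : VertAlg T 𝓔 →⋆ₐ[ℂ] Adjointable (G.A p) (HMod 𝓔 p p) (HMod 𝓔 p p) :=
  (vertSeminorm T 𝓔).lift (redHom T 𝓔 p) fun z => le_ciSup (redHom_bddAbove T 𝓔 z) p

theorem vertHom_toVert (p : V) (z : G.MaxAlg T) :
    vertHom T 𝓔 p (toVert T 𝓔 z) = redHom T 𝓔 p z :=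
  CStarSeminorm.lift_toCompletion _ _ _ z

theorem norm_toVert (z : G.MaxAlg T) : ‖toVert T 𝓔 z‖ = ⨆ p : V, ‖redHom T 𝓔 p z‖ :=
  CStarSeminorm.norm_toCompletion _ z

theorem denseRange_toVert : DenseRange (toVert T 𝓔) :=
  CStarSeminorm.denseRange_toCompletion _

/-- The supremum formula for the norm is available only on the image of the maximal algebra, so it
is applied to approximants x of z: there λ_p(x) = λ_p(x - z) for all p, hence ‖x‖ ≤ ‖x - z‖. -/
theorem eq_zero_of_vertHom_eq_zero (z : VertAlg T 𝓔) (h : ∀ p, vertHom T 𝓔 p z = 0) : z = 0 := by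
  -- The inequality is closed in x, so it extends from the dense image to x = z, where the
  -- right-hand side is zero. One summand would be enough; the second is slack.
  have key : ∀ x : VertAlg T 𝓔, ‖x‖ ≤ ‖x - z‖ + ‖x - z‖ := fun x => by
    refine (vertSeminorm T 𝓔).induction₁ (p := fun x => ‖x‖ ≤ ‖x - z‖ + ‖x - z‖) x
      (isClosed_le (by fun_prop) (by fun_prop)) fun x => ?_
    change ‖toVert T 𝓔 x‖ ≤ ‖toVert T 𝓔 x - z‖ + ‖toVert T 𝓔 x - z‖
    have h1 : ‖toVert T 𝓔 x‖ ≤ ‖toVert T 𝓔 x - z‖ := by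
      rw [norm_toVert]
      -- The bound has to be nonnegative because the real supremum over an empty vertex set is 0.
      refine Real.iSup_le (fun p => ?_) (norm_nonneg _)
      rw [← vertHom_toVert, ← sub_zero (vertHom T 𝓔 p _), ← h p, ← map_sub]
      exact NonUnitalStarAlgHom.norm_apply_le (vertHom T 𝓔 p) _
    linarith [norm_nonneg (toVert T 𝓔 x - z)]
  have h1 := key z
  rw [sub_self, norm_zero, add_zero] at h1
  exact norm_le_zero_iff.1 h1

/-- The canonical ucp map `x ↦ ⟨Ω, λ_p(x) Ω⟩` of the vertex-reduced fundamental C⋆-algebra. -/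
def vertExp (p : V) : VertAlg T 𝓔 →CP G.A p :=
  Adjointable.vectorMap (vertHom T 𝓔 p) (vacuum 𝓔 p)

/-- An element a of A p sends the unit vector Ω to Ω a, whose inner product with Ω is a; a reduced
operator sends Ω to a summand of a nonempty path, which is orthogonal to Ω. -/
theorem isCanonicalUCP_vertExp (p : V) :
    IsCanonicalUCP 𝓔 (toVert T 𝓔) p (vertExp T 𝓔 p) where
  map_one := by
    rw [vertExp, Adjointable.vectorMap_apply, map_one]
    exact inner_vacuum_vacuum 𝓔 p
  map_vertex a := by
    rw [vertExp, Adjointable.vectorMap_apply, vertHom_toVert]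
    -- An element of A p is the value of the empty word, so the formula for words on the vacuum
    -- covers this case too.
    change inner _ _ ((redHom T 𝓔 p (Word.nil.eval T a)).toCLM _) = a
    rw [redHom_eval_vacuum T 𝓔 Word.nil Word.reduced_nil, PreHilbertModule.inner_op_smul_right]
    exact (congrArg (· * a) (inner_vacuum_vacuum 𝓔 p)).trans (one_mul a)
  map_reduced s y h hs := by
    rw [vertExp, Adjointable.vectorMap_apply, vertHom_toVert, redHom_eval_vacuum T 𝓔 s hs,
      PreHilbertModule.inner_op_smul_right, inner_vacuum_gen 𝓔 s hs h, zero_mul]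

/-- Since the vacuum is cyclic for each λ_p, these values contain all matrix coefficients of z
between generators of H_{p,p}. Testing only with a, b from the maximal algebra is less than
GNS-faithfulness asks for, and it is the form in which the values can be compared with those for
another quotient. -/
theorem eq_zero_of_vertExp_eq_zero (z : VertAlg T 𝓔)
    (h : ∀ (p : V) (a b : G.MaxAlg T),
      vertExp T 𝓔 p (star (toVert T 𝓔 a) * (z * toVert T 𝓔 b)) = 0) : z = 0 := by
  refine eq_zero_of_vertHom_eq_zero T 𝓔 z fun p => PosDefKernel.adjointable_ext fun s t => ?_
  -- Every generator is the image of the vacuum under its own word with last factor 1.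
  have h1 : ∀ s : G.RedWord 𝓔 p p, (kernel 𝓔 p p).gen s =
      (vertHom T 𝓔 p (toVert T 𝓔 (s.word.eval T 1))).toCLM (vacuum 𝓔 p) := fun s => by
    rw [vertHom_toVert, redHom_eval_vacuum T 𝓔 s.word s.reduced, MulOpposite.op_one, one_smul]
  have h2 := h p (t.word.eval T 1) (s.word.eval T 1)
  rw [vertExp, Adjointable.vectorMap_apply, Adjointable.inner_map_star_mul, map_mul, ← h1] at h2
  refine Eq.trans ?_ (h2.trans (PreHilbertModule.inner_zero_right _).symm)
  rw [h1 s]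
  rfl

theorem gnsFaithful_vertExp : GNSFaithful (vertExp T 𝓔) := fun z hz =>
  eq_zero_of_vertExp_eq_zero T 𝓔 z fun p _ _ =>
    ((vertExp T 𝓔 p).gnsRep_eq_zero_iff z).1 (hz p) _ _

theorem injective_toVert_ofVertex (p : V) :
    Function.Injective fun a : G.A p => toVert T 𝓔 (ofVertex T p a) :=
  Function.LeftInverse.injective (isCanonicalUCP_vertExp T 𝓔 p).map_vertex

/-! ### Comparison with other quotients -/

variable {T 𝓔}

/-- A GNS-faithful family of canonical ucp maps determines the norm. -/
theorem norm_eq_norm_toVert {C : Type*} [CStarAlgebra C] {π : G.MaxAlg T →⋆ₐ[ℂ] C}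
    (hπ : Function.Surjective π) {E : ∀ p : V, C →CP G.A p}
    (hE : ∀ p, IsCanonicalUCP 𝓔 π p (E p)) (hfaith : GNSFaithful E) (z : G.MaxAlg T) :
    ‖π z‖ = ‖toVert T 𝓔 z‖ := by
  -- Both sides are canonical ucp maps evaluated at the same element a⋆zb of the maximal algebra, so
  -- they agree. It follows that π and λ have the same kernel, and each inclusion of kernels gives
  -- one of the two norm inequalities.
  have key : ∀ (z : G.MaxAlg T) (p : V) (a b : G.MaxAlg T), E p (star (π a) * (π z * π b)) =
      vertExp T 𝓔 p (star (toVert T 𝓔 a) * (toVert T 𝓔 z * toVert T 𝓔 b)) := fun z p a b => by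
    simp only [← map_star, ← map_mul]
    exact (hE p).apply_eq (isCanonicalUCP_vertExp T 𝓔 p) _
  refine le_antisymm (StarAlgHom.norm_apply_le_of_ker_le _ _ (fun x hx => ?_) z)
    (StarAlgHom.norm_apply_le_of_ker_le _ _ (fun x hx => ?_) z)
  -- GNS-faithfulness in C tests with arbitrary elements of C; surjectivity of π lifts them to the
  -- maximal algebra.
  · refine hfaith _ fun p => ((E p).gnsRep_eq_zero_iff _).2 fun c d => ?_
    obtain ⟨a, rfl⟩ := hπ c
    obtain ⟨b, rfl⟩ := hπ d
    rw [key, hx, zero_mul, mul_zero, map_zero]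
  · refine eq_zero_of_vertExp_eq_zero T 𝓔 _ fun p a b => ?_
    rw [← key, hx, zero_mul, mul_zero, map_zero]

end reduced

end GraphOfCStarAlgebras

end

/-! ### The proposition -/

theorem proposition2p7 {V : Type u} [Quiver.{v} V] [Quiver.HasInvolutiveReverse V]
    (G : GraphOfCStarAlgebras.{u, v, w, x} V) (T : MaximalSubtree V) (𝓔 : G.CondExps) :
    (∀ p : V, Function.Injective
      fun a : G.A p => GraphOfCStarAlgebras.toVert T 𝓔 (GraphOfCStarAlgebras.ofVertex T p a)) ∧
    ∃ 𝔼 : ∀ p : V, GraphOfCStarAlgebras.VertAlg T 𝓔 →CP G.A p,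
      (∀ p : V, GraphOfCStarAlgebras.IsCanonicalUCP 𝓔 (GraphOfCStarAlgebras.toVert T 𝓔) p (𝔼 p) ∧
        ∀ F : GraphOfCStarAlgebras.VertAlg T 𝓔 →CP G.A p,
          GraphOfCStarAlgebras.IsCanonicalUCP 𝓔 (GraphOfCStarAlgebras.toVert T 𝓔) p F →
            F = 𝔼 p) ∧
      GNSFaithful 𝔼 ∧
      ∀ (C : Type y) [CStarAlgebra C] (π : G.MaxAlg T →⋆ₐ[ℂ] C), Function.Surjective π →
        ∀ E : ∀ p : V, C →CP G.A p,
          (∀ p : V, GraphOfCStarAlgebras.IsCanonicalUCP 𝓔 π p (E p)) → GNSFaithful E →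
            ∃ ν : GraphOfCStarAlgebras.VertAlg T 𝓔 ≃⋆ₐ[ℂ] C,
              (∀ z : G.MaxAlg T, ν (GraphOfCStarAlgebras.toVert T 𝓔 z) = π z) ∧
              (∀ ν' : GraphOfCStarAlgebras.VertAlg T 𝓔 ≃⋆ₐ[ℂ] C,
                (∀ z : G.MaxAlg T, ν' (GraphOfCStarAlgebras.toVert T 𝓔 z) = π z) → ν' = ν) ∧
              ∀ (p : V) (z : GraphOfCStarAlgebras.VertAlg T 𝓔), E p (ν z) = 𝔼 p z := by
  refine ⟨GraphOfCStarAlgebras.injective_toVert_ofVertex T 𝓔,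
    GraphOfCStarAlgebras.vertExp T 𝓔, fun p =>
      ⟨GraphOfCStarAlgebras.isCanonicalUCP_vertExp T 𝓔 p, fun F hF => ?_⟩,
    GraphOfCStarAlgebras.gnsFaithful_vertExp T 𝓔, ?_⟩
  · refine DFunLike.coe_injective (F.continuous_apply.ext_on
      (GraphOfCStarAlgebras.denseRange_toVert T 𝓔)
      (GraphOfCStarAlgebras.vertExp T 𝓔 p).continuous_apply ?_)
    rintro _ ⟨z, rfl⟩
    exact hF.apply_eq (GraphOfCStarAlgebras.isCanonicalUCP_vertExp T 𝓔 p) z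
  · intro C _ π hπ E hE hfaith
    have hn := GraphOfCStarAlgebras.norm_eq_norm_toVert hπ hE hfaith
    have hd := GraphOfCStarAlgebras.denseRange_toVert T 𝓔
    set ν₀ : GraphOfCStarAlgebras.VertAlg T 𝓔 →⋆ₐ[ℂ] C :=
      (GraphOfCStarAlgebras.vertSeminorm T 𝓔).lift π fun z =>
        (hn z).le.trans (CStarSeminorm.norm_toCompletion _ z).le
    have hν₀ : ∀ z, ν₀ (GraphOfCStarAlgebras.toVert T 𝓔 z) = π z :=
      CStarSeminorm.lift_toCompletion _ _ _
    -- The norms agree on the dense image of the maximal algebra, and both sides are continuous.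
    have hiso : Isometry ν₀ := by
      refine AddMonoidHomClass.isometry_of_norm ν₀ fun z => ?_
      refine congrFun ((map_continuous ν₀).norm.ext_on hd continuous_norm ?_) z
      rintro _ ⟨z, rfl⟩
      exact (congrArg norm (hν₀ z)).trans (hn z)
    -- Surjectivity comes from π alone: a preimage z of c under π gives the preimage λ(z). For λ
    -- only the density of its range is used.
    have hbij : Function.Bijective ν₀ :=
      ⟨hiso.injective, fun c => (hπ c).imp' _ fun z hz => (hν₀ z).trans hz⟩
    refine ⟨StarAlgEquiv.ofBijective ν₀ hbij, hν₀, fun ν' hν' => ?_, fun p => congrFun ?_⟩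
    · refine DFunLike.coe_injective ((map_continuous ν').ext_on hd (map_continuous ν₀) ?_)
      rintro _ ⟨z, rfl⟩
      exact (hν' z).trans (hν₀ z).symm
    -- On the image of λ, E_p ∘ ν is E_p ∘ π, which agrees with the canonical map because both are
    -- determined on the maximal algebra.
    · refine ((E p).continuous_apply.comp (map_continuous ν₀)).ext_on hd
        (GraphOfCStarAlgebras.vertExp T 𝓔 p).continuous_apply ?_
      rintro _ ⟨z, rfl⟩
      exact (congrArg (E p) (hν₀ z)).trans
        ((hE p).apply_eq (GraphOfCStarAlgebras.isCanonicalUCP_vertExp T 𝓔 p) z)
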